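/- Let $n\ge 2$ be an integer, $0<\lambda<1$, and let $M=\mathbb S^n\times\mathbb S^1$ be the Hopf manifold, identified with the quotient of $\mathbb R^n\times\mathbb R\setminus\{(0,0)\}$ (coordinates $(z,t)$) by the group generated by $\gamma(z,t)=(\lambda z,\lambda t)$, through the covering $p\mapsto\big(p/\|p\|,\exp(2\pi i\log\|p\|/\log\lambda)\big)$. The affine Reeb flow $\mathcal F$ is the one-dimensional foliation of $M$ induced by the $\gamma$-invariant foliation of $\mathbb R^n\times\mathbb R\setminus\{(0,0)\}$ by the integral curves of $\partial/\partial t$. Functions and forms are complex-valued and smooth; $C^\infty(N)$ carries its usual $C^\infty$ topology. For a compact manifold $N$, $\mathcal D'(N)$ is the topological dual of $C^\infty(N)$ with the weak topology. Let $\Omega^1_{\mathcal F}(M)$ be the space of leafwise $1$-forms (smooth sections of the dual of the tangent bundle $T\mathcal F$, with the $C^\infty$ topology), $d_{\mathcal F}f=df|_{T\mathcal F}$ for $f\in C^\infty(M)$, and $H^1_{\mathcal F}(M)=\Omega^1_{\mathcal F}(M)/d_{\mathcal F}(C^\infty(M))$ the first leafwise cohomology space, with the quotient topology. For a smooth vector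 field $X$ on $M$, let $\mathcal D'_X(M)\subset\mathcal D'(M)$ be the subspace of the distributions $T$ with $X\cdot T=0$, i.e. $\langle T,X\cdot\varphi\rangle=0$ for all $\varphi\in C^\infty(M)$. Then there is an isomorphism of topological vector spaces $\Psi:H^1_{\mathcal F}(M)\to C^\infty(\mathbb S^{n-1}\times\mathbb S^1)$ such that, for every smooth nowhere vanishing vector field $X$ on $M$ tangent to $\mathcal F$: 1. the natural map $T\mapsto\big([\alpha]\mapsto\langle T,\alpha(X)\rangle\big)$ is a well-defined isomorphism of topological vector spaces $\Phi$ from $\mathcal D'_X(M)$ onto the topological dual of $H^1_{\mathcal F}(M)$ (with the weak topology); 2. consequently $T\mapsto \Phi(T)\circ\Psi^{-1}$ is an isomorphism of topological vector spaces from $\mathcal D'_X(M)$ onto $\mathcal D'(\mathbb S^{n-1}\times\mathbb S^1)$. -/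

import Mathlib

open scoped Manifold ContDiff Topology

namespace ReebFlow

noncomputable section

section General

variable {E : Type*} [NormedAddCommGroup E] [NormedSpace ℝ E]
  {H : Type*} [TopologicalSpace H] {I : ModelWithCorners ℝ E H}
  {M : Type*} [TopologicalSpace M] [ChartedSpace H M]

/-! ### The topological vector space `C^∞(M)` of complex smooth functions -/

variable (I M) in
/-- Complex-valued smooth functions on the real manifold `M`. -/
abbrev SmoothFn : Type _ := C^∞⟮I, M; 𝓘(ℝ, ℂ), ℂ⟯

/-- Complex scalars act on complex-valued smooth functions pointwise. -/
instance : SMul ℂ (SmoothFn I M) where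
  smul c f := ⟨fun x => c • f x, (contDiff_const_smul c).contMDiff.comp f.contMDiff⟩

theorem smoothFn_smul_apply (c : ℂ) (f : SmoothFn I M) (x : M) : (c • f) x = c • f x := rfl

instance : Module ℂ (SmoothFn I M) where
  one_smul f := by ext x; simp [smoothFn_smul_apply]
  mul_smul a b f := by ext x; simp [smoothFn_smul_apply, mul_assoc]
  smul_zero a := by ext x; simp [smoothFn_smul_apply]
  smul_add a f g := by ext x; simp [smoothFn_smul_apply, mul_add]
  add_smul a b f := by ext x; simp [smoothFn_smul_apply, add_mul]
  zero_smul f := by ext x; simp [smoothFn_smul_apply]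

/-- The `C^∞` topology: uniform convergence of the derivatives of every order, in the charts of
the manifold, on every compact subset of the target of the chart. -/
instance [I.Boundaryless] : TopologicalSpace (SmoothFn I M) :=
  ⨅ (x : M) (k : ℕ), TopologicalSpace.induced
    (fun f : SmoothFn I M =>
      UniformOnFun.ofFun {K : Set E | IsCompact K ∧ K ⊆ (extChartAt I x).target}
        (iteratedFDeriv ℝ k (f ∘ (extChartAt I x).symm)))
    inferInstance

variable (I M) in
/-- Distributions on the (compact) manifold `M`: continuous linear forms on `C^∞(M)`,
with the weak topology. -/
abbrev Distribution [I.Boundaryless] : Type _ := WeakDual ℂ (SmoothFn I M)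

/-! ### Vector fields acting on functions -/

theorem mvfderiv_smul_complex (c : ℂ) (f : SmoothFn I M) (x : M) (v : TangentSpace I x) :
    mvfderiv I (c • f : SmoothFn I M) x v = c • mvfderiv I f x v := by
  have hf : MDifferentiableAt I 𝓘(ℝ, ℂ) f x := f.contMDiff.mdifferentiable (by simp) x
  have hcf : MDifferentiableAt I 𝓘(ℝ, ℂ) (c • f : SmoothFn I M) x :=
    (c • f : SmoothFn I M).contMDiff.mdifferentiable (by simp) x
  rw [hf.mvfderiv, hcf.mvfderiv]
  have h : fderivWithin ℝ (fun y => c • writtenInExtChartAt I 𝓘(ℝ, ℂ) x f y) (Set.range I)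
      (extChartAt I x x) = c • fderivWithin ℝ (writtenInExtChartAt I 𝓘(ℝ, ℂ) x f) (Set.range I)
      (extChartAt I x x) := 
    fderivWithin_fun_const_smul (I.uniqueDiffOn _ (Set.mem_range_self _))
      hf.differentiableWithinAt_writtenInExtChartAt c
  exact congrArg (fun L => L v) h

variable [IsManifold I ∞ M]

variable (I M) in
/-- Smooth (real) vector fields on `M`. -/
abbrev SmoothVF : Type _ := Cₛ^∞⟮I; E, (TangentSpace I : M → Type _)⟯

theorem contMDiff_deriv (Y : SmoothVF I M) (f : SmoothFn I M) :
    ContMDiff I 𝓘(ℝ, ℂ) ∞ (fun x => mvfderiv I f x (Y x)) := by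
  have h1 : ContMDiff I.tangent 𝓘(ℝ, ℂ).tangent ∞ (tangentMap I 𝓘(ℝ, ℂ) f) :=
    f.contMDiff.contMDiff_tangentMap (by simp)
  exact (contMDiff_snd_tangentBundle_modelSpace ℂ 𝓘(ℝ, ℂ)).comp (h1.comp Y.contMDiff)

/-- The first order differential operator `f ↦ Y · f`, `(Y · f)(x) = d_x f (Y_x)`. -/
def vfDeriv (Y : SmoothVF I M) : SmoothFn I M →ₗ[ℂ] SmoothFn I M where
  toFun f := ⟨fun x => mvfderiv I f x (Y x), contMDiff_deriv Y f⟩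
  map_add' f g := by
    ext x
    have hf := f.contMDiff.mdifferentiable (by simp) x
    have hg := g.contMDiff.mdifferentiable (by simp) x
    exact congrArg (fun L => L (Y x)) (mvfderiv_add hf hg)
  map_smul' c f := by
    ext x
    exact mvfderiv_smul_complex c f x (Y x)

/-- The space of distributions invariant by `X`: those `T` with `X · T = 0`, where
`⟨X · T, φ⟩ = - ⟨T, X · φ⟩`. -/
def invariantDistributions [I.Boundaryless] (X : SmoothVF I M) :
    Submodule ℂ (Distribution I M) where
  carrier := {T | ∀ φ : SmoothFn I M, -T (vfDeriv X φ) = 0}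
  zero_mem' φ := neg_zero
  add_mem' {S T} hS hT φ := by
    have hS' := hS φ
    have hT' := hT φ
    rw [neg_eq_zero] at *
    exact (congrArg₂ (· + ·) hS' hT').trans (add_zero 0)
  smul_mem' c T hT φ := by
    have hT' := hT φ
    rw [neg_eq_zero] at *
    exact (congrArg (c • ·) hT').trans (smul_zero c)

/-! ### Leafwise cohomology of a foliation by curves

`τ x ⊆ T_x M` is the tangent line of the foliation at `x`. -/

variable (τ : ∀ x : M, Submodule ℝ (TangentSpace I x))

/-- Smooth vector fields tangent to the foliation. -/
abbrev TangentVF : Type _ := {Y : SmoothVF I M // ∀ x, Y x ∈ τ x}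

/-- Complex linear space of smooth complex-valued leafwise `1`-forms: the smooth sections `α` of
the dual of the bundle `τ`; `α` is smooth if its values on smooth fields tangent to `τ` are. -/
def leafFormSubmodule : Submodule ℂ (∀ x : M, τ x →ₗ[ℝ] ℂ) where
  carrier := {α | ∀ Y : TangentVF τ,
    ContMDiff I 𝓘(ℝ, ℂ) ∞ (fun x => α x ⟨Y.1 x, Y.2 x⟩)}
  zero_mem' _ := contMDiff_const
  add_mem' hα hβ Y := (hα Y).add (hβ Y)
  smul_mem' c _ hα Y := (contDiff_const_smul c).contMDiff.comp (hα Y)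

/-- Smooth leafwise `1`-forms, `Ω¹_F(M)`. -/
def LeafForm : Type _ := leafFormSubmodule τ

instance : AddCommGroup (LeafForm τ) := inferInstanceAs (AddCommGroup (leafFormSubmodule τ))

instance : Module ℂ (LeafForm τ) := inferInstanceAs (Module ℂ (leafFormSubmodule τ))

variable {τ}

/-- The smooth function `α(Y)`, for a leafwise `1`-form `α` and a tangent field `Y`. -/
def evalVF (Y : TangentVF τ) : LeafForm τ →ₗ[ℂ] SmoothFn I M where
  toFun α := ⟨fun x => α.1 x ⟨Y.1 x, Y.2 x⟩, α.2 Y⟩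
  map_add' _ _ := rfl
  map_smul' _ _ := rfl

/-- The `C^∞` topology on leafwise forms: the coarsest one for which all the maps
`α ↦ α(Y) ∈ C^∞(M)` are continuous. -/
instance [I.Boundaryless] : TopologicalSpace (LeafForm τ) :=
  ⨅ Y : TangentVF τ, TopologicalSpace.induced (evalVF Y) inferInstance

variable (τ)

/-- The leafwise exterior derivative `d_F : C^∞(M) → Ω¹_F(M)`, `(d_F f)(v) = df(v)` for `v ∈ τ`. -/
def leafD : SmoothFn I M →ₗ[ℂ] LeafForm τ where
  toFun f := ⟨fun x => (mvfderiv I f x).toLinearMap ∘ₗ (τ x).subtype,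
    fun Y => contMDiff_deriv Y.1 f⟩
  map_add' f g := by
    refine Subtype.ext (funext fun x => LinearMap.ext fun v => ?_)
    have hf := f.contMDiff.mdifferentiable (by simp) x
    have hg := g.contMDiff.mdifferentiable (by simp) x
    exact congrArg (fun L => L v.1) (mvfderiv_add hf hg)
  map_smul' c f :=
    Subtype.ext (funext fun x => LinearMap.ext fun v => mvfderiv_smul_complex c f x v.1)

/-- First leafwise cohomology of a one-dimensional foliation, with the quotient topology. As the
leaves have dimension one, `Ω²_F(M) = 0` and every leafwise `1`-form is closed. -/
abbrev LeafH1 : Type _ := LeafForm τ ⧸ LinearMap.range (leafD τ)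

end General

/-! ### The affine Reeb flow on `S^n × S^1` -/

/-- The Hopf manifold `S^d × S^1`. -/
abbrev Hopf (d : ℕ) : Type := Metric.sphere (0 : EuclideanSpace ℝ (Fin (d + 1))) 1 × Circle

/-- The model with corners of `S^d × S^1` (no boundary). -/
abbrev hopfModel (d : ℕ) := (𝓡 d).prod (𝓡 1)

/-- The direction `p / ‖p‖ ∈ S^d` of a nonzero vector `p` (an arbitrary point if `p = 0`). -/
def direction {d : ℕ} (p : EuclideanSpace ℝ (Fin (d + 1))) :
    Metric.sphere (0 : EuclideanSpace ℝ (Fin (d + 1))) 1 :=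
  if h : p = 0 then ⟨EuclideanSpace.single 0 1, by simp⟩
  else ⟨‖p‖⁻¹ • p, by simp [norm_smul, h]⟩

/-- The covering `p ↦ (p / ‖p‖, exp (2πi log ‖p‖ / log lam))` from `ℝ^(d+1) ∖ {0}` to
`S^d × S^1`. It identifies `S^d × S^1` with the quotient of `ℝ^(d+1) ∖ {0}` by the group
generated by the homothety of ratio `lam`; see `hopfMap_eq_iff` and `hopfMap_surjective`.
(The value at `p = 0` is irrelevant.) -/
def hopfMap {d : ℕ} (lam : ℝ) (p : EuclideanSpace ℝ (Fin (d + 1))) : Hopf d :=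
  (direction p, Circle.exp (2 * Real.pi * (Real.log ‖p‖ / Real.log lam)))

theorem hopfMap_eq_iff {d : ℕ} {lam : ℝ} (h0 : 0 < lam) (h1 : lam < 1)
    {p q : EuclideanSpace ℝ (Fin (d + 1))} (hp : p ≠ 0) (hq : q ≠ 0) :
    hopfMap lam p = hopfMap lam q ↔ ∃ k : ℤ, q = lam ^ k • p := by
  have hlog : Real.log lam ≠ 0 := (Real.log_neg h0 h1).ne
  have hp' : ‖p‖ ≠ 0 := norm_ne_zero_iff.2 hp
  have hq' : ‖q‖ ≠ 0 := norm_ne_zero_iff.2 hq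
  have key : ∀ k : ℤ, (2 * Real.pi * (Real.log ‖q‖ / Real.log lam)
      = 2 * Real.pi * (Real.log ‖p‖ / Real.log lam) + k * (2 * Real.pi)
      ↔ ‖q‖ = lam ^ k * ‖p‖) := by
    intro k
    have hk : 0 < lam ^ k := zpow_pos h0 k
    rw [← Real.log_injOn_pos.eq_iff (norm_pos_iff.2 hq) (mul_pos hk (norm_pos_iff.2 hp)),
      Real.log_mul hk.ne' hp', Real.log_zpow]
    have := Real.pi_pos.ne'
    field_simp
    constructor <;> intro h <;> linarith
  simp only [hopfMap, Prod.mk.injEq, direction, dif_neg hp, dif_neg hq, Subtype.mk.injEq]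
  rw [eq_comm (b := Circle.exp _), Circle.exp_eq_exp]
  simp only [key]
  constructor
  · rintro ⟨h, k, hk⟩
    refine ⟨k, ?_⟩
    have : q = ‖q‖ • (‖p‖⁻¹ • p) := by rw [h, smul_smul, mul_inv_cancel₀ hq', one_smul]
    rw [this, hk, smul_smul, mul_assoc, mul_inv_cancel₀ hp', mul_one]
  · rintro ⟨k, rfl⟩
    have hk : 0 < lam ^ k := zpow_pos h0 k
    have hn : ‖lam ^ k • p‖ = lam ^ k * ‖p‖ := by
      rw [norm_smul, Real.norm_of_nonneg hk.le]
    refine ⟨?_, k, hn⟩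
    rw [hn, smul_smul, mul_inv, mul_right_comm, inv_mul_cancel₀ hk.ne', one_mul]

theorem hopfMap_surjective {d : ℕ} {lam : ℝ} (h0 : 0 < lam) (h1 : lam < 1) (x : Hopf d) :
    ∃ p ≠ 0, hopfMap lam p = x := by
  obtain ⟨⟨u, hu⟩, z⟩ := x
  obtain ⟨θ, rfl⟩ := Circle.exp_surjective z
  have hlog : Real.log lam ≠ 0 := (Real.log_neg h0 h1).ne
  have hu1 : ‖u‖ = 1 := by simpa using hu
  have hr := Real.exp_pos (θ / (2 * Real.pi) * Real.log lam)
  have hn : ‖Real.exp (θ / (2 * Real.pi) * Real.log lam) • u‖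
      = Real.exp (θ / (2 * Real.pi) * Real.log lam) := by
    rw [norm_smul, Real.norm_of_nonneg hr.le, hu1, mul_one]
  have hp : Real.exp (θ / (2 * Real.pi) * Real.log lam) • u ≠ 0 := by
    rw [← norm_ne_zero_iff, hn]; exact hr.ne'
  refine ⟨_, hp, ?_⟩
  have := Real.pi_pos.ne'
  refine Prod.ext (Subtype.ext ?_) ?_
  · simp only [hopfMap, direction, dif_neg hp]
    rw [hn, smul_smul, inv_mul_cancel₀ hr.ne', one_smul]
  · simp only [hopfMap]
    rw [hn, Real.log_exp]
    congr 1
    field_simp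

/-- The tangent line field of the affine Reeb flow on `S^n × S^1`: the image, under the covering
`hopfMap`, of the foliation of `ℝ^(n+1) ∖ {0}` by the integral curves of `∂/∂t`, where `t` is the
last coordinate. -/
def reebLine (n : ℕ) (lam : ℝ) (x : Hopf n) : Submodule ℝ (TangentSpace (hopfModel n) x) :=
  Submodule.span ℝ {v | ∃ p : EuclideanSpace ℝ (Fin (n + 1)), p ≠ 0 ∧
    tangentMap (𝓡 (n + 1)) (hopfModel n) (hopfMap lam) ⟨p, EuclideanSpace.single (Fin.last n) 1⟩
      = ⟨x, v⟩}

end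

end ReebFlow

open ReebFlow

open scoped Manifold ContDiff Topology
open Filter Set

namespace ReebFlow

/-! Put n = m + 1. The field ‖p‖ ∂/∂t is invariant by homotheties and descends to `reebField`, a
smooth frame of the foliation. Evaluation on it identifies leafwise forms with functions g on the
Hopf manifold, and on the cover with densities A = g / ‖p‖ for which A dt is homothety invariant
(`density`). The form is exact when A has an invariant smooth primitive F in t on the cover minus
the origin.

For σ = ±1 the arc from (z, σ) to (z, σ / λ) carries the flux k_σ(z). Subtracting S_σ(z) = Σ_j
(k_σ(λ^j z) - k_σ(0)) from the primitive of A based at height σ makes it invariant up to the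
constant k_σ(0) (`leafPrimitive_smul`); k_σ(0) is the period along one of the two closed leaves. The
primitives for σ = 1 and σ = -1 are smooth on two open sets that cover everything, and on the
overlap z ≠ 0 they differ by a function of z alone, the gap. With a logarithmic correction the gap
is homothety invariant and becomes a function on S^m × S^1. The obstructions to exactness are the
two periods and the gap modulo constants (`isLeafExact_iff`). They can be prescribed freely, by
continuous linear choices (`gapMap_gapSection`, `exists_periodMap_eq`).

Hence the cohomology is ℂ ⊕ ℂ ⊕ C^∞(S^m × S^1)/ℂ, and the constants have to be absorbed. This rests
on a continuous surjection of C^∞(S^m × S^1) onto itself with kernel the constants and a continuous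
right inverse (`foldHopf`, `unfoldHopf`). On the circle it keeps the odd part of q and replaces the
even part e by e' / sin(2πx). The resulting map `classMap` has the exact densities as kernel
(`classMap_eq_zero_iff`) and a continuous right inverse (`exists_classMap_rightInverse`), so it
induces a topological isomorphism on the quotient without any open mapping theorem.

For a tangent field X without zeros, α ↦ α(X) is a topological isomorphism from leafwise forms to
functions that carries d_F φ to X·φ. Distributions killed by X are therefore the continuous linear
forms on the cohomology, and both weak topologies are those of pointwise convergence
(`IsReebTangent.exists_dualEquiv`). -/

noncomputable section

/-! ### Families of functions tending to zero in C^∞, and their closure properties -/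

section CkSmall

variable {ι : Type*} {E E' F G : Type} [NormedAddCommGroup E] [NormedSpace ℝ E]
  [NormedAddCommGroup E'] [NormedSpace ℝ E'] [NormedAddCommGroup F] [NormedSpace ℝ F]
  [NormedAddCommGroup G] [NormedSpace ℝ G]

/-- The functions `g i` are of class `C^k` on `U` and, along `l`, their derivatives of order at
most `k` tend to zero locally uniformly on `U`. -/
structure CkSmall (k : ℕ) (l : Filter ι) (U : Set E) (g : ι → E → F) : Prop where
  contDiffOn : ∀ i, ContDiffOn ℝ k (g i) U
  tendsto : ∀ j ≤ k, ∀ x ∈ U,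
    Tendsto (fun p : ι × E => ‖iteratedFDeriv ℝ j (g p.1) p.2‖) (l ×ˢ 𝓝 x) (𝓝 0)

/-- The functions `g i` are smooth on `U` and tend to zero in `C^∞(U)` along `l`. -/
def SmoothSmall (l : Filter ι) (U : Set E) (g : ι → E → F) : Prop := ∀ k, CkSmall k l U g

variable {k : ℕ} {l : Filter ι} {U V : Set E} {g h : ι → E → F}

theorem SmoothSmall.contDiffOn (hg : SmoothSmall l U g) (i : ι) : ContDiffOn ℝ ∞ (g i) U :=
  contDiffOn_infty.2 fun k => (hg k).contDiffOn i

theorem SmoothSmall.tendsto (hg : SmoothSmall l U g) (k : ℕ) {x : E} (hx : x ∈ U) :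
    Tendsto (fun p : ι × E => ‖iteratedFDeriv ℝ k (g p.1) p.2‖) (l ×ˢ 𝓝 x) (𝓝 0) :=
  (hg k).tendsto k le_rfl x hx

/-- Along the trivial filter the limit condition is vacuous. Each closure property of `SmoothSmall`
thus serves twice: with `l = ⊥` it gives smoothness of one function, and with `l = 𝓝 f` it gives
continuity of an operator. -/
theorem smoothSmall_bot (hg : ∀ i, ContDiffOn ℝ ∞ (g i) U) : SmoothSmall ⊥ U g := fun k =>
  ⟨fun i => (hg i).of_le (by exact_mod_cast le_top), fun j _ x _ => by simp⟩

theorem smoothSmall_iff : SmoothSmall l U g ↔ (∀ i, ContDiffOn ℝ ∞ (g i) U) ∧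
    ∀ k : ℕ, ∀ x ∈ U,
    Tendsto (fun p : ι × E => ‖iteratedFDeriv ℝ k (g p.1) p.2‖) (l ×ˢ 𝓝 x) (𝓝 0) :=
  ⟨fun h => ⟨h.contDiffOn, fun k _ hx => h.tendsto k hx⟩, fun h k =>
    ⟨fun i => (h.1 i).of_le (by exact_mod_cast le_top), fun j _ => h.2 j⟩⟩

theorem CkSmall.mono (hg : CkSmall k l U g) (hVU : V ⊆ U) : CkSmall k l V g :=
  ⟨fun i => (hg.contDiffOn i).mono hVU, fun j hj x hx => hg.tendsto j hj x (hVU hx)⟩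

theorem SmoothSmall.mono (hg : SmoothSmall l U g) (hVU : V ⊆ U) : SmoothSmall l V g :=
  fun k => (hg k).mono hVU

theorem CkSmall.tendsto_apply (hg : CkSmall k l U g) {x : E} (hx : x ∈ U) :
    Tendsto (fun p : ι × E => g p.1 p.2) (l ×ˢ 𝓝 x) (𝓝 0) := by
  have := hg.tendsto 0 (Nat.zero_le _) x hx
  simp only [norm_iteratedFDeriv_zero] at this
  exact tendsto_zero_iff_norm_tendsto_zero.2 this

theorem SmoothSmall.tendsto_apply (hg : SmoothSmall l U g) {x : E} (hx : x ∈ U) :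
    Tendsto (fun p : ι × E => g p.1 p.2) (l ×ˢ 𝓝 x) (𝓝 0) := (hg 0).tendsto_apply hx

theorem SmoothSmall.tendsto_at (hg : SmoothSmall l U g) {x : E} (hx : x ∈ U) :
    Tendsto (fun i => g i x) l (𝓝 0) :=
  (hg.tendsto_apply hx).comp (tendsto_id.prodMk tendsto_const_nhds) |>.mono_left
    (by simp) |>.congr fun _ => rfl

theorem CkSmall.congr (hU : IsOpen U) (hg : CkSmall k l U g) (hgh : ∀ i, EqOn (h i) (g i) U) :
    CkSmall k l U h := by
  refine ⟨fun i => (hg.contDiffOn i).congr (hgh i), fun j hj x hx => ?_⟩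
  refine (hg.tendsto j hj x hx).congr' ?_
  filter_upwards [tendsto_snd.eventually (hU.mem_nhds hx)] with p hp
  have : g p.1 =ᶠ[𝓝 p.2] h p.1 :=
    Filter.eventuallyEq_of_mem (hU.mem_nhds hp) fun y hy => (hgh p.1 hy).symm
  rw [(Filter.EventuallyEq.iteratedFDeriv ℝ this j).eq_of_nhds]

theorem SmoothSmall.congr (hU : IsOpen U) (hg : SmoothSmall l U g)
    (hgh : ∀ i, EqOn (h i) (g i) U) : SmoothSmall l U h := fun k => (hg k).congr hU hgh

theorem smoothSmall_of_locally
    (h : ∀ x ∈ U, ∃ V, IsOpen V ∧ x ∈ V ∧ SmoothSmall l V g) : SmoothSmall l U g := by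
  refine smoothSmall_iff.2 ⟨fun i x hx => ?_, fun k x hx => ?_⟩
  · obtain ⟨V, hV, hxV, hg⟩ := h x hx
    exact ((hg.contDiffOn i).contDiffAt (hV.mem_nhds hxV)).contDiffWithinAt
  · obtain ⟨V, hV, hxV, hg⟩ := h x hx
    exact hg.tendsto k hxV

theorem smoothSmall_zero : SmoothSmall l U (fun _ _ => (0 : F)) := by
  refine smoothSmall_iff.2 ⟨fun i => contDiffOn_const, fun k x hx => ?_⟩
  have : (fun _ : E => (0 : F)) = 0 := rfl
  simpa [this] using tendsto_const_nhds

theorem ckSmall_zero_iff (hU : IsOpen U) : CkSmall 0 l U g ↔ (∀ i, ContinuousOn (g i) U) ∧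
    ∀ x ∈ U, Tendsto (fun p : ι × E => g p.1 p.2) (l ×ˢ 𝓝 x) (𝓝 0) := by
  refine ⟨fun h => ⟨fun i => (h.contDiffOn i).continuousOn, fun x hx => h.tendsto_apply hx⟩,
    fun h => ⟨fun i => by simpa using (contDiffOn_zero (𝕜 := ℝ)).2 (h.1 i), fun j hj x hx => ?_⟩⟩
  obtain rfl : j = 0 := by omega
  simp only [norm_iteratedFDeriv_zero]
  exact tendsto_zero_iff_norm_tendsto_zero.1 (h.2 x hx)

/-- This drives the inductions on `k`. Passing to the derivative changes the target space, which is
why the inductive statements below quantify over `F` after the colon. -/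
theorem ckSmall_succ_iff (hU : IsOpen U) : CkSmall (k + 1) l U g ↔
    (∀ i, DifferentiableOn ℝ (g i) U) ∧
    (∀ x ∈ U, Tendsto (fun p : ι × E => g p.1 p.2) (l ×ˢ 𝓝 x) (𝓝 0)) ∧
    CkSmall k l U (fun i => fderiv ℝ (g i)) := by
  have key : ∀ i, ContDiffOn ℝ ((k + 1 : ℕ) : ℕ∞ω) (g i) U ↔ DifferentiableOn ℝ (g i) U ∧
      ContDiffOn ℝ k (fderiv ℝ (g i)) U := fun i => by
    push_cast
    rw [contDiffOn_succ_iff_fderiv_of_isOpen hU]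
    simp
  constructor
  · intro h
    refine ⟨fun i => ((key i).1 (h.contDiffOn i)).1, fun x hx => h.tendsto_apply hx,
      fun i => ((key i).1 (h.contDiffOn i)).2, fun j hj x hx => ?_⟩
    simp only [norm_iteratedFDeriv_fderiv]
    exact h.tendsto (j + 1) (by omega) x hx
  · rintro ⟨h1, h2, h3⟩
    refine ⟨fun i => (key i).2 ⟨h1 i, h3.contDiffOn i⟩, fun j hj x hx => ?_⟩
    rcases j with _ | j
    · simp only [norm_iteratedFDeriv_zero]
      exact tendsto_zero_iff_norm_tendsto_zero.1 (h2 x hx)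
    · simp only [← norm_iteratedFDeriv_fderiv]
      exact h3.tendsto j (by omega) x hx

theorem CkSmall.add (hU : IsOpen U) (hg : CkSmall k l U g) (hh : CkSmall k l U h) :
    CkSmall k l U (fun i x => g i x + h i x) := by
  refine ⟨fun i => (hg.contDiffOn i).add (hh.contDiffOn i), fun j hj x hx => ?_⟩
  have := (hg.tendsto j hj x hx).add (hh.tendsto j hj x hx)
  rw [add_zero] at this
  refine squeeze_zero' (Eventually.of_forall fun _ => norm_nonneg _) ?_ this
  filter_upwards [tendsto_snd.eventually (hU.mem_nhds hx)] with p hp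
  have hj' : (j : ℕ∞ω) ≤ k := by exact_mod_cast hj
  have := iteratedFDeriv_add_apply
    (((hg.contDiffOn p.1).contDiffAt (hU.mem_nhds hp)).of_le hj')
    (((hh.contDiffOn p.1).contDiffAt (hU.mem_nhds hp)).of_le hj')
  change ‖iteratedFDeriv ℝ j (g p.1 + h p.1) p.2‖ ≤ _
  rw [this]
  exact norm_add_le _ _

theorem SmoothSmall.add (hU : IsOpen U) (hg : SmoothSmall l U g) (hh : SmoothSmall l U h) :
    SmoothSmall l U (fun i x => g i x + h i x) := fun k => (hg k).add hU (hh k)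

/-- Leibniz bound: every term contains a derivative of `g i`, which tends to zero, times a
derivative of the fixed `c`, which is continuous and so locally bounded. -/
theorem CkSmall.bilin (hU : IsOpen U) (B : F →L[ℝ] E' →L[ℝ] G) {c : E → E'}
    (hg : CkSmall k l U g) (hc : ContDiffOn ℝ k c U) :
    CkSmall k l U (fun i x => B (g i x) (c x)) := by
  have hcd : ∀ i, ContDiffOn ℝ k (fun x => B (g i x) (c x)) U := fun i =>
    (B.contDiff.comp_contDiffOn (hg.contDiffOn i)).clm_apply hc
  refine ⟨hcd, fun j hj x hx => ?_⟩
  have hj' : (j : ℕ∞ω) ≤ k := by exact_mod_cast hj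
  have hlim : Tendsto (fun p : ι × E => ‖B‖ * ∑ a ∈ Finset.range (j + 1), (j.choose a : ℝ) *
      ‖iteratedFDeriv ℝ a (g p.1) p.2‖ * ‖iteratedFDeriv ℝ (j - a) c p.2‖) (l ×ˢ 𝓝 x)
      (𝓝 (‖B‖ * ∑ a ∈ Finset.range (j + 1), (j.choose a : ℝ) * 0 *
        ‖iteratedFDeriv ℝ (j - a) c x‖)) := by
    refine Tendsto.const_mul _ (tendsto_finsetSum _ fun a ha => ?_)
    have ha' : a ≤ j := by simpa [Nat.lt_succ_iff] using ha
    refine ((hg.tendsto a (ha'.trans hj) x hx).const_mul _).mul ?_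
    have hco : ContinuousAt (iteratedFDeriv ℝ (j - a) c) x :=
      (hc.contDiffAt (hU.mem_nhds hx)).continuousAt_iteratedFDeriv
        (by exact_mod_cast (Nat.sub_le _ _).trans hj)
    exact hco.norm.tendsto.comp tendsto_snd
  simp only [mul_zero, zero_mul, Finset.sum_const_zero] at hlim
  refine squeeze_zero' (Eventually.of_forall fun _ => norm_nonneg _) ?_ hlim
  filter_upwards [tendsto_snd.eventually (hU.mem_nhds hx)] with p hp
  have := B.norm_iteratedFDerivWithin_le_of_bilinear (hg.contDiffOn p.1) hc hU.uniqueDiffOn hp hj'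
  simpa only [iteratedFDerivWithin_of_isOpen _ hU hp] using this

theorem SmoothSmall.bilin (hU : IsOpen U) (B : F →L[ℝ] E' →L[ℝ] G) {c : E → E'}
    (hg : SmoothSmall l U g) (hc : ContDiffOn ℝ ∞ c U) :
    SmoothSmall l U (fun i x => B (g i x) (c x)) := fun k =>
  (hg k).bilin hU B (hc.of_le (by exact_mod_cast le_top))

theorem SmoothSmall.clm_apply (hU : IsOpen U) (L : F →L[ℝ] G) (hg : SmoothSmall l U g) :
    SmoothSmall l U (fun i x => L (g i x)) :=
  hg.bilin hU (c := fun _ => L) (ContinuousLinearMap.apply ℝ G) contDiffOn_const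

theorem SmoothSmall.neg (hU : IsOpen U) (hg : SmoothSmall l U g) :
    SmoothSmall l U (fun i x => -g i x) := hg.clm_apply hU (-ContinuousLinearMap.id ℝ F)

theorem SmoothSmall.sub (hU : IsOpen U) (hg : SmoothSmall l U g) (hh : SmoothSmall l U h) :
    SmoothSmall l U (fun i x => g i x - h i x) := by
  simpa only [sub_eq_add_neg] using hg.add hU (hh.neg hU)

theorem SmoothSmall.mul {g : ι → E → ℂ} {c : E → ℂ} (hU : IsOpen U) (hg : SmoothSmall l U g)
    (hc : ContDiffOn ℝ ∞ c U) : SmoothSmall l U (fun i x => g i x * c x) :=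
  hg.bilin hU (ContinuousLinearMap.mul ℝ ℂ) hc

theorem SmoothSmall.fderiv (hU : IsOpen U) (hg : SmoothSmall l U g) :
    SmoothSmall l U (fun i => fderiv ℝ (g i)) := fun k => ((ckSmall_succ_iff hU).1 (hg (k + 1))).2.2

/-- Induction by the chain rule: the derivative of the composite is a small family composed with
`φ`, paired bilinearly with the fixed derivative of `φ`. -/
theorem CkSmall.comp {V : Set E'} (hU : IsOpen U) (hV : IsOpen V) {φ : E' → E}
    (hφ : ContDiffOn ℝ ∞ φ V) (hφV : MapsTo φ V U) :
    ∀ {k : ℕ} {F : Type} [NormedAddCommGroup F] [NormedSpace ℝ F] {g : ι → E → F},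
      CkSmall k l U g → CkSmall k l V (fun i x => g i (φ x)) := by
  have hlim : ∀ x ∈ V, Tendsto (Prod.map id φ : ι × E' → ι × E) (l ×ˢ 𝓝 x) (l ×ˢ 𝓝 (φ x)) :=
    fun x hx => tendsto_id.prodMap (hφ.continuousOn.continuousAt (hV.mem_nhds hx))
  intro k
  induction k with
  | zero =>
    intro F _ _ g hg
    rw [ckSmall_zero_iff hU] at hg
    rw [ckSmall_zero_iff hV]
    exact ⟨fun i => (hg.1 i).comp hφ.continuousOn hφV,
      fun x hx => (hg.2 _ (hφV hx)).comp (hlim x hx)⟩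
  | succ k ih =>
    intro F _ _ g hg
    obtain ⟨h1, h2, h3⟩ := (ckSmall_succ_iff hU).1 hg
    have hφd : DifferentiableOn ℝ φ V := hφ.differentiableOn (by simp)
    refine (ckSmall_succ_iff hV).2 ⟨fun i => (h1 i).comp hφd hφV,
      fun x hx => (h2 _ (hφV hx)).comp (hlim x hx), ?_⟩
    have hφ' : ContDiffOn ℝ k (_root_.fderiv ℝ φ) V :=
      hφ.fderiv_of_isOpen hV (by exact_mod_cast le_top)
    refine ((ih h3).bilin hV (ContinuousLinearMap.compL ℝ E' E F) hφ').congr hV fun i x hx => ?_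
    exact fderiv_comp x ((h1 i).differentiableAt (hU.mem_nhds (hφV hx)))
      (hφd.differentiableAt (hV.mem_nhds hx))

theorem SmoothSmall.comp {V : Set E'} (hU : IsOpen U) (hV : IsOpen V) {φ : E' → E}
    (hφ : ContDiffOn ℝ ∞ φ V) (hφV : MapsTo φ V U) (hg : SmoothSmall l U g) :
    SmoothSmall l V (fun i x => g i (φ x)) := fun k => (hg k).comp hU hV hφ hφV

end CkSmall

section Compact

variable {ι X F : Type*} [TopologicalSpace X] [NormedAddCommGroup F]

/-- Limits along `l ×ˢ 𝓝 x` at each point of a compact set amount to uniform smallness on it; this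
links `SmoothSmall` with the topology of `C^∞`. -/
theorem eventually_forall_norm_lt_of_isCompact {l : Filter ι} {K : Set X} (hK : IsCompact K)
    {g : ι → X → F} (hg : ∀ x ∈ K, Tendsto (fun p : ι × X => g p.1 p.2) (l ×ˢ 𝓝 x) (𝓝 0))
    {ε : ℝ} (hε : 0 < ε) : ∀ᶠ i in l, ∀ x ∈ K, ‖g i x‖ < ε := by
  refine hK.induction_on (p := fun s => ∀ᶠ i in l, ∀ x ∈ s, ‖g i x‖ < ε) (by simp)
    (fun s t hst h => h.mono fun i hi x hx => hi x (hst hx))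
    (fun s t hs ht => (hs.and ht).mono fun i hi x hx => hx.elim (hi.1 x) (hi.2 x))
    fun x hx => ?_
  have := (hg x hx).norm.eventually (gt_mem_nhds (by simpa using hε))
  rw [eventually_prod_iff] at this
  obtain ⟨pa, ha, pb, hb, h⟩ := this
  exact ⟨{y | pb y}, mem_nhdsWithin_of_mem_nhds hb, ha.mono fun i hi y hy => h hi hy⟩

end Compact

/-! ### Integrals depending smoothly on a parameter -/

section ParametricIntegral

set_option linter.unusedSectionVars false

open MeasureTheory

variable {ι : Type*} {E F : Type} [NormedAddCommGroup E] [NormedSpace ℝ E]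
  [NormedAddCommGroup F] [NormedSpace ℝ F] {l : Filter ι} {U : Set (E × ℝ)} {a b : ℝ}

theorem eventually_slice_mem (hU : IsOpen U) {x : E} (hx : ∀ s ∈ uIcc a b, (x, s) ∈ U) :
    ∀ᶠ y in 𝓝 x, ∀ s ∈ uIcc a b, (y, s) ∈ U :=
  isCompact_uIcc.eventually_forall_of_forall_eventually fun s hs => hU.mem_nhds (hx s hs)

theorem isOpen_slice (hU : IsOpen U) (a b : ℝ) : IsOpen {x : E | ∀ s ∈ uIcc a b, (x, s) ∈ U} :=
  isOpen_iff_mem_nhds.2 fun _ hx => eventually_slice_mem hU hx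

theorem continuousOn_slice {g : E × ℝ → F} (hg : ContinuousOn g U) {x : E}
    (hx : ∀ s ∈ uIcc a b, (x, s) ∈ U) : ContinuousOn (fun s => g (x, s)) (uIcc a b) :=
  hg.comp (by fun_prop) hx

/-- The integrand is controlled only on the open set `U`. Compactness of the segment gives a
neighbourhood of `x` whose slices stay in `U` and on which the integrand is bounded, so dominated
convergence applies. -/
theorem continuousOn_parametric_intervalIntegral {g : E × ℝ → F} (hU : IsOpen U)
    (hg : ContinuousOn g U) :
    ContinuousOn (fun x => ∫ s in a..b, g (x, s)) {x | ∀ s ∈ uIcc a b, (x, s) ∈ U} := by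
  intro x hx
  refine ContinuousAt.continuousWithinAt ?_
  have hb : ∀ᶠ y in 𝓝 x, ∀ s ∈ uIcc a b, ‖g (y, s) - g (x, s)‖ < 1 := by
    refine isCompact_uIcc.eventually_forall_of_forall_eventually fun s hs => ?_
    have h1 : ContinuousAt g (x, s) := hg.continuousAt (hU.mem_nhds (hx s hs))
    have h2 : ContinuousAt (fun z : E × ℝ => g (x, z.2)) (x, s) :=
      ContinuousAt.comp (f := fun z : E × ℝ => (x, z.2)) h1 (by fun_prop)
    have h3 : ContinuousAt (fun z : E × ℝ => ‖g z - g (x, z.2)‖) (x, s) := (h1.sub h2).norm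
    exact h3.eventually (gt_mem_nhds (by simp))
  obtain ⟨C, hC⟩ := isCompact_uIcc.exists_bound_of_continuousOn (continuousOn_slice hg hx)
  refine intervalIntegral.continuousAt_of_dominated_interval (bound := fun _ => C + 1) ?_ ?_
    intervalIntegrable_const ?_
  · filter_upwards [eventually_slice_mem hU hx] with y hy
    exact ((continuousOn_slice hg hy).mono uIoc_subset_uIcc).aestronglyMeasurable
      measurableSet_uIoc
  · filter_upwards [hb] with y hy
    refine Eventually.of_forall fun s hs => ?_
    have hs' := uIoc_subset_uIcc hs
    calc ‖g (y, s)‖ = ‖g (x, s) + (g (y, s) - g (x, s))‖ := by congr 1; abel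
      _ ≤ C + 1 := (norm_add_le _ _).trans (add_le_add (hC s hs') (hy s hs').le)
  · refine Eventually.of_forall fun s hs => ?_
    have h1 : ContinuousAt g (x, s) := hg.continuousAt (hU.mem_nhds (hx s (uIoc_subset_uIcc hs)))
    exact ContinuousAt.comp (f := fun z : E => (z, s)) h1 (by fun_prop)

theorem hasFDerivAt_parametric_intervalIntegral {g : E × ℝ → F} (hU : IsOpen U)
    (hg : ContDiffOn ℝ 1 g U) {x : E} (hx : ∀ s ∈ uIcc a b, (x, s) ∈ U) :
    HasFDerivAt (fun x => ∫ s in a..b, g (x, s))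
      (∫ s in a..b, (fderiv ℝ g (x, s)).comp (ContinuousLinearMap.inl ℝ E ℝ)) x := by
  have hc : ContinuousOn (fun p => (fderiv ℝ g p).comp (ContinuousLinearMap.inl ℝ E ℝ)) U :=
    (hg.continuousOn_fderiv_of_isOpen hU le_rfl).clm_comp continuousOn_const
  obtain ⟨C, hC⟩ := isCompact_uIcc.exists_bound_of_continuousOn (continuousOn_slice hc hx)
  have hb : ∀ᶠ y in 𝓝 x, ∀ s ∈ uIcc a b,
      ‖(fderiv ℝ g (y, s)).comp (ContinuousLinearMap.inl ℝ E ℝ)‖ < C + 1 := by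
    refine isCompact_uIcc.eventually_forall_of_forall_eventually fun s hs => ?_
    have h1 := (hc.continuousAt (hU.mem_nhds (hx s hs))).norm
    exact h1.eventually (gt_mem_nhds ((hC s hs).trans_lt (lt_add_one C)))
  refine intervalIntegral.hasFDerivAt_integral_of_dominated_of_fderiv_le
    (F' := fun y s => (fderiv ℝ g (y, s)).comp (ContinuousLinearMap.inl ℝ E ℝ))
    (hb.and (eventually_slice_mem hU hx)) (bound := fun _ => C + 1) ?_ ?_ ?_ ?_
    intervalIntegrable_const ?_
  · filter_upwards [eventually_slice_mem hU hx] with y hy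
    exact ((continuousOn_slice hg.continuousOn hy).mono uIoc_subset_uIcc).aestronglyMeasurable
      measurableSet_uIoc
  · exact (continuousOn_slice hg.continuousOn hx).intervalIntegrable
  · exact ((continuousOn_slice hc hx).mono uIoc_subset_uIcc).aestronglyMeasurable
      measurableSet_uIoc
  · exact Eventually.of_forall fun s hs y hy => (hy.1 s (uIoc_subset_uIcc hs)).le
  · refine Eventually.of_forall fun s hs y hy => ?_
    have h1 : HasFDerivAt g (fderiv ℝ g (y, s)) (y, s) :=
      ((hg.differentiableOn (by simp)).differentiableAt
        (hU.mem_nhds (hy.2 s (uIoc_subset_uIcc hs)))).hasFDerivAt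
    exact HasFDerivAt.comp (f := fun z : E => (z, s)) y h1 (hasFDerivAt_prodMk_left y s)

theorem CkSmall.intervalIntegral (hU : IsOpen U) (a b : ℝ) :
    ∀ {k : ℕ} {F : Type} [NormedAddCommGroup F] [NormedSpace ℝ F] {g : ι → E × ℝ → F},
    CkSmall k l U g →
    CkSmall k l {x | ∀ s ∈ uIcc a b, (x, s) ∈ U} (fun i x => ∫ s in a..b, g i (x, s)) := by
  have hlim : ∀ {F : Type} [NormedAddCommGroup F] [NormedSpace ℝ F] {g : ι → E × ℝ → F},
      (∀ p ∈ U, Tendsto (fun q : ι × (E × ℝ) => g q.1 q.2) (l ×ˢ 𝓝 p) (𝓝 0)) →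
      ∀ x ∈ {x | ∀ s ∈ uIcc a b, (x, s) ∈ U},
      Tendsto (fun q : ι × E => ∫ s in a..b, g q.1 (q.2, s)) (l ×ˢ 𝓝 x) (𝓝 0) := by
    intro F _ _ g hg x hx
    rw [Metric.tendsto_nhds]
    intro ε hε
    have hε' : 0 < ε / (|b - a| + 1) := by positivity
    -- Compactness of the segment is applied along the product filter `l ×ˢ 𝓝 x`, so the bound is
    -- uniform in `s` and holds jointly in the index and the parameter.
    have := eventually_forall_norm_lt_of_isCompact (isCompact_uIcc (a := a) (b := b))
      (g := fun (q : ι × E) s => g q.1 (q.2, s)) (l := l ×ˢ 𝓝 x) (fun s hs => by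
        have h1 := hg (x, s) (hx s hs)
        rw [nhds_prod_eq, ← Filter.prod_assoc, tendsto_map'_iff] at h1
        exact h1.congr fun _ => rfl) hε'
    filter_upwards [this] with q hq
    rw [dist_zero_right]
    refine (intervalIntegral.norm_integral_le_of_norm_le_const
      fun s hs => (hq s (uIoc_subset_uIcc hs)).le).trans_lt ?_
    rw [div_mul_eq_mul_div, div_lt_iff₀ (by positivity)]
    nlinarith [abs_nonneg (b - a)]
  intro k
  induction k with
  | zero =>
    intro F _ _ g hg
    rw [ckSmall_zero_iff hU] at hg
    rw [ckSmall_zero_iff (isOpen_slice hU a b)]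
    exact ⟨fun i => continuousOn_parametric_intervalIntegral hU (hg.1 i), hlim hg.2⟩
  | succ k ih =>
    intro F _ _ g hg
    have hd := fun i x (hx : ∀ s ∈ uIcc a b, (x, s) ∈ U) =>
      hasFDerivAt_parametric_intervalIntegral hU
        ((hg.contDiffOn i).of_le (by exact_mod_cast Nat.le_add_left 1 k)) hx
    refine (ckSmall_succ_iff (isOpen_slice hU a b)).2
      ⟨fun i x hx => (hd i x hx).differentiableAt.differentiableWithinAt,
        hlim fun p hp => hg.tendsto_apply hp, ?_⟩
    have h3 := ((ckSmall_succ_iff hU).1 hg).2.2.bilin hU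
      (ContinuousLinearMap.compL ℝ E (E × ℝ) F)
      (c := fun _ => ContinuousLinearMap.inl ℝ E ℝ) contDiffOn_const
    exact (ih h3).congr (isOpen_slice hU a b) fun i x hx => (hd i x hx).fderiv

theorem SmoothSmall.intervalIntegral {g : ι → E × ℝ → F} (hU : IsOpen U) (hg : SmoothSmall l U g)
    (a b : ℝ) :
    SmoothSmall l {x | ∀ s ∈ uIcc a b, (x, s) ∈ U} (fun i x => ∫ s in a..b, g i (x, s)) :=
  fun k => (hg k).intervalIntegral hU a b

end ParametricIntegral

/-! ### The equation h(z) - h(λz) = g(z) - g(0) for the contraction z ↦ λz -/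

section Series

set_option linter.unusedSectionVars false

variable {ι : Type*} {E : Type} [NormedAddCommGroup E] [NormedSpace ℝ E]
  [FiniteDimensional ℝ E] {l : Filter ι} {lam : ℝ}

theorem norm_smul_pow_le {F : Type} [NormedAddCommGroup F] [NormedSpace ℝ F] (h0 : 0 < lam)
    (h1 : lam < 1) {mu : ℝ} (hmu0 : 0 ≤ mu) {g : E → F} {R C : ℝ}
    (hC : ∀ z ∈ Metric.closedBall (0 : E) R, ‖g z‖ ≤ C) (j : ℕ) {z : E}
    (hz : z ∈ Metric.closedBall (0 : E) R) : ‖mu ^ j • g (lam ^ j • z)‖ ≤ mu ^ j * C := by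
  rw [norm_smul, norm_pow, Real.norm_of_nonneg hmu0]
  refine mul_le_mul_of_nonneg_left (hC _ ?_) (by positivity)
  rw [mem_closedBall_zero_iff] at hz ⊢
  rw [norm_smul, norm_pow, Real.norm_of_nonneg h0.le]
  exact (mul_le_of_le_one_left (norm_nonneg _) (pow_le_one₀ h0.le h1.le)).trans hz

theorem summable_smul_pow {F : Type} [NormedAddCommGroup F] [NormedSpace ℝ F] [CompleteSpace F]
    (h0 : 0 < lam) (h1 : lam < 1) {mu : ℝ} (hmu0 : 0 ≤ mu) (hmu1 : mu < 1) {g : E → F}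
    (hg : Continuous g) (z : E) : Summable fun j : ℕ => mu ^ j • g (lam ^ j • z) := by
  obtain ⟨C, hC⟩ := (isCompact_closedBall (0 : E) ‖z‖).exists_bound_of_continuousOn hg.continuousOn
  exact Summable.of_norm_bounded ((summable_geometric_of_lt_one hmu0 hmu1).mul_right C)
    fun j => norm_smul_pow_le h0 h1 hmu0 hC j (by simp)

/-- Differentiating mu^j g(lam^j z) gives (mu lam)^j g'(lam^j z), a series of the same kind with a
smaller ratio; the induction therefore treats all ratios mu < 1 together. Bounds are taken on balls
about the origin because the contraction preserves them. -/
theorem CkSmall.tsum_smul_pow (h0 : 0 < lam) (h1 : lam < 1) :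
    ∀ {k : ℕ} {F : Type} [NormedAddCommGroup F] [NormedSpace ℝ F] [CompleteSpace F]
      {mu : ℝ} (_ : 0 ≤ mu) (_ : mu < 1) {g : ι → E → F}, CkSmall k l univ g →
      CkSmall k l univ (fun i z => ∑' j : ℕ, mu ^ j • g i (lam ^ j • z)) := by
  have hlim : ∀ {F : Type} [NormedAddCommGroup F] [NormedSpace ℝ F] [CompleteSpace F]
      {mu : ℝ} (_ : 0 ≤ mu) (_ : mu < 1) {g : ι → E → F},
      (∀ x, Tendsto (fun q : ι × E => g q.1 q.2) (l ×ˢ 𝓝 x) (𝓝 0)) →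
      ∀ x, Tendsto (fun q : ι × E => ∑' j : ℕ, mu ^ j • g q.1 (lam ^ j • q.2)) (l ×ˢ 𝓝 x)
        (𝓝 0) := by
    intro F _ _ _ mu hmu0 hmu1 g hg x
    rw [Metric.tendsto_nhds]
    intro ε hε
    have hmu : 0 < 1 - mu := by linarith
    have hε' : 0 < ε / 2 * (1 - mu) := by positivity
    have hK := eventually_forall_norm_lt_of_isCompact (isCompact_closedBall (0 : E) (‖x‖ + 1))
      (fun y _ => hg y) hε'
    have hx : ∀ᶠ y in 𝓝 x, ‖y‖ < ‖x‖ + 1 :=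
      continuous_norm.continuousAt.eventually (gt_mem_nhds (lt_add_one _))
    filter_upwards [hK.prod_mk hx] with q hq
    rw [dist_zero_right]
    have hs := (hasSum_geometric_of_lt_one hmu0 hmu1).mul_right (ε / 2 * (1 - mu))
    refine (tsum_of_norm_bounded hs fun j => norm_smul_pow_le h0 h1 hmu0
      (fun z hz => (hq.1 z hz).le) j (by simpa using hq.2.le)).trans_lt ?_
    field_simp
    linarith
  have hcont : ∀ {F : Type} [NormedAddCommGroup F] [NormedSpace ℝ F] [CompleteSpace F]
      {mu : ℝ} (_ : 0 ≤ mu) (_ : mu < 1) {g : E → F}, Continuous g →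
      Continuous (fun z => ∑' j : ℕ, mu ^ j • g (lam ^ j • z)) := by
    intro F _ _ _ mu hmu0 hmu1 g hg
    refine continuous_iff_continuousAt.2 fun x => ?_
    obtain ⟨C, hC⟩ :=
      (isCompact_closedBall (0 : E) (‖x‖ + 1)).exists_bound_of_continuousOn hg.continuousOn
    refine (continuousOn_tsum (fun j => by fun_prop)
      ((summable_geometric_of_lt_one hmu0 hmu1).mul_right C)
      fun j z hz => norm_smul_pow_le h0 h1 hmu0 hC j hz).continuousAt ?_
    filter_upwards [continuous_norm.continuousAt.eventually (gt_mem_nhds (lt_add_one ‖x‖))] with y hy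
    simpa using le_of_lt hy
  intro k
  induction k with
  | zero =>
    intro F _ _ _ mu hmu0 hmu1 g hg
    rw [ckSmall_zero_iff isOpen_univ] at hg ⊢
    refine ⟨fun i => (hcont hmu0 hmu1 ?_).continuousOn,
      fun x _ => hlim hmu0 hmu1 (fun x => hg.2 x (mem_univ x)) x⟩
    exact continuousOn_univ.1 (hg.1 i)
  | succ k ih =>
    intro F _ _ _ mu hmu0 hmu1 g hg
    obtain ⟨hd, hz, hg'⟩ := (ckSmall_succ_iff isOpen_univ).1 hg
    have hml0 : 0 ≤ mu * lam := mul_nonneg hmu0 h0.le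
    have hml1 : mu * lam < 1 := by nlinarith
    have hfd : ∀ i z, HasFDerivAt (fun z => ∑' j : ℕ, mu ^ j • g i (lam ^ j • z))
        (∑' j : ℕ, (mu * lam) ^ j • fderiv ℝ (g i) (lam ^ j • z)) z := by
      intro i z
      have hc : Continuous (fderiv ℝ (g i)) := continuousOn_univ.1 (hg'.contDiffOn i).continuousOn
      obtain ⟨C, hC⟩ :=
        (isCompact_closedBall (0 : E) (‖z‖ + 1)).exists_bound_of_continuousOn hc.continuousOn
      refine hasFDerivAt_tsum_of_isPreconnected (x₀ := z)
        ((summable_geometric_of_lt_one hml0 hml1).mul_right C)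
        (Metric.isOpen_ball (x := (0 : E)) (ε := ‖z‖ + 1))
        (convex_ball _ _).isPreconnected (fun j x _ => ?_)
        (fun j x hx => norm_smul_pow_le h0 h1 hml0 hC j (Metric.ball_subset_closedBall hx))
        (by simp) (summable_smul_pow h0 h1 hmu0 hmu1
          (continuousOn_univ.1 (hg.contDiffOn i).continuousOn) z) (by simp)
      have h2 : HasFDerivAt (g i) (fderiv ℝ (g i) (lam ^ j • x)) (lam ^ j • x) :=
        ((hd i).differentiableAt univ_mem).hasFDerivAt
      have h3 := (h2.comp x ((hasFDerivAt_id x).const_smul (lam ^ j))).const_smul (mu ^ j)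
      refine h3.congr_fderiv ?_
      ext v
      simp [mul_pow, mul_smul]
    refine (ckSmall_succ_iff isOpen_univ).2
      ⟨fun i z _ => (hfd i z).differentiableAt.differentiableWithinAt,
        fun x _ => hlim hmu0 hmu1 (fun x => hz x (mem_univ x)) x, ?_⟩
    exact (ih hml0 hml1 hg').congr isOpen_univ fun i z _ => (hfd i z).fderiv

/-- The coefficient `Q` of the first order Taylor formula `g z = g 0 + Q z`. -/
def taylorCoeff (g : E → ℂ) (z : E) : E →L[ℝ] ℂ := ∫ s in (0 : ℝ)..1, fderiv ℝ g (s • z)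

theorem taylorCoeff_apply {g : E → ℂ} (hg : ContDiff ℝ 1 g) (z : E) :
    taylorCoeff g z z = g z - g 0 := by
  have hc : Continuous fun s : ℝ => fderiv ℝ g (s • z) :=
    (hg.continuous_fderiv (by simp)).comp (by fun_prop)
  rw [taylorCoeff, ContinuousLinearMap.intervalIntegral_apply (hc.intervalIntegrable _ _)]
  have : ∀ s ∈ uIcc (0 : ℝ) 1, HasDerivAt (fun s : ℝ => g (s • z)) (fderiv ℝ g (s • z) z) s := by
    intro s _
    have h1 := ((hg.differentiable (by simp)) (s • z)).hasFDerivAt.comp_hasDerivAt s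
      ((hasDerivAt_id s).smul_const z)
    simpa [Function.comp_def] using! h1
  rw [intervalIntegral.integral_eq_sub_of_hasDerivAt this
    ((hc.clm_apply continuous_const).intervalIntegrable _ _)]
  simp

theorem SmoothSmall.taylorCoeff {g : ι → E → ℂ} (hg : SmoothSmall l univ g) :
    SmoothSmall l univ (fun i => taylorCoeff (g i)) := by
  have h := (((hg.fderiv isOpen_univ).comp isOpen_univ (V := (univ : Set (E × ℝ))) isOpen_univ
    (φ := fun p => p.2 • p.1) (by fun_prop) (mapsTo_univ _ _)).intervalIntegral isOpen_univ 0 1)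
  exact h.mono fun x _ => by simp

/-- The solution `h` of `h z - h (lam z) = g z - g 0` vanishing at the origin. -/
def contractionSum (lam : ℝ) (g : E → ℂ) (z : E) : ℂ := ∑' j : ℕ, (g (lam ^ j • z) - g 0)

theorem summable_contraction (h0 : 0 < lam) (h1 : lam < 1) {g : E → ℂ} (hg : ContDiff ℝ ∞ g)
    (z : E) : Summable fun j : ℕ => g (lam ^ j • z) - g 0 := by
  have hq : Continuous (taylorCoeff g) := continuousOn_univ.1
    ((SmoothSmall.taylorCoeff (l := (⊥ : Filter Unit)) (g := fun _ => g)
      (smoothSmall_bot fun _ => hg.contDiffOn)).contDiffOn ()).continuousOn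
  have h := (summable_smul_pow h0 h1 h0.le h1 hq z).map (ContinuousLinearMap.apply ℝ ℂ z)
    (ContinuousLinearMap.apply ℝ ℂ z).continuous
  refine h.congr fun j => ?_
  rw [← taylorCoeff_apply (hg.of_le (by exact_mod_cast le_top))]
  simp

/-- By Taylor's formula g(lam^j z) - g(0) = lam^j Q(lam^j z) z, where Q is `taylorCoeff g`. The sum
is a geometric-type series of values of Q, applied to z. -/
theorem SmoothSmall.contractionSum (h0 : 0 < lam) (h1 : lam < 1) {g : ι → E → ℂ}
    (hg : SmoothSmall l univ g) : SmoothSmall l univ (fun i => contractionSum lam (g i)) := by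
  have h : SmoothSmall l univ fun i z => ∑' j : ℕ, lam ^ j • ReebFlow.taylorCoeff (g i) (lam ^ j • z) :=
    fun k => (hg.taylorCoeff k).tsum_smul_pow h0 h1 h0.le h1
  refine (h.bilin isOpen_univ (c := fun z => z) (ContinuousLinearMap.id ℝ (E →L[ℝ] ℂ))
    contDiffOn_id).congr isOpen_univ fun i z _ => ?_
  have hgi : ContDiff ℝ ∞ (g i) := contDiffOn_univ.1 (hg.contDiffOn i)
  have hq : Continuous (ReebFlow.taylorCoeff (g i)) := continuousOn_univ.1
    (hg.taylorCoeff.contDiffOn i).continuousOn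
  have hs := summable_smul_pow h0 h1 h0.le h1 hq z
  have h2 := (ContinuousLinearMap.apply ℝ ℂ z).map_tsum hs
  simp only [ContinuousLinearMap.apply_apply] at h2
  rw [ContinuousLinearMap.id_apply, h2]
  refine tsum_congr fun j => ?_
  rw [← taylorCoeff_apply (hgi.of_le (by exact_mod_cast le_top))]
  simp

theorem contractionSum_sub (h0 : 0 < lam) (h1 : lam < 1) {g : E → ℂ} (hg : ContDiff ℝ ∞ g)
    (z : E) : contractionSum lam g z - contractionSum lam g (lam • z) = g z - g 0 := by
  rw [contractionSum, (summable_contraction h0 h1 hg z).tsum_eq_zero_add]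
  simp [contractionSum, pow_succ, mul_smul]

/-- Uniqueness by telescoping: the partial sums are h(z) - h(lam^N z), and lam^N z tends to the
origin, where h is continuous. -/
theorem contractionSum_eq (h0 : 0 < lam) (h1 : lam < 1) {g h : E → ℂ} (hh : ContinuousAt h 0)
    (hg : ContDiff ℝ ∞ g) (hgh : ∀ z, h z - h (lam • z) = g z - g 0) (z : E) :
    contractionSum lam g z = h z - h 0 := by
  have hs := (summable_contraction h0 h1 hg z).hasSum.tendsto_sum_nat
  have hlim : Tendsto (fun N : ℕ => lam ^ N • z) atTop (𝓝 0) := by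
    simpa using (tendsto_pow_atTop_nhds_zero_of_lt_one h0.le h1).smul_const z
  refine tendsto_nhds_unique hs (Tendsto.congr (fun N => ?_)
    (tendsto_const_nhds.sub (hh.tendsto.comp hlim)))
  induction N with
  | zero => simp
  | succ N ih =>
    rw [Finset.sum_range_succ, ← ih, ← hgh, smul_smul, ← pow_succ']
    simp

end Series

/-! ### The C^∞ topology in terms of small families -/

section SmoothFnTopology

set_option linter.unusedSectionVars false

variable {ι : Type*} {E : Type} [NormedAddCommGroup E] [NormedSpace ℝ E] [FiniteDimensional ℝ E]
  {H : Type*} [TopologicalSpace H] {I : ModelWithCorners ℝ E H} [I.Boundaryless]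
  {M : Type*} [TopologicalSpace M] [ChartedSpace H M] [IsManifold I ∞ M]

theorem contDiffOn_comp_extChartAt_symm (f : SmoothFn I M) (x : M) :
    ContDiffOn ℝ ∞ (fun y => f ((extChartAt I x).symm y)) (extChartAt I x).target :=
  (f.contMDiff.comp_contMDiffOn (contMDiffOn_extChartAt_symm x)).contDiffOn

theorem tendsto_smoothFn_iff {g : ι → SmoothFn I M} {l : Filter ι} {f : SmoothFn I M} :
    Tendsto g l (𝓝 f) ↔ ∀ x, SmoothSmall l (extChartAt I x).target
      (fun i y => (g i - f) ((extChartAt I x).symm y)) := by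
  have hsub : ∀ i x (k : ℕ), ∀ y ∈ (extChartAt I x).target,
      iteratedFDeriv ℝ k (g i ∘ (extChartAt I x).symm) y
        - iteratedFDeriv ℝ k (f ∘ (extChartAt I x).symm) y
      = iteratedFDeriv ℝ k (fun y => (g i - f) ((extChartAt I x).symm y)) y := by
    intro i x k y hy
    have hn := (isOpen_extChartAt_target (I := I) x).mem_nhds hy
    have h1 := ((contDiffOn_comp_extChartAt_symm (g i) x).contDiffAt hn).of_le
      (show (k : ℕ∞ω) ≤ ∞ by exact_mod_cast le_top)
    have h2 := ((contDiffOn_comp_extChartAt_symm f x).contDiffAt hn).of_le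
      (show (k : ℕ∞ω) ≤ ∞ by exact_mod_cast le_top)
    exact (iteratedFDeriv_sub_apply h1 h2).symm
  have key : Tendsto g l (𝓝 f) ↔ ∀ x (k : ℕ), ∀ K : Set E, IsCompact K ∧ K ⊆ (extChartAt I x).target →
      TendstoUniformlyOn (fun i => iteratedFDeriv ℝ k (g i ∘ (extChartAt I x).symm))
        (iteratedFDeriv ℝ k (f ∘ (extChartAt I x).symm)) l K := by
    simp only [nhds_iInf, tendsto_iInf, nhds_induced, tendsto_comap_iff]
    refine forall_congr' fun x => forall_congr' fun k => ?_
    rw [UniformOnFun.tendsto_iff_tendstoUniformlyOn]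
    rfl
  rw [key]
  refine forall_congr' fun x => ?_
  have hopen := isOpen_extChartAt_target (I := I) x
  constructor
  · intro h
    refine smoothSmall_iff.2 ⟨fun i => contDiffOn_comp_extChartAt_symm _ x, fun k y hy => ?_⟩
    obtain ⟨K, hK, hyK, hKt⟩ := exists_compact_subset hopen hy
    have h1 := Metric.tendstoUniformlyOn_iff.1 (h k K ⟨hK, hKt⟩)
    rw [Metric.tendsto_nhds]
    intro ε hε
    filter_upwards [(h1 ε hε).prod_mk (mem_interior_iff_mem_nhds.1 hyK)] with p hp
    have := hp.1 p.2 hp.2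
    rwa [dist_comm, dist_eq_norm, hsub p.1 x k p.2 (hKt hp.2), ← norm_norm,
      ← dist_zero_right] at this
  · intro h k K hK
    refine Metric.tendstoUniformlyOn_iff.2 fun ε hε => ?_
    have h1 := eventually_forall_norm_lt_of_isCompact hK.1
      (g := fun i => iteratedFDeriv ℝ k (fun y => (g i - f) ((extChartAt I x).symm y))) (fun y hy =>
      tendsto_zero_iff_norm_tendsto_zero.2 (h.tendsto k (hK.2 hy))) hε
    filter_upwards [h1] with i hi y hy
    rw [dist_comm, dist_eq_norm, hsub i x k y (hK.2 hy)]
    exact hi y hy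

end SmoothFnTopology

/-! ### Functions on the Hopf manifold as homothety invariant functions on the cover -/

section HopfCovering

variable {d : ℕ} {lam : ℝ}

/-- The Euclidean space of dimension `d + 1`, whose complement of the origin covers `S^d × S^1`. -/
abbrev Cover (d : ℕ) : Type := EuclideanSpace ℝ (Fin (d + 1))

theorem contMDiff_coe_euclideanSphere (d : ℕ) : ContMDiff (𝓡 d) 𝓘(ℝ, Cover d) ∞
    (fun u : Metric.sphere (0 : Cover d) 1 => (u : Cover d)) :=
  have := Fact.mk (@finrank_euclideanSpace_fin ℝ _ (d + 1))
  contMDiff_coe_sphere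

theorem contMDiff_coe_circle : ContMDiff (𝓡 1) 𝓘(ℝ, ℂ) ∞ (fun z : Circle => (z : ℂ)) :=
  have := finrank_real_complex_fact'
  contMDiff_coe_sphere (E := ℂ)

theorem direction_coe {p : Cover d} (hp : p ≠ 0) : (direction p : Cover d) = ‖p‖⁻¹ • p := by
  rw [direction, dif_neg hp]

theorem contMDiffOn_direction : ContMDiffOn 𝓘(ℝ, Cover d) (𝓡 d) ∞
    (direction : Cover d → _) {0}ᶜ := by
  intro p hp
  refine ContMDiffAt.contMDiffWithinAt ?_
  have hp0 : 0 < ‖p‖ := norm_pos_iff.2 hp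
  -- `codRestrict_sphere` is applied to a map smooth on the whole space. The identity is therefore
  -- replaced by a map `c` that agrees with it near `p` and stays within ‖p‖ / 2 of `p`, so never
  -- vanishes.
  let ψ : ContDiffBump p := ⟨‖p‖ / 4, ‖p‖ / 2, by positivity, by linarith⟩
  let c : Cover d → Cover d := fun q => p + ψ q • (q - p)
  have hc0 : ∀ q, c q ≠ 0 := by
    intro q hq
    have h1 : ‖ψ q • (q - p)‖ ≤ ‖p‖ / 2 := by
      rw [norm_smul, Real.norm_of_nonneg ψ.nonneg]
      rcases le_total (‖p‖ / 2) (dist q p) with h | h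
      · rw [ψ.zero_of_le_dist h]; simp; positivity
      · rw [dist_eq_norm] at h
        exact (mul_le_of_le_one_left (norm_nonneg _) ψ.le_one).trans h
    have h2 : ψ q • (q - p) = -p := by
      rw [eq_neg_iff_add_eq_zero, add_comm]; exact hq
    rw [h2, norm_neg] at h1
    linarith
  have hc : ContDiff ℝ ∞ c :=
    contDiff_const.add (ψ.contDiff.smul (contDiff_id.sub contDiff_const))
  have hf : ContDiff ℝ ∞ fun q => ‖c q‖⁻¹ • c q :=
    ((hc.norm ℝ hc0).inv fun q => (norm_pos_iff.2 (hc0 q)).ne').smul hc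
  have hmem : ∀ q, ‖c q‖⁻¹ • c q ∈ Metric.sphere (0 : Cover d) 1 := by
    intro q
    simp [norm_smul, hc0 q]
  have := Fact.mk (@finrank_euclideanSpace_fin ℝ _ (d + 1))
  have hS := hf.contMDiff.codRestrict_sphere (n := d) hmem
  refine (hS p).congr_of_eventuallyEq ?_
  filter_upwards [ψ.eventuallyEq_one, isOpen_compl_singleton.mem_nhds hp] with q hq hq0
  refine Subtype.ext ?_
  have : c q = q := by simp [c, hq]
  rw [direction_coe hq0]
  simp [this]

theorem contMDiffOn_hopfMap (lam : ℝ) : ContMDiffOn 𝓘(ℝ, Cover d) (hopfModel d) ∞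
    (hopfMap lam : Cover d → Hopf d) {0}ᶜ := by
  refine contMDiffOn_direction.prodMk ?_
  refine contMDiff_circleExp.comp_contMDiffOn (ContDiffOn.contMDiffOn ?_)
  have h : ContDiffOn ℝ ∞ (fun p : Cover d => Real.log ‖p‖) {0}ᶜ :=
    ContDiffOn.log (contDiffOn_id.norm ℝ fun p hp => hp) fun p hp => (norm_pos_iff.2 hp).ne'
  exact contDiffOn_const.mul (h.div_const _)

theorem exists_local_section (h0 : 0 < lam) (h1 : lam < 1) (x : Hopf d) :
    ∃ (W : Set (Hopf d)) (s : Hopf d → Cover d), IsOpen W ∧ x ∈ W ∧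
      ContMDiffOn (hopfModel d) 𝓘(ℝ, Cover d) ∞ s W ∧ (∀ y, s y ≠ 0) ∧
      ∀ y, hopfMap lam (s y) = y := by
  obtain ⟨θ, hθ⟩ := Circle.exp_surjective x.2
  have hlog : Real.log lam ≠ 0 := (Real.log_neg h0 h1).ne
  -- An angle of the circle coordinate, read off a branch of the argument centred at the base value.
  -- The section identity holds everywhere; the restriction to `W` is needed only for smoothness
  -- across the cut.
  let τ : Hopf d → ℝ := fun y => θ + (Complex.log ((y.2 : ℂ) * (x.2⁻¹ : Circle))).im
  let s : Hopf d → Cover d := fun y => Real.exp (τ y / (2 * Real.pi) * Real.log lam) • (y.1 : Cover d)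
  have hcont : Continuous fun y : Hopf d => (y.2 : ℂ) * (x.2⁻¹ : Circle) := by fun_prop
  have hsm : ContMDiff (hopfModel d) 𝓘(ℝ, ℂ) ∞ fun y : Hopf d => (y.2 : ℂ) * (x.2⁻¹ : Circle) := by
    have h2 : ContDiff ℝ ∞ fun z : ℂ => z * (x.2⁻¹ : Circle) := contDiff_id.mul contDiff_const
    exact h2.contMDiff.comp (contMDiff_coe_circle.comp contMDiff_snd)
  have hn : ∀ y : Hopf d, ‖(y.1 : Cover d)‖ = 1 := fun y => by simp
  have hns : ∀ y, ‖s y‖ = Real.exp (τ y / (2 * Real.pi) * Real.log lam) := fun y => by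
    rw [norm_smul, Real.norm_of_nonneg (Real.exp_pos _).le, hn, mul_one]
  have hs0 : ∀ y, s y ≠ 0 := fun y => by
    rw [← norm_ne_zero_iff, hns]; exact (Real.exp_pos _).ne'
  refine ⟨(fun y : Hopf d => (y.2 : ℂ) * (x.2⁻¹ : Circle)) ⁻¹' Complex.slitPlane, s,
    Complex.isOpen_slitPlane.preimage hcont, ?_, ?_, hs0, fun y => ?_⟩
  · simp
  · have hF : ContDiffOn ℝ ∞ (fun z : ℂ =>
        Real.exp ((θ + (Complex.log z).im) / (2 * Real.pi) * Real.log lam)) Complex.slitPlane := by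
      have hl : ContDiffOn ℝ ∞ (fun z : ℂ => (Complex.log z).im) Complex.slitPlane := fun z hz =>
        (Complex.imCLM.contDiff.contDiffAt.comp z
          ((Complex.contDiffAt_log hz).restrict_scalars ℝ)).contDiffWithinAt
      exact (((contDiffOn_const.add hl).div_const _).mul contDiffOn_const).exp
    exact (hF.contMDiffOn.comp hsm.contMDiffOn subset_rfl).smul
      ((contMDiff_coe_euclideanSphere d).comp contMDiff_fst).contMDiffOn
  · refine Prod.ext (Subtype.ext ?_) ?_
    · change ((direction (s y) : _) : Cover d) = _
      rw [direction_coe (hs0 y), hns, smul_smul, inv_mul_cancel₀ (Real.exp_pos _).ne', one_smul]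
    · simp only [hopfMap]
      rw [hns, Real.log_exp, mul_div_cancel_right₀ _ hlog, mul_div_cancel₀ _ (by positivity),
        Circle.exp_add, hθ, Complex.log_im, ← Circle.coe_mul, Circle.exp_arg, mul_comm y.2,
        mul_inv_cancel_left]

theorem contDiffOn_lift (f : SmoothFn (hopfModel d) (Hopf d)) (lam : ℝ) :
    ContDiffOn ℝ ∞ (fun p : Cover d => f (hopfMap lam p)) {0}ᶜ :=
  (f.contMDiff.comp_contMDiffOn (contMDiffOn_hopfMap lam)).contDiffOn

variable {ι : Type*}

/-- Convergence can be tested on the cover instead of in charts: one direction composes with the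
covering followed by a chart, the other with an inverse chart followed by a local section. -/
theorem tendsto_hopf_iff (h0 : 0 < lam) (h1 : lam < 1)
    {g : ι → SmoothFn (hopfModel d) (Hopf d)} {l : Filter ι} {f : SmoothFn (hopfModel d) (Hopf d)} :
    Tendsto g l (𝓝 f) ↔
      SmoothSmall l {0}ᶜ (fun i (p : Cover d) => (g i - f) (hopfMap lam p)) := by
  rw [tendsto_smoothFn_iff]
  constructor
  · intro h
    refine smoothSmall_of_locally fun p hp => ?_
    let x := hopfMap lam p
    let V : Set (Cover d) := {0}ᶜ ∩ hopfMap lam ⁻¹' (extChartAt (hopfModel d) x).source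
    have hV : IsOpen V := (contMDiffOn_hopfMap lam).continuousOn.isOpen_inter_preimage
      isOpen_compl_singleton (isOpen_extChartAt_source x)
    have hφ : ContDiffOn ℝ ∞ (fun q => extChartAt (hopfModel d) x (hopfMap lam q)) V := by
      refine ContMDiffOn.contDiffOn (ContMDiffOn.comp (contMDiffOn_extChartAt (x := x))
        ((contMDiffOn_hopfMap lam).mono inter_subset_left) fun q hq => ?_)
      rw [← extChartAt_source (hopfModel d)]
      exact hq.2
    refine ⟨V, hV, ⟨hp, mem_extChartAt_source x⟩, ?_⟩
    refine ((h x).comp (isOpen_extChartAt_target x) hV hφ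
      fun q hq => (extChartAt (hopfModel d) x).map_source hq.2).congr hV fun i q hq => ?_
    exact congrArg (g i - f) ((extChartAt (hopfModel d) x).left_inv hq.2).symm
  · intro h x
    refine smoothSmall_of_locally fun y hy => ?_
    obtain ⟨W, s, hW, hyW, hs, hs0, hsx⟩ :=
      exists_local_section h0 h1 ((extChartAt (hopfModel d) x).symm y)
    let V := (extChartAt (hopfModel d) x).target ∩ (extChartAt (hopfModel d) x).symm ⁻¹' W
    have hV : IsOpen V := (continuousOn_extChartAt_symm x).isOpen_inter_preimage
      (isOpen_extChartAt_target x) hW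
    refine ⟨V, hV, ⟨hy, hyW⟩, ?_⟩
    have hφ : ContDiffOn ℝ ∞ (fun q => s ((extChartAt (hopfModel d) x).symm q)) V :=
      ContMDiffOn.contDiffOn (hs.comp ((contMDiffOn_extChartAt_symm x).mono inter_subset_left)
        fun q hq => hq.2)
    refine (h.comp isOpen_compl_singleton hV hφ fun q _ => hs0 _).congr hV fun i q _ => ?_
    simp only [hsx]

theorem continuous_of_smoothSmall_lift {V : Type*} [TopologicalSpace V] [AddCommGroup V] [Module ℂ V]
    (h0 : 0 < lam) (h1 : lam < 1) (T : V →ₗ[ℂ] SmoothFn (hopfModel d) (Hopf d))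
    (hT : ∀ v : V, SmoothSmall (𝓝 v) {0}ᶜ (fun w p => T (w - v) (hopfMap lam p))) :
    Continuous T := by
  refine continuous_iff_continuousAt.2 fun v => (tendsto_hopf_iff h0 h1).2 ?_
  simpa only [map_sub] using hT v

theorem smoothSmall_lift (h0 : 0 < lam) (h1 : lam < 1) (f : SmoothFn (hopfModel d) (Hopf d)) :
    SmoothSmall (𝓝 f) {0}ᶜ (fun g (p : Cover d) => (g - f) (hopfMap lam p)) :=
  (tendsto_hopf_iff h0 h1).1 tendsto_id

/-- Functions on `ℝ^(d+1)` that are smooth away from the origin and invariant by the homothety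
of ratio `lam`. -/
def invariantFn (d : ℕ) (lam : ℝ) : Submodule ℂ (Cover d → ℂ) where
  carrier := {F | ContDiffOn ℝ ∞ F {0}ᶜ ∧ ∀ p ≠ 0, F (lam • p) = F p}
  zero_mem' := ⟨contDiffOn_const, fun _ _ => rfl⟩
  add_mem' hF hG := ⟨hF.1.add hG.1, fun p hp => congrArg₂ (· + ·) (hF.2 p hp) (hG.2 p hp)⟩
  smul_mem' c _ hF := ⟨contDiffOn_const.smul hF.1, fun p hp => congrArg (c • ·) (hF.2 p hp)⟩

theorem hopfMap_smul (h0 : 0 < lam) (h1 : lam < 1) {p : Cover d} (hp : p ≠ 0) :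
    hopfMap lam (lam • p) = hopfMap lam p :=
  ((hopfMap_eq_iff h0 h1 hp (smul_ne_zero h0.ne' hp)).2 ⟨1, by simp⟩).symm

theorem invariantFn_zpow (h0 : 0 < lam) {F : Cover d → ℂ} (hF : F ∈ invariantFn d lam)
    {p : Cover d} (hp : p ≠ 0) (k : ℤ) : F (lam ^ k • p) = F p := by
  have hk : ∀ k : ℤ, lam ^ k • p ≠ 0 := fun k => smul_ne_zero (zpow_ne_zero k h0.ne') hp
  have step : ∀ k : ℤ, F (lam ^ (k + 1) • p) = F (lam ^ k • p) := fun k => by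
    rw [zpow_add_one₀ h0.ne', mul_comm, mul_smul]
    exact hF.2 _ (hk k)
  induction k with
  | zero => simp
  | succ k ih => rw [step, ih]
  | pred k ih => rw [← ih, ← step, sub_add_cancel]

theorem invariantFn_eq (h0 : 0 < lam) (h1 : lam < 1) {F : Cover d → ℂ}
    (hF : F ∈ invariantFn d lam) {p q : Cover d} (hp : p ≠ 0) (hq : q ≠ 0)
    (h : hopfMap lam p = hopfMap lam q) : F p = F q := by
  obtain ⟨k, rfl⟩ := (hopfMap_eq_iff h0 h1 hp hq).1 h
  exact (invariantFn_zpow h0 hF hp k).symm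

/-- The smooth function on `S^d × S^1` with a given lift. -/
def descend (h0 : 0 < lam) (h1 : lam < 1) :
    invariantFn d lam →ₗ[ℂ] SmoothFn (hopfModel d) (Hopf d) where
  -- The chosen preimage varies arbitrarily with `x`; invariance allows it to be replaced near each
  -- point by a smooth local section.
  toFun F := ⟨fun x => F.1 (hopfMap_surjective h0 h1 x).choose, by
    intro x
    obtain ⟨W, s, hW, hxW, hs, hs0, hsx⟩ := exists_local_section h0 h1 x
    refine ContMDiffAt.congr_of_eventuallyEq (f := F.1 ∘ s) ?_ (Eventually.of_forall fun y => ?_)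
    · exact (F.2.1.contMDiffOn.comp hs fun y _ => hs0 y).contMDiffAt (hW.mem_nhds hxW)
    · have := (hopfMap_surjective h0 h1 y).choose_spec
      exact invariantFn_eq h0 h1 F.2 this.1 (hs0 y) (this.2.trans (hsx y).symm)⟩
  map_add' _ _ := rfl
  map_smul' _ _ := rfl

theorem descend_hopfMap (h0 : 0 < lam) (h1 : lam < 1) (F : invariantFn d lam) {p : Cover d}
    (hp : p ≠ 0) : descend h0 h1 F (hopfMap lam p) = F.1 p := by
  have := (hopfMap_surjective h0 h1 (hopfMap lam p)).choose_spec
  exact invariantFn_eq h0 h1 F.2 this.1 hp this.2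

/-- The lift to `ℝ^(d+1)` of a smooth function on `S^d × S^1`. -/
def lift (h0 : 0 < lam) (h1 : lam < 1) :
    SmoothFn (hopfModel d) (Hopf d) →ₗ[ℂ] invariantFn d lam where
  toFun f := ⟨fun p => f (hopfMap lam p), contDiffOn_lift f lam,
    fun _ hp => congrArg f (hopfMap_smul h0 h1 hp)⟩
  map_add' _ _ := rfl
  map_smul' _ _ := rfl

theorem ext_hopf (h0 : 0 < lam) (h1 : lam < 1) {f g : SmoothFn (hopfModel d) (Hopf d)}
    (h : ∀ p ≠ 0, f (hopfMap lam p) = g (hopfMap lam p)) : f = g := by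
  ext x
  obtain ⟨p, hp, rfl⟩ := hopfMap_surjective h0 h1 x
  exact h p hp

end HopfCovering

/-! ### Primitives along the leaves, periods on the closed leaves, and the gap -/

section LeafIntegration

variable {ι : Type*} {m : ℕ} {lam σ : ℝ} {l : Filter ι}

theorem ne_zero_of_mem_uIcc {a b s : ℝ} (hab : 0 < a * b) (hs : s ∈ uIcc a b) : s ≠ 0 := by
  rintro rfl
  rcases mem_uIcc.1 hs with h | h <;> nlinarith

/-- A leaf segment misses the origin when it lies off the axis z = 0, or when both of its ends are
on the same side of t = 0. -/
theorem slice_mem {z : Cover m} {a b : ℝ} (h : z ≠ 0 ∨ 0 < a * b) :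
    ∀ s ∈ uIcc a b, (z, s) ∈ ({0}ᶜ : Set (Cover m × ℝ)) := by
  intro s hs h0
  have h0' := Prod.ext_iff.1 h0
  exact h.elim (fun hz => hz h0'.1) fun hab => ne_zero_of_mem_uIcc hab hs h0'.2

/-- Coefficients `A` of the forms `A dt` on `(ℝ^(m+1) × ℝ) ∖ {0}` that are invariant by the
homothety of ratio `lam`. -/
def homogDensity (m : ℕ) (lam : ℝ) : Submodule ℂ (Cover m × ℝ → ℂ) where
  carrier := {A | ContDiffOn ℝ ∞ A {0}ᶜ ∧ ∀ p, (lam : ℂ) * A (lam • p) = A p}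
  zero_mem' := ⟨contDiffOn_const, fun _ => mul_zero _⟩
  add_mem' hA hB := ⟨hA.1.add hB.1, fun p => by
    rw [Pi.add_apply, mul_add, hA.2 p, hB.2 p, Pi.add_apply]⟩
  smul_mem' c A hA := ⟨contDiffOn_const.smul hA.1, fun p => by
    rw [Pi.smul_apply, mul_smul_comm, hA.2 p, Pi.smul_apply]⟩

theorem continuousOn_leaf {A : Cover m × ℝ → ℂ} (hA : ContinuousOn A {0}ᶜ) {z : Cover m} {a b : ℝ}
    (h : z ≠ 0 ∨ 0 < a * b) : ContinuousOn (fun s => A (z, s)) (uIcc a b) :=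
  continuousOn_slice hA (slice_mem h)

theorem intervalIntegrable_leaf {A : Cover m × ℝ → ℂ} (hA : ContinuousOn A {0}ᶜ) {z : Cover m}
    {a b : ℝ} (h : z ≠ 0 ∨ 0 < a * b) :
    IntervalIntegrable (fun s => A (z, s)) MeasureTheory.volume a b :=
  (continuousOn_leaf hA h).intervalIntegrable

/-- The integral of `A dt` on the arc from `(z, σ)` to `(z, σ / lam)`. -/
def leafFlux (lam σ : ℝ) (A : Cover m × ℝ → ℂ) (z : Cover m) : ℂ := ∫ s in σ..σ / lam, A (z, s)

theorem flux_range_pos (h0 : 0 < lam) (hσ : σ ≠ 0) : 0 < σ * (σ / lam) := by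
  rw [← mul_div_assoc]; exact div_pos (mul_self_pos.2 hσ) h0

theorem SmoothSmall.leafFlux (h0 : 0 < lam) (hσ : σ ≠ 0) {A : ι → Cover m × ℝ → ℂ}
    (hA : SmoothSmall l {0}ᶜ A) : SmoothSmall l univ (fun i => leafFlux lam σ (A i)) :=
  (hA.intervalIntegral isOpen_compl_singleton σ (σ / lam)).mono
    fun _ _ => slice_mem (Or.inr (flux_range_pos h0 hσ))

theorem contDiff_leafFlux (h0 : 0 < lam) (hσ : σ ≠ 0) {A : Cover m × ℝ → ℂ}
    (hA : ContDiffOn ℝ ∞ A {0}ᶜ) : ContDiff ℝ ∞ (leafFlux lam σ A) :=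
  contDiffOn_univ.1 ((SmoothSmall.leafFlux (l := (⊥ : Filter Unit)) h0 hσ
    (smoothSmall_bot fun _ => hA)).contDiffOn ())

/-- The primitive of `A dt` along the leaves, normalized to be homothety invariant up to a
constant and to vanish at `(0, σ)`. -/
def leafPrimitive (lam σ : ℝ) (A : Cover m × ℝ → ℂ) (p : Cover m × ℝ) : ℂ :=
  (∫ s in σ..p.2, A (p.1, s)) - contractionSum lam (leafFlux lam σ A) p.1

/-- The difference on a leaf of the primitives of `A dt` normalized at its two ends. -/
def leafGap (lam : ℝ) (A : Cover m × ℝ → ℂ) (z : Cover m) : ℂ :=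
  (∫ s in (1 : ℝ)..-1, A (z, s)) - contractionSum lam (leafFlux lam 1 A) z
    + contractionSum lam (leafFlux lam (-1) A) z

/-- Both are primitives of the same density on one leaf, which is connected for z ≠ 0, so the
difference does not depend on t. -/
theorem leafPrimitive_sub_leafPrimitive {A : Cover m × ℝ → ℂ} (hA : ContDiffOn ℝ ∞ A {0}ᶜ)
    {z : Cover m} (hz : z ≠ 0) (t : ℝ) :
    leafPrimitive lam 1 A (z, t) - leafPrimitive lam (-1) A (z, t) = leafGap lam A z := by
  have h := fun a b : ℝ => intervalIntegrable_leaf (a := a) (b := b) hA.continuousOn (Or.inl hz)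
  have := intervalIntegral.integral_add_adjacent_intervals (h 1 (-1)) (h (-1) t)
  simp only [leafPrimitive, leafGap]
  rw [← this]
  ring

/-- The substitution s ↦ lam s and the homogeneity of `A` turn the integral at lam • p into the one
at p with base σ / lam instead of σ. The error is the flux at z, and the contraction sum cancels it
up to the flux at the origin. -/
theorem leafPrimitive_smul (h0 : 0 < lam) (h1 : lam < 1) (hσ : σ ≠ 0) {A : Cover m × ℝ → ℂ}
    (hA : A ∈ homogDensity m lam) {p : Cover m × ℝ} (hp : p.1 ≠ 0 ∨ 0 < σ * p.2) :
    leafPrimitive lam σ A (lam • p) = leafPrimitive lam σ A p - leafFlux lam σ A 0 := by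
  have hpos := flux_range_pos (lam := lam) h0 hσ
  have hp' : p.1 ≠ 0 ∨ 0 < σ / lam * p.2 := hp.imp_right fun h => by
    rw [div_mul_eq_mul_div]; exact div_pos h h0
  have hc := hA.1.continuousOn
  have hsub : (∫ s in σ..lam * p.2, A (lam • p.1, s)) = ∫ s in σ / lam..p.2, A (p.1, s) := by
    have h2 := intervalIntegral.smul_integral_comp_mul_left (a := σ / lam) (b := p.2)
      (fun s => A (lam • p.1, s)) lam
    rw [mul_div_cancel₀ _ h0.ne'] at h2
    rw [← h2, ← intervalIntegral.integral_smul]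
    refine intervalIntegral.integral_congr fun s _ => ?_
    have := hA.2 (p.1, s)
    simpa using this
  have hadd := intervalIntegral.integral_add_adjacent_intervals
    (intervalIntegrable_leaf (z := p.1) hc (Or.inr hpos)) (intervalIntegrable_leaf hc hp')
  have hsum := contractionSum_sub h0 h1 (contDiff_leafFlux h0 hσ hA.1) p.1
  have hk : leafFlux lam σ A p.1 = ∫ s in σ..σ / lam, A (p.1, s) := rfl
  simp only [leafPrimitive, Prod.smul_fst, Prod.smul_snd, smul_eq_mul]
  rw [hsub, ← hadd]
  linear_combination hk + hsum

theorem isOpen_leafDomain (m : ℕ) (σ : ℝ) :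
    IsOpen {p : Cover m × ℝ | p.1 ≠ 0 ∨ 0 < σ * p.2} :=
  (isOpen_ne_fun continuous_fst continuous_const).union
    (isOpen_lt continuous_const (continuous_const.mul continuous_snd))

theorem contDiffOn_leafPrimitive (h0 : 0 < lam) (h1 : lam < 1) (hσ : σ ≠ 0)
    {A : Cover m × ℝ → ℂ} (hA : ContDiffOn ℝ ∞ A {0}ᶜ) :
    ContDiffOn ℝ ∞ (leafPrimitive lam σ A) {p | p.1 ≠ 0 ∨ 0 < σ * p.2} := by
  refine ContDiffOn.sub ?_ ?_
  · let φ : (Cover m × ℝ) × ℝ → Cover m × ℝ := fun q => (q.1.1, σ + q.2 * (q.1.2 - σ))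
    have hφ : ContDiff ℝ ∞ φ := by fun_prop
    have hU : IsOpen (φ ⁻¹' {0}ᶜ) := isOpen_compl_singleton.preimage hφ.continuous
    have h2 : SmoothSmall (⊥ : Filter Unit) (φ ⁻¹' {0}ᶜ) fun _ q => A (φ q) :=
      (smoothSmall_bot fun _ => hA).comp isOpen_compl_singleton hU hφ.contDiffOn
        (mapsTo_preimage _ _)
    have h3 := (h2.intervalIntegral hU 0 1).contDiffOn ()
    have h4 : ContDiffOn ℝ ∞ (fun p : Cover m × ℝ => ∫ s in (0 : ℝ)..1, A (φ (p, s)))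
        {p | p.1 ≠ 0 ∨ 0 < σ * p.2} := by
      refine h3.mono fun p hp s hs h => ?_
      obtain ⟨h5, h6⟩ := Prod.ext_iff.1 h
      rw [uIcc_of_le zero_le_one] at hs
      refine hp.elim (fun hz => hz h5) fun hz => ?_
      have h6 : σ + s * (p.2 - σ) = 0 := h6
      -- On the axis the segment avoids the origin: σ times its height is a convex combination of σ²
      -- and σ t, both positive.
      have h7 : (1 - s) * σ ^ 2 + s * (σ * p.2) = 0 := by linear_combination σ * h6
      have : 0 < σ ^ 2 := by positivity
      rcases hs.2.lt_or_eq with hs1 | rfl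
      · nlinarith [mul_nonneg hs.1 hz.le, mul_pos (sub_pos.2 hs1) this]
      · linarith
    refine ((contDiff_snd.sub (contDiff_const (c := σ))).contDiffOn.smul h4).congr fun p _ => ?_
    have h5 := intervalIntegral.smul_integral_comp_mul_add (a := 0) (b := 1)
      (fun s => A (p.1, s)) (p.2 - σ) σ
    simp only [mul_zero, zero_add, mul_one, sub_add_cancel] at h5
    rw [← h5]
    simp only [φ, mul_comm, add_comm]
    rfl
  · have h2 := SmoothSmall.contractionSum (l := (⊥ : Filter Unit)) h0 h1
      (SmoothSmall.leafFlux h0 hσ (smoothSmall_bot fun _ => hA))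
    exact (h2.contDiffOn ()).comp (contDiff_fst (𝕜 := ℝ)).contDiffOn (mapsTo_univ _ _)

theorem hasDerivAt_leafPrimitive {A : Cover m × ℝ → ℂ}
    (hA : ContDiffOn ℝ ∞ A {0}ᶜ) {z : Cover m} {t : ℝ} (hp : z ≠ 0 ∨ 0 < σ * t) :
    HasDerivAt (fun t => leafPrimitive lam σ A (z, t)) (A (z, t)) t := by
  have hmem : (z, t) ∈ ({0}ᶜ : Set (Cover m × ℝ)) := slice_mem hp t right_mem_uIcc
  have hopen : IsOpen ((fun s : ℝ => (z, s)) ⁻¹' {0}ᶜ) :=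
    isOpen_compl_singleton.preimage (by fun_prop)
  have hc : ContinuousOn (fun s : ℝ => A (z, s)) ((fun s : ℝ => (z, s)) ⁻¹' {0}ᶜ) :=
    hA.continuousOn.comp (by fun_prop) (mapsTo_preimage _ _)
  have h := intervalIntegral.integral_hasDerivAt_right (intervalIntegrable_leaf hA.continuousOn hp)
    (hc.stronglyMeasurableAtFilter hopen t hmem) (hc.continuousAt (hopen.mem_nhds hmem))
  exact h.sub_const (contractionSum lam (leafFlux lam σ A) z)

theorem leafFlux_of_hasDerivAt (h0 : 0 < lam) (hσ : σ ≠ 0) {A F : Cover m × ℝ → ℂ}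
    (hA : ContinuousOn A {0}ᶜ) (hF : ∀ p ≠ 0, HasDerivAt (fun t => F (p.1, t)) (A p) p.2)
    (z : Cover m) : leafFlux lam σ A z = F (z, σ / lam) - F (z, σ) :=
  intervalIntegral.integral_eq_sub_of_hasDerivAt (f := fun s => F (z, s))
    (fun s hs => hF (z, s) (slice_mem (Or.inr (flux_range_pos h0 hσ)) s hs))
    (intervalIntegrable_leaf hA (Or.inr (flux_range_pos h0 hσ)))

theorem homothety_arc (h0 : 0 < lam) (hσ : σ ≠ 0) {F : Cover m × ℝ → ℂ}
    (hF : ∀ p ≠ 0, F (lam • p) = F p) (z : Cover m) : F (z, σ / lam) = F (lam • z, σ) := by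
  have hne : (z, σ / lam) ≠ 0 := fun h => (div_ne_zero hσ h0.ne') (Prod.ext_iff.1 h).2
  rw [← hF _ hne]
  simp [mul_div_cancel₀ _ h0.ne']

/-- The arc on the axis from σ to σ / lam closes up in the quotient, and an invariant primitive
takes equal values at its ends. -/
theorem leafFlux_zero_of_exact (h0 : 0 < lam) (hσ : σ ≠ 0) {A F : Cover m × ℝ → ℂ}
    (hA : ContinuousOn A {0}ᶜ) (hF : ∀ p ≠ 0, HasDerivAt (fun t => F (p.1, t)) (A p) p.2)
    (hFi : ∀ p ≠ 0, F (lam • p) = F p) : leafFlux lam σ A 0 = 0 := by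
  rw [leafFlux_of_hasDerivAt h0 hσ hA hF, homothety_arc h0 hσ hFi, smul_zero, sub_self]

/-- For an exact density each normalized primitive differs from F only by the constant F(0, σ),
because -F(·, σ) solves the cohomological equation of the flux. The gap is the difference of these
constants. -/
theorem leafGap_of_exact (h0 : 0 < lam) (h1 : lam < 1) {A F : Cover m × ℝ → ℂ}
    (hA : ContDiffOn ℝ ∞ A {0}ᶜ) (hFc : ContinuousOn F {0}ᶜ)
    (hF : ∀ p ≠ 0, HasDerivAt (fun t => F (p.1, t)) (A p) p.2)
    (hFi : ∀ p ≠ 0, F (lam • p) = F p) {z : Cover m} (hz : z ≠ 0) :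
    leafGap lam A z = F (0, -1) - F (0, 1) := by
  have hS : ∀ σ : ℝ, σ ≠ 0 → contractionSum lam (leafFlux lam σ A) z = F (0, σ) - F (z, σ) := by
    intro σ hσ
    have hne : ((0 : Cover m), σ) ≠ 0 := fun h => hσ (Prod.ext_iff.1 h).2
    rw [contractionSum_eq h0 h1 (h := fun z => -F (z, σ)) ?_ (contDiff_leafFlux h0 hσ hA)]
    · ring
    · intro w
      rw [leafFlux_zero_of_exact h0 hσ hA.continuousOn hF hFi,
        leafFlux_of_hasDerivAt h0 hσ hA.continuousOn hF, homothety_arc h0 hσ hFi]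
      ring
    · have h2 : ContinuousAt F ((0 : Cover m), σ) :=
        hFc.continuousAt (isOpen_compl_singleton.mem_nhds hne)
      exact (ContinuousAt.comp (f := fun w : Cover m => (w, σ)) h2 (by fun_prop)).neg
  have hint : (∫ s in (1 : ℝ)..-1, A (z, s)) = F (z, -1) - F (z, 1) :=
    intervalIntegral.integral_eq_sub_of_hasDerivAt (f := fun s => F (z, s))
      (fun s hs => hF (z, s) (slice_mem (Or.inl hz) s hs))
      (intervalIntegrable_leaf hA.continuousOn (Or.inl hz))
  rw [leafGap, hint, hS 1 one_ne_zero, hS (-1) (by norm_num)]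
  ring

/-- The two normalized primitives are glued. The constant gap makes them agree on z ≠ 0 after adding
κ to the second one, and vanishing periods make the result invariant. -/
theorem exists_exact_primitive (h0 : 0 < lam) (h1 : lam < 1) {A : Cover m × ℝ → ℂ}
    (hA : A ∈ homogDensity m lam) (hc1 : leafFlux lam 1 A 0 = 0)
    (hc2 : leafFlux lam (-1) A 0 = 0) {κ : ℂ}
    (hgap : ∀ z ≠ 0, leafGap lam A z = κ) :
    ∃ F : Cover m × ℝ → ℂ, ContDiffOn ℝ ∞ F {0}ᶜ ∧ (∀ p ≠ 0, F (lam • p) = F p) ∧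
      ∀ p ≠ 0, HasDerivAt (fun t => F (p.1, t)) (A p) p.2 := by
  classical
  let D : ℝ → Set (Cover m × ℝ) := fun σ => {p | p.1 ≠ 0 ∨ 0 < σ * p.2}
  let F : Cover m × ℝ → ℂ := fun p =>
    if p.1 ≠ 0 ∨ 0 < 1 * p.2 then leafPrimitive lam 1 A p else leafPrimitive lam (-1) A p + κ
  have hcover : ∀ p : Cover m × ℝ, p ≠ 0 → p ∈ D 1 ∨ p ∈ D (-1) := by
    intro p hp
    by_cases hz : p.1 = 0
    · have ht : p.2 ≠ 0 := fun ht => hp (Prod.ext hz ht)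
      rcases lt_or_gt_of_ne ht with h | h
      · exact Or.inr (Or.inr (by linarith))
      · exact Or.inl (Or.inr (by linarith))
    · exact Or.inl (Or.inl hz)
  have hF1 : ∀ p ∈ D 1, F p = leafPrimitive lam 1 A p := fun p hp => if_pos hp
  have hF2 : ∀ p ∈ D (-1), F p = leafPrimitive lam (-1) A p + κ := by
    intro p hp
    by_cases hz : p.1 = 0
    · have h2 : p ∉ D 1 := by
        rintro (h | h)
        · exact h hz
        · rcases hp with h' | h'
          · exact h' hz
          · linarith
      exact if_neg h2
    · rw [hF1 p (Or.inl hz), ← hgap p.1 hz, ← leafPrimitive_sub_leafPrimitive hA.1 hz p.2]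
      ring
  have hD : ∀ σ, IsOpen (D σ) := isOpen_leafDomain m
  have hDsmul : ∀ σ p, p ∈ D σ → lam • p ∈ D σ := by
    rintro σ p (h | h)
    · exact Or.inl (smul_ne_zero h0.ne' h)
    · refine Or.inr ?_
      have : 0 < lam * (σ * p.2) := mul_pos h0 h
      simp only [Prod.smul_snd, smul_eq_mul]
      linarith
  have hDline : ∀ σ (p : Cover m × ℝ), p ∈ D σ → ∀ᶠ t in 𝓝 p.2, (p.1, t) ∈ D σ := fun σ p hp =>
    (by fun_prop : ContinuousAt (fun t => (p.1, t)) p.2).eventually ((hD σ).mem_nhds hp)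
  refine ⟨F, fun p hp => ContDiffAt.contDiffWithinAt ?_, fun p hp => ?_, fun p hp => ?_⟩
  · rcases hcover p hp with h | h
    · exact ((contDiffOn_leafPrimitive h0 h1 one_ne_zero hA.1).contDiffAt
        ((hD 1).mem_nhds h)).congr_of_eventuallyEq
        (eventuallyEq_of_mem ((hD 1).mem_nhds h) hF1)
    · exact (((contDiffOn_leafPrimitive h0 h1 (by norm_num) hA.1).contDiffAt
        ((hD (-1)).mem_nhds h)).add contDiffAt_const).congr_of_eventuallyEq
        (eventuallyEq_of_mem ((hD (-1)).mem_nhds h) hF2)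
  · rcases hcover p hp with h | h
    · rw [hF1 _ h, hF1 _ (hDsmul 1 p h), leafPrimitive_smul h0 h1 one_ne_zero hA h,
        hc1, sub_zero]
    · rw [hF2 _ h, hF2 _ (hDsmul (-1) p h), leafPrimitive_smul h0 h1 (by norm_num) hA h,
        hc2, sub_zero]
  · rcases hcover p hp with h | h
    · exact (hasDerivAt_leafPrimitive hA.1 h).congr_of_eventuallyEq
        ((hDline 1 p h).mono fun t ht => hF1 _ ht)
    · exact ((hasDerivAt_leafPrimitive hA.1 h).add_const κ).congr_of_eventuallyEq
        ((hDline (-1) p h).mono fun t ht => hF2 _ ht)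

/-- The lift of the homothety invariant gap: the logarithm compensates the periods. -/
def invariantGap (lam : ℝ) (A : Cover m × ℝ → ℂ) (z : Cover m) : ℂ :=
  leafGap lam A z + (leafFlux lam 1 A 0 - leafFlux lam (-1) A 0) *
    ((Real.log ‖z‖ / Real.log lam : ℝ) : ℂ)

/-- The gap is the difference of the two normalized primitives at height t = 0, which the homothety
preserves; each changes by its own period. -/
theorem leafGap_smul (h0 : 0 < lam) (h1 : lam < 1) {A : Cover m × ℝ → ℂ}
    (hA : A ∈ homogDensity m lam) {z : Cover m} (hz : z ≠ 0) :
    leafGap lam A (lam • z) = leafGap lam A z - (leafFlux lam 1 A 0 - leafFlux lam (-1) A 0) := by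
  have hz' : lam • z ≠ 0 := smul_ne_zero h0.ne' hz
  have h2 := leafPrimitive_smul h0 h1 one_ne_zero hA (p := (z, 0)) (Or.inl hz)
  have h3 := leafPrimitive_smul h0 h1 (σ := -1) (by norm_num) hA (p := (z, 0)) (Or.inl hz)
  rw [← leafPrimitive_sub_leafPrimitive hA.1 hz 0, ← leafPrimitive_sub_leafPrimitive hA.1 hz' 0]
  simp only [Prod.smul_mk, smul_zero] at h2 h3
  rw [h2, h3]
  ring

theorem invariantGap_smul (h0 : 0 < lam) (h1 : lam < 1) {A : Cover m × ℝ → ℂ}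
    (hA : A ∈ homogDensity m lam) {z : Cover m} (hz : z ≠ 0) :
    invariantGap lam A (lam • z) = invariantGap lam A z := by
  have hlog : Real.log lam ≠ 0 := (Real.log_neg h0 h1).ne
  rw [invariantGap, invariantGap, leafGap_smul h0 h1 hA hz, norm_smul, Real.norm_of_nonneg h0.le,
    Real.log_mul h0.ne' (norm_ne_zero_iff.2 hz), add_div, div_self hlog]
  push_cast
  ring

theorem contDiffOn_log_norm (m : ℕ) (lam : ℝ) : ContDiffOn ℝ ∞
    (fun z : Cover m => ((Real.log ‖z‖ / Real.log lam : ℝ) : ℂ)) {0}ᶜ := by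
  have h : ContDiffOn ℝ ∞ (fun p : Cover m => Real.log ‖p‖) {0}ᶜ :=
    ContDiffOn.log (contDiffOn_id.norm ℝ fun p hp => hp) fun p hp => (norm_pos_iff.2 hp).ne'
  exact Complex.ofRealCLM.contDiff.comp_contDiffOn (h.div_const _)

theorem SmoothSmall.invariantGap (h0 : 0 < lam) (h1 : lam < 1) {A : ι → Cover m × ℝ → ℂ}
    (hA : SmoothSmall l {0}ᶜ A) : SmoothSmall l {0}ᶜ (fun i => invariantGap lam (A i)) := by
  have hU : IsOpen ({0}ᶜ : Set (Cover m)) := isOpen_compl_singleton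
  have hS : ∀ σ : ℝ, σ ≠ 0 → SmoothSmall l {0}ᶜ
      (fun i => ReebFlow.contractionSum lam (ReebFlow.leafFlux lam σ (A i)) : ι → Cover m → ℂ) := fun σ hσ =>
    ((hA.leafFlux h0 hσ).contractionSum h0 h1).mono (subset_univ _)
  have hk : ∀ σ : ℝ, σ ≠ 0 → SmoothSmall l {0}ᶜ
      (fun i (_ : Cover m) => ReebFlow.leafFlux lam σ (A i) 0) := fun σ hσ =>
    (hA.leafFlux h0 hσ).comp isOpen_univ hU (φ := fun _ => 0) contDiffOn_const (mapsTo_univ _ _)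
  have hI := (hA.intervalIntegral isOpen_compl_singleton 1 (-1)).mono
    (fun z (hz : z ∈ ({0}ᶜ : Set (Cover m))) => slice_mem (Or.inl hz))
  have hm : (-1 : ℝ) ≠ 0 := by norm_num
  exact ((hI.sub hU (hS 1 one_ne_zero)).add hU (hS (-1) hm)).add hU
    (((hk 1 one_ne_zero).sub hU (hk (-1) hm)).mul hU (contDiffOn_log_norm m lam))

theorem leafFlux_add (h0 : 0 < lam) (hσ : σ ≠ 0) {A B : Cover m × ℝ → ℂ}
    (hA : ContinuousOn A {0}ᶜ) (hB : ContinuousOn B {0}ᶜ) :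
    leafFlux lam σ (A + B) = leafFlux lam σ A + leafFlux lam σ B := by
  ext z
  exact intervalIntegral.integral_add
    (intervalIntegrable_leaf hA (Or.inr (flux_range_pos h0 hσ)))
    (intervalIntegrable_leaf hB (Or.inr (flux_range_pos h0 hσ)))

theorem leafFlux_smul (c : ℂ) (A : Cover m × ℝ → ℂ) :
    leafFlux lam σ (c • A) = c • leafFlux lam σ A := by
  ext z
  exact intervalIntegral.integral_smul c fun s => A (z, s)

theorem contractionSum_add (h0 : 0 < lam) (h1 : lam < 1) {g h : Cover m → ℂ}
    (hg : ContDiff ℝ ∞ g) (hh : ContDiff ℝ ∞ h) (z : Cover m) :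
    contractionSum lam (g + h) z = contractionSum lam g z + contractionSum lam h z := by
  rw [contractionSum, contractionSum, contractionSum,
    ← (summable_contraction h0 h1 hg z).tsum_add (summable_contraction h0 h1 hh z)]
  exact tsum_congr fun j => by simp only [Pi.add_apply]; ring

theorem contractionSum_smul (c : ℂ) (g : Cover m → ℂ) (z : Cover m) :
    contractionSum lam (c • g) z = c * contractionSum lam g z := by
  rw [contractionSum, contractionSum, ← tsum_mul_left]
  exact tsum_congr fun j => by simp only [Pi.smul_apply, smul_eq_mul]; ring

/-- The period of `A dt` along the closed leaf through `(0, σ)`. -/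
def period (h0 : 0 < lam) (hσ : σ ≠ 0) : homogDensity m lam →ₗ[ℂ] ℂ where
  toFun A := leafFlux lam σ A.1 0
  map_add' A B := congrFun (leafFlux_add h0 hσ A.2.1.continuousOn B.2.1.continuousOn) 0
  map_smul' c A := congrFun (leafFlux_smul c A.1) 0

theorem invariantGap_mem (h0 : 0 < lam) (h1 : lam < 1) {A : Cover m × ℝ → ℂ}
    (hA : A ∈ homogDensity m lam) : invariantGap lam A ∈ invariantFn m lam :=
  ⟨(SmoothSmall.invariantGap (l := (⊥ : Filter Unit)) h0 h1
    (smoothSmall_bot fun _ => hA.1)).contDiffOn (), fun _ hz => invariantGap_smul h0 h1 hA hz⟩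

/-- The gap as a linear map; it is set to zero at the origin. -/
def gap (h0 : 0 < lam) (h1 : lam < 1) :
    homogDensity m lam →ₗ[ℂ] SmoothFn (hopfModel m) (Hopf m) where
  toFun A := descend h0 h1 ⟨invariantGap lam A.1, invariantGap_mem h0 h1 A.2⟩
  map_add' A B := ext_hopf h0 h1 fun z hz => by
    have hA := A.2.1
    have hB := B.2.1
    have hm : (-1 : ℝ) ≠ 0 := by norm_num
    have hint : (∫ s in (1 : ℝ)..-1, (A.1 + B.1) (z, s))
        = (∫ s in (1 : ℝ)..-1, A.1 (z, s)) + ∫ s in (1 : ℝ)..-1, B.1 (z, s) :=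
      intervalIntegral.integral_add (intervalIntegrable_leaf hA.continuousOn (Or.inl hz))
        (intervalIntegrable_leaf hB.continuousOn (Or.inl hz))
    rw [ContMDiffMap.coe_add, Pi.add_apply]
    simp only [descend_hopfMap h0 h1 _ hz, invariantGap, leafGap, Submodule.coe_add]
    rw [leafFlux_add h0 one_ne_zero hA.continuousOn hB.continuousOn,
      leafFlux_add h0 hm hA.continuousOn hB.continuousOn, hint,
      contractionSum_add h0 h1 (contDiff_leafFlux h0 one_ne_zero hA)
        (contDiff_leafFlux h0 one_ne_zero hB),
      contractionSum_add h0 h1 (contDiff_leafFlux h0 hm hA) (contDiff_leafFlux h0 hm hB)]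
    simp only [Pi.add_apply]
    ring
  map_smul' c A := ext_hopf h0 h1 fun z hz => by
    have hint : (∫ s in (1 : ℝ)..-1, (c • A.1) (z, s)) = c * ∫ s in (1 : ℝ)..-1, A.1 (z, s) :=
      intervalIntegral.integral_smul c fun s => A.1 (z, s)
    rw [RingHom.id_apply, smoothFn_smul_apply]
    simp only [descend_hopfMap h0 h1 _ hz, invariantGap, leafGap, Submodule.coe_smul]
    rw [leafFlux_smul, leafFlux_smul, hint, contractionSum_smul, contractionSum_smul]
    simp only [Pi.smul_apply, smul_eq_mul]
    ring

theorem gap_hopfMap (h0 : 0 < lam) (h1 : lam < 1) (A : homogDensity m lam) {z : Cover m}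
    (hz : z ≠ 0) : gap h0 h1 A (hopfMap lam z) = invariantGap lam A.1 z :=
  descend_hopfMap h0 h1 _ hz

end LeafIntegration

/-! ### Prescribing the gap by a density supported away from the closed leaves -/

section GapSection

variable {ι : Type*} {m : ℕ} {lam : ℝ} {l : Filter ι}

theorem deriv_smoothTransition_eq_zero {x : ℝ} (hx : 1 < |x|) :
    deriv Real.smoothTransition x = 0 := by
  rcases lt_abs.1 hx with h | h
  · have : Real.smoothTransition =ᶠ[𝓝 x] fun _ => 1 :=
      (eventually_gt_nhds h).mono fun y hy => Real.smoothTransition.one_of_one_le hy.le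
    rw [this.deriv_eq, deriv_const]
  · have : Real.smoothTransition =ᶠ[𝓝 x] fun _ => 0 :=
      (eventually_lt_nhds (show x < 0 by linarith)).mono
        fun y hy => Real.smoothTransition.zero_of_nonpos hy.le
    rw [this.deriv_eq, deriv_const]

/-- A density, supported away from the closed leaves, whose gap is `W`. -/
def sectionDensity (W : Cover m → ℂ) (p : Cover m × ℝ) : ℂ :=
  W p.1 * ((-(deriv Real.smoothTransition (p.2 / ‖p.1‖) * ‖p.1‖⁻¹) : ℝ) : ℂ)

theorem contDiff_deriv_smoothTransition : ContDiff ℝ ∞ (deriv Real.smoothTransition) :=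
  (contDiff_infty_iff_deriv.1 Real.smoothTransition.contDiff).2

/-- The derivative of the transition function vanishes outside [-1, 1], so the density is zero on
the cone ‖z‖ < |t|. That cone contains the axis, where W is not controlled. -/
theorem SmoothSmall.sectionDensity {W : ι → Cover m → ℂ} (hW : SmoothSmall l {0}ᶜ W) :
    SmoothSmall l {0}ᶜ (fun i => sectionDensity (W i)) := by
  refine smoothSmall_of_locally fun p hp => ?_
  by_cases hz : p.1 = 0
  · have hV : IsOpen {p : Cover m × ℝ | ‖p.1‖ < |p.2|} :=
      isOpen_lt (by fun_prop) (by fun_prop)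
    refine ⟨_, hV, ?_, smoothSmall_zero.congr hV fun i q hq => ?_⟩
    · have ht : p.2 ≠ 0 := fun ht => hp (Prod.ext hz ht)
      simpa [hz] using ht
    -- On the axis itself the factor ‖z‖⁻¹ is 0 by the convention for the inverse of zero.
    · rcases eq_or_ne q.1 0 with h | h
      · simp [ReebFlow.sectionDensity, h]
      · have hn : 0 < ‖q.1‖ := norm_pos_iff.2 h
        have : deriv Real.smoothTransition (q.2 / ‖q.1‖) = 0 :=
          deriv_smoothTransition_eq_zero (by
            rw [abs_div, abs_norm, one_lt_div hn]; exact hq)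
        simp [ReebFlow.sectionDensity, this]
  · have hV : IsOpen {p : Cover m × ℝ | p.1 ≠ 0} := isOpen_ne_fun continuous_fst continuous_const
    refine ⟨_, hV, hz, ?_⟩
    refine (hW.comp isOpen_compl_singleton hV (φ := Prod.fst) contDiff_fst.contDiffOn
      fun q hq => hq).mul hV (Complex.ofRealCLM.contDiff.comp_contDiffOn ?_)
    have hn : ContDiffOn ℝ ∞ (fun q : Cover m × ℝ => ‖q.1‖) {p | p.1 ≠ 0} :=
      (contDiff_fst.contDiffOn).norm ℝ fun q hq => hq
    have hn0 : ∀ q ∈ {p : Cover m × ℝ | p.1 ≠ 0}, ‖q.1‖ ≠ 0 := fun q hq => norm_ne_zero_iff.2 hq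
    exact ((contDiff_deriv_smoothTransition.comp_contDiffOn
      (contDiff_snd.contDiffOn.div hn hn0)).mul (hn.inv hn0)).neg

theorem sectionDensity_mem (h0 : 0 < lam) {W : Cover m → ℂ} (hW : W ∈ invariantFn m lam) :
    sectionDensity W ∈ homogDensity m lam := by
  refine ⟨(SmoothSmall.sectionDensity (l := (⊥ : Filter Unit))
    (smoothSmall_bot fun _ => hW.1)).contDiffOn (), fun p => ?_⟩
  rcases eq_or_ne p.1 0 with h | h
  · simp [sectionDensity, h]
  · simp only [sectionDensity, Prod.smul_fst, Prod.smul_snd, hW.2 _ h, norm_smul, smul_eq_mul,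
      Real.norm_of_nonneg h0.le, mul_div_mul_left _ _ h0.ne', mul_inv]
    have : (lam : ℂ) ≠ 0 := by exact_mod_cast h0.ne'
    push_cast
    field_simp

theorem integral_sectionDensity (W : Cover m → ℂ) (z : Cover m) (a b : ℝ) :
    ∫ s in a..b, sectionDensity W (z, s) = W z *
      ((Real.smoothTransition (a / ‖z‖) - Real.smoothTransition (b / ‖z‖) : ℝ) : ℂ) := by
  have hd : ∀ s ∈ uIcc a b, HasDerivAt (fun s => -Real.smoothTransition (s / ‖z‖))
      (-(deriv Real.smoothTransition (s / ‖z‖) * ‖z‖⁻¹)) s := by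
    intro s _
    have h1 : HasDerivAt Real.smoothTransition (deriv Real.smoothTransition (s / ‖z‖)) (s / ‖z‖) :=
      ((Real.smoothTransition.contDiff (n := 1)).differentiable (by simp) _).hasDerivAt
    have h2 := (h1.comp s ((hasDerivAt_id s).div_const ‖z‖)).neg
    simpa [Function.comp_def, div_eq_mul_inv] using! h2
  have hc : Continuous fun s => -(deriv Real.smoothTransition (s / ‖z‖) * ‖z‖⁻¹) :=
    ((contDiff_deriv_smoothTransition.continuous.comp (by fun_prop)).mul continuous_const).neg
  simp only [sectionDensity]
  rw [intervalIntegral.integral_const_mul, intervalIntegral.integral_ofReal,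
    intervalIntegral.integral_eq_sub_of_hasDerivAt hd (hc.intervalIntegrable _ _)]
  congr 2
  ring

theorem leafFlux_sectionDensity_zero (σ : ℝ) (W : Cover m → ℂ) :
    leafFlux lam σ (sectionDensity W) 0 = 0 := by
  simp [leafFlux, sectionDensity]

/-- With χ the smooth transition function, the integral between heights 1 and -1 contributes W(z)
χ(1/‖z‖). The contraction sum for σ = 1 contributes the missing W(z) (1 - χ(1/‖z‖)), and the one for
σ = -1 vanishes because χ is zero on negative numbers. -/
theorem invariantGap_sectionDensity (h0 : 0 < lam) (h1 : lam < 1) {W : Cover m → ℂ}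
    (hW : W ∈ invariantFn m lam) {z : Cover m} (hz : z ≠ 0) :
    invariantGap lam (sectionDensity W) z = W z := by
  classical
  have hA := (sectionDensity_mem h0 hW).1
  have hflux : ∀ σ : ℝ, ∀ w : Cover m, w ≠ 0 → leafFlux lam σ (sectionDensity W) w = W w *
      ((Real.smoothTransition (σ / ‖w‖) - Real.smoothTransition (σ / ‖lam • w‖) : ℝ) : ℂ) := by
    intro σ w _
    rw [leafFlux, integral_sectionDensity W w, norm_smul, Real.norm_of_nonneg h0.le, div_div]
  -- Minus the mass of the density above height 1. It solves the cohomological equation by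
  -- invariance of W, and it vanishes on the unit ball, where 1/‖w‖ ≥ 1.
  let h : Cover m → ℂ := fun w =>
    if w = 0 then 0 else -(W w * ((1 - Real.smoothTransition (1 / ‖w‖) : ℝ) : ℂ))
  have hh : h =ᶠ[𝓝 0] fun _ => 0 := by
    filter_upwards [Metric.ball_mem_nhds (0 : Cover m) one_pos] with w hw
    rcases eq_or_ne w 0 with h' | h'
    · simp [h, h']
    · have h2 : 1 ≤ 1 / ‖w‖ := by
        rw [le_div_iff₀ (norm_pos_iff.2 h')]
        simpa using (mem_ball_zero_iff.1 hw).le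
      simp only [h, h', if_false, Real.smoothTransition.one_of_one_le h2]
      simp
  have hp : contractionSum lam (leafFlux lam 1 (sectionDensity W)) z = h z - h 0 := by
    refine contractionSum_eq h0 h1 (continuousAt_const.congr hh.symm)
      (contDiff_leafFlux h0 one_ne_zero hA) (fun w => ?_) z
    rw [leafFlux_sectionDensity_zero]
    rcases eq_or_ne w 0 with rfl | h'
    · simp [leafFlux_sectionDensity_zero]
    · have h2 : lam • w ≠ 0 := smul_ne_zero h0.ne' h'
      simp only [h, h', h2, if_false, hflux 1 w h', hW.2 w h']
      push_cast
      ring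
  have hm : contractionSum lam (leafFlux lam (-1) (sectionDensity W)) z = 0 := by
    have hneg : ∀ w : Cover m, Real.smoothTransition (-1 / ‖w‖) = 0 := fun w =>
      Real.smoothTransition.zero_of_nonpos (div_nonpos_of_nonpos_of_nonneg (by norm_num)
        (norm_nonneg _))
    rw [contractionSum_eq (h := fun _ => 0) h0 h1 continuousAt_const
      (contDiff_leafFlux h0 (by norm_num) hA), sub_zero]
    intro w
    rw [leafFlux_sectionDensity_zero]
    rcases eq_or_ne w 0 with rfl | h'
    · simp [leafFlux_sectionDensity_zero]
    · rw [hflux _ w h', hneg, hneg]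
      simp
  have hneg : Real.smoothTransition (-1 / ‖z‖) = 0 :=
    Real.smoothTransition.zero_of_nonpos (div_nonpos_of_nonpos_of_nonneg (by norm_num)
      (norm_nonneg _))
  rw [invariantGap, leafGap, hp, hm, leafFlux_sectionDensity_zero, leafFlux_sectionDensity_zero,
    integral_sectionDensity W z, hneg]
  simp only [h, hz, if_true, if_false]
  push_cast
  ring

end GapSection

/-! ### Functions and densities; the complete obstruction to exactness -/

section Split

variable {ι : Type*} {m : ℕ} {lam : ℝ} {l : Filter ι}

/-- The splitting `ℝ^(m+2) = ℝ^(m+1) × ℝ` into the coordinates `(z, t)`. -/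
def splitCLE (m : ℕ) : (Cover m × ℝ) ≃L[ℝ] Cover (m + 1) :=
  LinearEquiv.toContinuousLinearEquiv
    { toFun := fun q => WithLp.toLp 2 (Fin.snoc (α := fun _ => ℝ) (fun i => q.1 i) q.2)
      invFun := fun p => (WithLp.toLp 2 fun i => p (Fin.castSucc i), p (Fin.last (m + 1)))
      map_add' := fun p q => by
        ext i
        refine Fin.lastCases ?_ (fun j => ?_) i <;> simp
      map_smul' := fun c q => by
        ext i
        refine Fin.lastCases ?_ (fun j => ?_) i <;> simp
      left_inv := fun q => by
        refine Prod.ext ?_ ?_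
        · ext i
          simp
        · simp
      right_inv := fun p => by
        ext i
        refine Fin.lastCases ?_ (fun j => ?_) i <;> simp }

/-- The vector `∂/∂t`. -/
abbrev lastVec (m : ℕ) : Cover (m + 1) := EuclideanSpace.single (Fin.last (m + 1)) 1

theorem splitCLE_zero_one (m : ℕ) : splitCLE m (0, 1) = lastVec m := by
  ext i
  refine Fin.lastCases ?_ (fun j => ?_) i
  · simp [splitCLE]
  · have : Fin.castSucc j ≠ Fin.last (m + 1) := (Fin.castSucc_lt_last j).ne
    simp [splitCLE, this]

theorem splitCLE_apply_last (q : Cover m × ℝ) : splitCLE m q (Fin.last (m + 1)) = q.2 := by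
  simp [splitCLE]

theorem splitCLE_line (z : Cover m) (t : ℝ) :
    splitCLE m (z, t) = splitCLE m (z, 0) + t • lastVec m := by
  rw [← splitCLE_zero_one, ← map_smul, ← map_add]
  simp

theorem norm_splitCLE_axis (t : ℝ) : ‖splitCLE m (0, t)‖ = |t| := by
  rw [splitCLE_line]
  have : ((0 : Cover m), (0 : ℝ)) = 0 := rfl
  simp [this, norm_smul]

theorem splitCLE_ne_zero {q : Cover m × ℝ} (hq : q ≠ 0) : splitCLE m q ≠ 0 := by
  simpa using hq

theorem splitCLE_symm_ne_zero {p : Cover (m + 1)} (hp : p ≠ 0) : (splitCLE m).symm p ≠ 0 := by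
  simpa using hp

theorem contDiffOn_norm_splitCLE (m : ℕ) :
    ContDiffOn ℝ ∞ (fun q : Cover m × ℝ => ((‖splitCLE m q‖⁻¹ : ℝ) : ℂ)) {0}ᶜ :=
  Complex.ofRealCLM.contDiff.comp_contDiffOn
    (((splitCLE m).contDiff.contDiffOn.norm ℝ fun _ hq => splitCLE_ne_zero hq).inv
      fun _ hq => norm_ne_zero_iff.2 (splitCLE_ne_zero hq))

theorem SmoothSmall.density {G : ι → Cover (m + 1) → ℂ} (hG : SmoothSmall l {0}ᶜ G) :
    SmoothSmall l {0}ᶜ (fun i (q : Cover m × ℝ) => G i (splitCLE m q) * ((‖splitCLE m q‖⁻¹ : ℝ) : ℂ)) :=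
  (hG.comp isOpen_compl_singleton isOpen_compl_singleton (splitCLE m).contDiff.contDiffOn
    fun _ hq => splitCLE_ne_zero hq).mul isOpen_compl_singleton (contDiffOn_norm_splitCLE m)

/-- The density `A` for which `g` is the value of the form `A dt` on the field `‖p‖ ∂/∂t`. -/
def density (h0 : 0 < lam) (h1 : lam < 1) :
    SmoothFn (hopfModel (m + 1)) (Hopf (m + 1)) →ₗ[ℂ] homogDensity m lam where
  toFun g := ⟨fun q => g (hopfMap lam (splitCLE m q)) * ((‖splitCLE m q‖⁻¹ : ℝ) : ℂ),
    (SmoothSmall.density (l := (⊥ : Filter Unit))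
      (smoothSmall_bot fun _ => contDiffOn_lift g lam)).contDiffOn (), fun q => by
    rcases eq_or_ne q 0 with rfl | hq
    · simp
    · have : (lam : ℂ) ≠ 0 := by exact_mod_cast h0.ne'
      beta_reduce
      rw [map_smul, hopfMap_smul h0 h1 (splitCLE_ne_zero hq), norm_smul,
        Real.norm_of_nonneg h0.le, mul_inv]
      push_cast
      field_simp⟩
  map_add' _ _ := Subtype.ext (funext fun _ => add_mul _ _ _)
  map_smul' _ _ := Subtype.ext (funext fun _ => mul_assoc _ _ _)

theorem SmoothSmall.ofDensity {A : ι → Cover m × ℝ → ℂ} (hA : SmoothSmall l {0}ᶜ A) :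
    SmoothSmall l {0}ᶜ (fun i (p : Cover (m + 1)) => A i ((splitCLE m).symm p) * ((‖p‖ : ℝ) : ℂ)) :=
  (hA.comp isOpen_compl_singleton isOpen_compl_singleton (splitCLE m).symm.contDiff.contDiffOn
    fun _ hq => splitCLE_symm_ne_zero hq).mul isOpen_compl_singleton
    (Complex.ofRealCLM.contDiff.comp_contDiffOn (contDiffOn_id.norm ℝ fun _ hp => hp))

/-- The inverse of `density`. -/
def ofDensity (h0 : 0 < lam) (h1 : lam < 1) :
    homogDensity m lam →ₗ[ℂ] SmoothFn (hopfModel (m + 1)) (Hopf (m + 1)) :=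
  descend h0 h1 ∘ₗ
    { toFun := fun A => ⟨fun p => A.1 ((splitCLE m).symm p) * ((‖p‖ : ℝ) : ℂ),
        (SmoothSmall.ofDensity (l := (⊥ : Filter Unit))
          (smoothSmall_bot fun _ => A.2.1)).contDiffOn (), fun p _ => by
        have h2 := A.2.2 ((splitCLE m).symm p)
        beta_reduce
        rw [map_smul, ← h2, norm_smul, Real.norm_of_nonneg h0.le]
        push_cast
        ring⟩
      map_add' := fun _ _ => Subtype.ext (funext fun _ => add_mul _ _ _)
      map_smul' := fun _ _ => Subtype.ext (funext fun _ => mul_assoc _ _ _) }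

theorem ofDensity_hopfMap (h0 : 0 < lam) (h1 : lam < 1) (A : homogDensity m lam)
    {p : Cover (m + 1)} (hp : p ≠ 0) :
    ofDensity h0 h1 A (hopfMap lam p) = A.1 ((splitCLE m).symm p) * ((‖p‖ : ℝ) : ℂ) :=
  descend_hopfMap h0 h1 _ hp

theorem density_ofDensity (h0 : 0 < lam) (h1 : lam < 1) (A : homogDensity m lam) :
    density h0 h1 (ofDensity h0 h1 A) = A := by
  refine Subtype.ext (funext fun q => ?_)
  change ofDensity h0 h1 A (hopfMap lam (splitCLE m q)) * ((‖splitCLE m q‖⁻¹ : ℝ) : ℂ) = _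
  rcases eq_or_ne q 0 with rfl | hq
  -- At the origin homogeneity reads lam · A 0 = A 0 and forces A 0 = 0, in agreement with the
  -- convention ‖0‖⁻¹ = 0 on the left.
  · have h2 := A.2.2 0
    rw [smul_zero] at h2
    have h3 : (lam : ℂ) - 1 ≠ 0 := by
      rw [sub_ne_zero]; exact_mod_cast h1.ne
    have h4 : ((lam : ℂ) - 1) * A.1 0 = 0 := by linear_combination h2
    rw [(mul_eq_zero.1 h4).resolve_left h3]
    simp
  · have h2 := splitCLE_ne_zero hq
    have h3 : ((‖splitCLE m q‖ : ℝ) : ℂ) ≠ 0 := by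
      exact_mod_cast norm_ne_zero_iff.2 h2
    rw [ofDensity_hopfMap h0 h1 A h2, ContinuousLinearEquiv.symm_apply_apply]
    push_cast
    field_simp

/-- `g` is the derivative of a smooth function along the image of the field `‖p‖ ∂/∂t`. -/
def IsLeafExact (lam : ℝ) (g : SmoothFn (hopfModel (m + 1)) (Hopf (m + 1))) : Prop :=
  ∃ f : SmoothFn (hopfModel (m + 1)) (Hopf (m + 1)), ∀ p : Cover (m + 1), p ≠ 0 →
    g (hopfMap lam p) = (‖p‖ : ℂ) * fderiv ℝ (fun q => f (hopfMap lam q)) p (lastVec m)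

theorem hasDerivAt_splitCLE_line {F : Cover (m + 1) → ℂ} {q : Cover m × ℝ}
    (hF : DifferentiableAt ℝ F (splitCLE m q)) :
    HasDerivAt (fun t => F (splitCLE m (q.1, t))) (fderiv ℝ F (splitCLE m q) (lastVec m)) q.2 := by
  have h2 : HasDerivAt (fun t => splitCLE m (q.1, t)) (lastVec m) q.2 := by
    have h3 : HasDerivAt (fun t : ℝ => splitCLE m (q.1, 0) + t • lastVec m)
        ((1 : ℝ) • lastVec m) q.2 := ((hasDerivAt_id q.2).smul_const (lastVec m)).const_add _
    rw [one_smul] at h3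
    exact h3.congr_of_eventuallyEq (Eventually.of_forall fun t => splitCLE_line q.1 t)
  exact hF.hasFDerivAt.comp_hasDerivAt q.2 h2

/-- The gap of a function on `S^(m+1) × S^1`. -/
def gapMap (h0 : 0 < lam) (h1 : lam < 1) :
    SmoothFn (hopfModel (m + 1)) (Hopf (m + 1)) →ₗ[ℂ] SmoothFn (hopfModel m) (Hopf m) :=
  gap h0 h1 ∘ₗ density h0 h1

/-- The periods of a function on `S^(m+1) × S^1` along the two closed leaves. -/
def periodMap (h0 : 0 < lam) (h1 : lam < 1) {σ : ℝ} (hσ : σ ≠ 0) :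
    SmoothFn (hopfModel (m + 1)) (Hopf (m + 1)) →ₗ[ℂ] ℂ :=
  period h0 hσ ∘ₗ density h0 h1

/-- When both periods vanish the logarithmic correction disappears and the invariant gap is the
plain one, so `leafGap_of_exact` and `exists_exact_primitive` give the two implications. -/
theorem isLeafExact_iff (h0 : 0 < lam) (h1 : lam < 1)
    (g : SmoothFn (hopfModel (m + 1)) (Hopf (m + 1))) : IsLeafExact lam g ↔
      periodMap h0 h1 one_ne_zero g = 0 ∧ periodMap h0 h1 (neg_ne_zero.2 one_ne_zero) g = 0 ∧
      ∃ κ : ℂ, ∀ x, gapMap h0 h1 g x = κ := by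
  let A := density h0 h1 g
  have hm : (-1 : ℝ) ≠ 0 := neg_ne_zero.2 one_ne_zero
  constructor
  · rintro ⟨f, hf⟩
    let F : Cover m × ℝ → ℂ := fun q => f (hopfMap lam (splitCLE m q))
    have hFc : ContinuousOn F {0}ᶜ := (contDiffOn_lift f lam).continuousOn.comp
      (splitCLE m).continuous.continuousOn fun q hq => splitCLE_ne_zero hq
    have hFi : ∀ p ≠ 0, F (lam • p) = F p := fun p hp => by
      simp only [F, map_smul, hopfMap_smul h0 h1 (splitCLE_ne_zero hp)]
    have hF : ∀ p ≠ 0, HasDerivAt (fun t => F (p.1, t)) (A.1 p) p.2 := by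
      intro p hp
      have hp' := splitCLE_ne_zero hp
      have h2 := hasDerivAt_splitCLE_line (q := p) (((contDiffOn_lift f lam).contDiffAt
        (isOpen_compl_singleton.mem_nhds hp')).differentiableAt (by simp))
      have h3 : A.1 p = fderiv ℝ (fun q => f (hopfMap lam q)) (splitCLE m p) (lastVec m) := by
        change g (hopfMap lam (splitCLE m p)) * ((‖splitCLE m p‖⁻¹ : ℝ) : ℂ) = _
        have h4 : ((‖splitCLE m p‖ : ℝ) : ℂ) ≠ 0 := by exact_mod_cast norm_ne_zero_iff.2 hp'
        rw [hf _ hp']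
        push_cast
        field_simp
      rw [h3]
      exact h2
    have hc := A.2.1.continuousOn
    have e1 : leafFlux lam 1 A.1 0 = 0 := leafFlux_zero_of_exact h0 one_ne_zero hc hF hFi
    have e2 : leafFlux lam (-1) A.1 0 = 0 := leafFlux_zero_of_exact h0 hm hc hF hFi
    refine ⟨e1, e2, F (0, -1) - F (0, 1), fun x => ?_⟩
    obtain ⟨z, hz, rfl⟩ := hopfMap_surjective h0 h1 x
    refine (gap_hopfMap h0 h1 A hz).trans ?_
    rw [invariantGap, e1, e2, leafGap_of_exact h0 h1 A.2.1 hFc hF hFi hz]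
    simp
  · rintro ⟨e1, e2, κ, hκ⟩
    have e1 : leafFlux lam 1 A.1 0 = 0 := e1
    have e2 : leafFlux lam (-1) A.1 0 = 0 := e2
    obtain ⟨F, hF, hFi, hFd⟩ := exists_exact_primitive h0 h1 A.2 e1 e2 (κ := κ) fun z hz => by
      have h2 := (gap_hopfMap h0 h1 A hz).symm.trans (hκ _)
      rw [invariantGap, e1, e2] at h2
      simpa using h2
    have hG : (fun p => F ((splitCLE m).symm p)) ∈ invariantFn (m + 1) lam :=
      ⟨hF.comp (splitCLE m).symm.contDiff.contDiffOn fun p hp => splitCLE_symm_ne_zero hp,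
        fun p hp => by simp only [map_smul, hFi _ (splitCLE_symm_ne_zero hp)]⟩
    let f := descend h0 h1 ⟨_, hG⟩
    refine ⟨f, fun p hp => ?_⟩
    obtain ⟨q, rfl⟩ := (splitCLE m).surjective p
    have hq : q ≠ 0 := by rintro rfl; simp at hp
    have h2 := hasDerivAt_splitCLE_line (q := q) (((contDiffOn_lift f lam).contDiffAt
        (isOpen_compl_singleton.mem_nhds hp)).differentiableAt (by simp))
    have h3 : HasDerivAt (fun t => f (hopfMap lam (splitCLE m (q.1, t)))) (A.1 q) q.2 := by
      refine (hFd q hq).congr_of_eventuallyEq ?_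
      have : ∀ᶠ t in 𝓝 q.2, (q.1, t) ≠ 0 :=
        (by fun_prop : ContinuousAt (fun t => (q.1, t)) q.2).eventually_ne hq
      filter_upwards [this] with t ht
      refine (descend_hopfMap h0 h1 _ (splitCLE_ne_zero ht)).trans ?_
      simp
    rw [h2.unique h3]
    change _ = _ * (g (hopfMap lam (splitCLE m q)) * ((‖splitCLE m q‖⁻¹ : ℝ) : ℂ))
    have h4 : ((‖splitCLE m q‖ : ℝ) : ℂ) ≠ 0 := by exact_mod_cast norm_ne_zero_iff.2 hp
    push_cast
    field_simp

theorem smoothSmall_density_sub (h0 : 0 < lam) (h1 : lam < 1)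
    (f : SmoothFn (hopfModel (m + 1)) (Hopf (m + 1))) :
    SmoothSmall (𝓝 f) {0}ᶜ (fun g => (density h0 h1 (g - f)).1) :=
  (smoothSmall_lift h0 h1 f).density

theorem continuous_gapMap (h0 : 0 < lam) (h1 : lam < 1) :
    Continuous (gapMap h0 h1 : SmoothFn (hopfModel (m + 1)) (Hopf (m + 1)) →ₗ[ℂ] _) :=
  continuous_of_smoothSmall_lift h0 h1 _ fun f =>
    ((smoothSmall_density_sub h0 h1 f).invariantGap h0 h1).congr isOpen_compl_singleton
      fun _ _ hz => gap_hopfMap h0 h1 _ hz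

theorem continuous_periodMap (h0 : 0 < lam) (h1 : lam < 1) {σ : ℝ} (hσ : σ ≠ 0) :
    Continuous (periodMap h0 h1 hσ : SmoothFn (hopfModel (m + 1)) (Hopf (m + 1)) →ₗ[ℂ] ℂ) := by
  refine continuous_iff_continuousAt.2 fun f => ?_
  have h2 : Tendsto (fun g => periodMap h0 h1 hσ (g - f)) (𝓝 f) (𝓝 0) :=
    ((smoothSmall_density_sub h0 h1 f).leafFlux h0 hσ).tendsto_at (mem_univ 0)
  simpa [ContinuousAt, map_sub] using! h2.add_const (periodMap h0 h1 hσ f)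

/-- A continuous right inverse of `gapMap` with vanishing periods. -/
def gapSection (h0 : 0 < lam) (h1 : lam < 1) :
    SmoothFn (hopfModel m) (Hopf m) →ₗ[ℂ] SmoothFn (hopfModel (m + 1)) (Hopf (m + 1)) :=
  ofDensity h0 h1 ∘ₗ
    { toFun := fun W => ⟨sectionDensity W.1, sectionDensity_mem h0 W.2⟩
      map_add' := fun _ _ => Subtype.ext (funext fun _ => add_mul _ _ _)
      map_smul' := fun _ _ => Subtype.ext (funext fun _ => mul_assoc _ _ _) } ∘ₗ lift h0 h1

theorem density_gapSection (h0 : 0 < lam) (h1 : lam < 1) (w : SmoothFn (hopfModel m) (Hopf m)) :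
    (density h0 h1 (gapSection h0 h1 w)).1 = sectionDensity fun z => w (hopfMap lam z) :=
  congrArg Subtype.val (density_ofDensity h0 h1 _)

theorem gapMap_gapSection (h0 : 0 < lam) (h1 : lam < 1) (w : SmoothFn (hopfModel m) (Hopf m)) :
    gapMap h0 h1 (gapSection h0 h1 w) = w := ext_hopf h0 h1 fun z hz => by
  refine (gap_hopfMap h0 h1 _ hz).trans ?_
  rw [density_gapSection]
  exact invariantGap_sectionDensity h0 h1 (lift h0 h1 w).2 hz

theorem periodMap_gapSection (h0 : 0 < lam) (h1 : lam < 1) {σ : ℝ} (hσ : σ ≠ 0)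
    (w : SmoothFn (hopfModel m) (Hopf m)) : periodMap h0 h1 hσ (gapSection h0 h1 w) = 0 := by
  change leafFlux lam σ (density h0 h1 (gapSection h0 h1 w)).1 0 = 0
  rw [density_gapSection, leafFlux_sectionDensity_zero]

theorem continuous_gapSection (h0 : 0 < lam) (h1 : lam < 1) :
    Continuous (gapSection h0 h1 : SmoothFn (hopfModel m) (Hopf m) →ₗ[ℂ] _) :=
  continuous_of_smoothSmall_lift h0 h1 _ fun f =>
    ((smoothSmall_lift h0 h1 f).sectionDensity.ofDensity).congr isOpen_compl_singleton
      fun _ _ hz => ofDensity_hopfMap h0 h1 _ hz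

/-- A multiple of 1 + σ t/‖p‖ is constant on each closed leaf and zero on the one of sign -σ. Its
gap is then removed by `gapSection`, which does not affect the periods. -/
theorem exists_periodMap_eq (h0 : 0 < lam) (h1 : lam < 1) {σ : ℝ} (hσ : σ = 1 ∨ σ = -1)
    (hσ0 : σ ≠ 0) (hσ1 : -σ ≠ 0) : ∃ g : SmoothFn (hopfModel (m + 1)) (Hopf (m + 1)),
      gapMap h0 h1 g = 0 ∧ periodMap h0 h1 hσ0 g = 1 ∧ periodMap h0 h1 hσ1 g = 0 := by
  have hlog : Real.log lam ≠ 0 := (Real.log_neg h0 h1).ne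
  -- The denominator normalizes the period to 1: the integral of ds / |s| from σ to σ / lam is -σ
  -- log lam.
  let G : Cover (m + 1) → ℂ := fun p =>
    ((-(1 + σ * (‖p‖⁻¹ * p (Fin.last (m + 1)))) / (2 * σ * Real.log lam) : ℝ) : ℂ)
  have hG : G ∈ invariantFn (m + 1) lam := by
    refine ⟨Complex.ofRealCLM.contDiff.comp_contDiffOn (ContDiffOn.div_const ?_ _), fun p hp => ?_⟩
    · have hn : ContDiffOn ℝ ∞ (fun p : Cover (m + 1) => ‖p‖⁻¹) {0}ᶜ :=
        (contDiffOn_id.norm ℝ fun _ hp => hp).inv fun p hp => norm_ne_zero_iff.2 hp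
      exact (contDiffOn_const.add (contDiffOn_const.mul (hn.mul (by fun_prop)))).neg
    · simp only [G, norm_smul, Real.norm_of_nonneg h0.le, PiLp.smul_apply, smul_eq_mul]
      have : ‖p‖ ≠ 0 := norm_ne_zero_iff.2 hp
      congr 4
      field_simp
  let g := descend h0 h1 ⟨G, hG⟩
  have hper : ∀ (σ' : ℝ) (hσ' : σ' ≠ 0), (σ' = 1 ∨ σ' = -1) →
      periodMap h0 h1 hσ' g = ((1 + σ * σ') / (2 * σ * σ') : ℝ) := by
    intro σ' hσ' h
    have hval : ∀ s ∈ uIcc σ' (σ' / lam), (density h0 h1 g).1 ((0 : Cover m), s)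
        = ((-(1 + σ * σ') / (2 * σ * σ' * Real.log lam) * s⁻¹ : ℝ) : ℂ) := by
      intro s hs
      have hs0 : s ≠ 0 := ne_zero_of_mem_uIcc (flux_range_pos h0 hσ') hs
      have hne : ((0 : Cover m), s) ≠ 0 := fun h => hs0 (Prod.ext_iff.1 h).2
      have habs : |s| = σ' * s := by
        rcases h with rfl | rfl
        · have : 1 ≤ 1 / lam := by rw [le_div_iff₀ h0]; linarith
          rw [uIcc_of_le this] at hs
          rw [abs_of_pos (by linarith [hs.1]), one_mul]
        · have : -1 / lam ≤ -1 := by rw [div_le_iff₀ h0]; linarith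
          rw [uIcc_of_ge this] at hs
          rw [abs_of_neg (by linarith [hs.2])]; ring
      have hσ2 : σ' * σ' = 1 := by rcases h with rfl | rfl <;> norm_num
      change descend h0 h1 ⟨G, hG⟩ (hopfMap lam (splitCLE m (0, s))) * _ = _
      rw [descend_hopfMap h0 h1 _ (splitCLE_ne_zero hne)]
      simp only [G]
      rw [← Complex.ofReal_mul, splitCLE_apply_last, norm_splitCLE_axis, habs]
      congr 1
      field_simp
      linear_combination σ * hσ2
    change (∫ s in σ'..σ' / lam, (density h0 h1 g).1 ((0 : Cover m), s)) = _
    rw [intervalIntegral.integral_congr hval, intervalIntegral.integral_ofReal,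
      intervalIntegral.integral_const_mul,
      integral_inv fun h' => ne_zero_of_mem_uIcc (flux_range_pos h0 hσ') h' rfl]
    rw [div_div_cancel_left' hσ', Real.log_inv]
    congr 1
    field_simp
  have hσ2 : σ * σ = 1 := by rcases hσ with rfl | rfl <;> norm_num
  refine ⟨g - gapSection h0 h1 (gapMap h0 h1 g), ?_, ?_, ?_⟩
  · rw [map_sub, gapMap_gapSection, sub_self]
  · rw [map_sub, periodMap_gapSection, sub_zero, hper σ hσ0 hσ]
    rw [mul_assoc, hσ2]
    norm_num
  · rw [map_sub, periodMap_gapSection, sub_zero,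
      hper (-σ) hσ1 (by rcases hσ with rfl | rfl <;> simp)]
    rw [mul_neg, hσ2]
    simp

end Split

/-! ### A surjection on periodic functions whose kernel is the constants -/

section Fold

variable {ι : Type*} {l : Filter ι}

/-- The function `sin (2πx)`, with complex values. -/
def sinTwoPi (x : ℝ) : ℂ := (Real.sin (2 * Real.pi * x) : ℝ)

theorem contDiff_sinTwoPi : ContDiff ℝ ∞ sinTwoPi :=
  Complex.ofRealCLM.contDiff.comp (Real.contDiff_sin.comp (contDiff_const.mul contDiff_id))

theorem sinTwoPi_neg (x : ℝ) : sinTwoPi (-x) = -sinTwoPi x := by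
  simp [sinTwoPi]

theorem sinTwoPi_add_one (x : ℝ) : sinTwoPi (x + 1) = sinTwoPi x := by
  simp [sinTwoPi, mul_add, Real.sin_add_two_pi]

theorem hasDerivAt_sinTwoPi (x : ℝ) :
    HasDerivAt sinTwoPi ((Real.cos (2 * Real.pi * x) * (2 * Real.pi) : ℝ) : ℂ) x := by
  have h : HasDerivAt (fun x => Real.sin (2 * Real.pi * x))
      (Real.cos (2 * Real.pi * x) * (2 * Real.pi)) x := by
    have h2 := (hasDerivAt_id x).const_mul (2 * Real.pi)
    rw [mul_one] at h2
    exact (Real.hasDerivAt_sin _).comp x h2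
  exact h.ofReal_comp

theorem deriv_sinTwoPi_ne_zero {x : ℝ} (hx : sinTwoPi x = 0) : deriv sinTwoPi x ≠ 0 := by
  rw [(hasDerivAt_sinTwoPi x).deriv]
  have hs : Real.sin (2 * Real.pi * x) = 0 := Complex.ofReal_eq_zero.1 hx
  have hc : Real.cos (2 * Real.pi * x) ≠ 0 := by
    intro hc
    have := Real.sin_sq_add_cos_sq (2 * Real.pi * x)
    rw [hs, hc] at this
    norm_num at this
  have := Real.pi_pos.ne'
  exact_mod_cast mul_ne_zero hc (by positivity)

open Classical in
/-- The quotient of `g` by `sin (2πx)`, for a function `g` vanishing at the zeros of the sine. -/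
def sinDiv (g : ℝ → ℂ) (x : ℝ) : ℂ :=
  if sinTwoPi x = 0 then deriv g x / deriv sinTwoPi x else g x / sinTwoPi x

theorem sinDiv_mul {g : ℝ → ℂ} {x : ℝ} (hg : sinTwoPi x = 0 → g x = 0) :
    sinDiv g x * sinTwoPi x = g x := by
  by_cases h : sinTwoPi x = 0
  · rw [h, mul_zero, hg h]
  · rw [sinDiv, if_neg h, div_mul_cancel₀ _ h]

theorem sinDiv_mul_sin {g : ℝ → ℂ} {x : ℝ} (hg : DifferentiableAt ℝ g x) :
    sinDiv (fun x => g x * sinTwoPi x) x = g x := by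
  by_cases h : sinTwoPi x = 0
  · rw [sinDiv, if_pos h, deriv_fun_mul hg (hasDerivAt_sinTwoPi x).differentiableAt, h, mul_zero,
      zero_add, mul_div_cancel_right₀ _ (deriv_sinTwoPi_ne_zero h)]
  · rw [sinDiv, if_neg h, mul_div_cancel_right₀ _ h]

theorem taylorCoeff_apply_one {g : ℝ → ℂ} (hg : ContDiff ℝ 1 g) (y : ℝ) :
    (y : ℂ) * taylorCoeff g y 1 = g y - g 0 := by
  have h := taylorCoeff_apply hg y
  have h2 : taylorCoeff g y y = y • taylorCoeff g y 1 := by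
    rw [← map_smul, smul_eq_mul, mul_one]
  rw [← h, h2, Complex.real_smul]

theorem taylorCoeff_zero_apply_one (g : ℝ → ℂ) : taylorCoeff g 0 1 = deriv g 0 := by
  simp [taylorCoeff]

/-- Near a zero a of the sine, Taylor's formula writes both functions as (x - a) times a smooth
factor. The factor of the sine is nonzero at a because the zero is simple, so the quotient of the
factors is smooth and has the prescribed value at a. -/
theorem SmoothSmall.sinDiv {g : ι → ℝ → ℂ} (hg : SmoothSmall l univ g)
    (h0 : ∀ i x, sinTwoPi x = 0 → g i x = 0) : SmoothSmall l univ (fun i => sinDiv (g i)) := by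
  refine smoothSmall_of_locally fun a _ => ?_
  by_cases ha : sinTwoPi a = 0
  · have hshift : ContDiff ℝ ∞ fun y : ℝ => a + y := by fun_prop
    have hs : ContDiff ℝ ∞ fun y => sinTwoPi (a + y) := contDiff_sinTwoPi.comp hshift
    let s : ℝ → ℂ := fun y => ReebFlow.taylorCoeff (fun y => sinTwoPi (a + y)) y 1
    have hsc : ContDiff ℝ ∞ s := contDiffOn_univ.1 (((SmoothSmall.taylorCoeff
      (l := (⊥ : Filter Unit)) (smoothSmall_bot fun _ => hs.contDiffOn)).clm_apply isOpen_univ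
        (ContinuousLinearMap.apply ℝ ℂ (1 : ℝ))).contDiffOn ())
    have hG : SmoothSmall l univ fun i y => ReebFlow.taylorCoeff (fun y => g i (a + y)) y 1 :=
      (hg.comp isOpen_univ isOpen_univ hshift.contDiffOn (mapsTo_univ _ _)).taylorCoeff.clm_apply
        isOpen_univ (ContinuousLinearMap.apply ℝ ℂ (1 : ℝ))
    have hback : ContDiff ℝ ∞ fun x : ℝ => x - a := by fun_prop
    let V : Set ℝ := {x | s (x - a) ≠ 0}
    have hV : IsOpen V := isOpen_ne_fun (hsc.continuous.comp hback.continuous) continuous_const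
    have hs0 : s 0 = deriv sinTwoPi a := by
      simp only [s]
      rw [taylorCoeff_zero_apply_one, deriv_comp_const_add, add_zero]
    refine ⟨V, hV, ?_, ?_⟩
    · simp only [V, mem_ofPred_eq, sub_self, hs0]
      exact deriv_sinTwoPi_ne_zero ha
    · refine ((hG.comp isOpen_univ hV hback.contDiffOn (mapsTo_univ _ _)).mul hV
        ((hsc.comp hback).contDiffOn.inv fun x hx => hx)).congr hV fun i x hx => ?_
      have hgi : ContDiff ℝ ∞ (g i) := contDiffOn_univ.1 (hg.contDiffOn i)
      have e1 := taylorCoeff_apply_one (hs.of_le (by exact_mod_cast le_top)) (x - a)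
      have e2 := taylorCoeff_apply_one
        ((hgi.comp hshift).of_le (by exact_mod_cast le_top)) (x - a)
      simp only [Function.comp_def, add_sub_cancel, add_zero, ha, h0 i a ha, sub_zero] at e1 e2
      have hx' : ReebFlow.taylorCoeff (fun y => sinTwoPi (a + y)) (x - a) 1 ≠ 0 := hx
      rcases eq_or_ne x a with rfl | hxa
      · have e3 : ReebFlow.taylorCoeff (fun y => g i (x + y)) 0 1 = deriv (g i) x := by
          rw [taylorCoeff_zero_apply_one, deriv_comp_const_add, add_zero]
        simp only [ReebFlow.sinDiv, if_pos ha, Function.comp_def, sub_self]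
        rw [e3, div_eq_mul_inv, ← hs0]
        change _ = _ * (s (x - x))⁻¹
        rw [sub_self]
      · have hxa' : ((x - a : ℝ) : ℂ) ≠ 0 := by exact_mod_cast sub_ne_zero.2 hxa
        have hne : sinTwoPi x ≠ 0 := by rw [← e1]; exact mul_ne_zero hxa' hx'
        simp only [ReebFlow.sinDiv, if_neg hne, Function.comp_def]
        rw [← e1, ← e2, mul_div_mul_left _ _ hxa', div_eq_mul_inv]
        rfl
  · have hV : IsOpen {x | sinTwoPi x ≠ 0} :=
      isOpen_ne_fun contDiff_sinTwoPi.continuous continuous_const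
    refine ⟨_, hV, ha, ?_⟩
    refine ((hg.mono (subset_univ _)).mul hV (contDiff_sinTwoPi.contDiffOn.inv
      fun x hx => hx)).congr hV fun i x hx => ?_
    simp only [ReebFlow.sinDiv]
    rw [if_neg hx, div_eq_mul_inv]
    rfl

/-- Smooth functions on the line of period one. -/
def periodicFn : Submodule ℂ (ℝ → ℂ) where
  carrier := {q | ContDiff ℝ ∞ q ∧ ∀ x, q (x + 1) = q x}
  zero_mem' := ⟨contDiff_const, fun _ => rfl⟩
  add_mem' hp hq := ⟨hp.1.add hq.1, fun x => congrArg₂ (· + ·) (hp.2 x) (hq.2 x)⟩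
  smul_mem' c _ hq := ⟨contDiff_const.smul hq.1, fun x => congrArg (c • ·) (hq.2 x)⟩

/-- The even part of a function. -/
def evenPart : (ℝ → ℂ) →ₗ[ℂ] ℝ → ℂ where
  toFun q x := (q x + q (-x)) / 2
  map_add' p q := by ext x; simp only [Pi.add_apply]; ring
  map_smul' c q := by ext x; simp only [Pi.smul_apply, smul_eq_mul, RingHom.id_apply]; ring

/-- The odd part of a function. -/
def oddPart : (ℝ → ℂ) →ₗ[ℂ] ℝ → ℂ where
  toFun q x := (q x - q (-x)) / 2
  map_add' p q := by ext x; simp only [Pi.add_apply]; ring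
  map_smul' c q := by ext x; simp only [Pi.smul_apply, smul_eq_mul, RingHom.id_apply]; ring

theorem evenPart_apply (q : ℝ → ℂ) (x : ℝ) : evenPart q x = (q x + q (-x)) / 2 := rfl

theorem oddPart_apply (q : ℝ → ℂ) (x : ℝ) : oddPart q x = (q x - q (-x)) / 2 := rfl

theorem evenPart_neg (q : ℝ → ℂ) (x : ℝ) : evenPart q (-x) = evenPart q x := by
  simp only [evenPart_apply, neg_neg, add_comm]

theorem oddPart_neg (q : ℝ → ℂ) (x : ℝ) : oddPart q (-x) = -oddPart q x := by
  simp only [oddPart_apply, neg_neg]; ring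

theorem periodic_neg {q : ℝ → ℂ} (hq : ∀ x, q (x + 1) = q x) (x : ℝ) : q (-(x + 1)) = q (-x) := by
  rw [← hq (-(x + 1))]; congr 1; ring

theorem SmoothSmall.evenPart {q : ι → ℝ → ℂ} (hq : SmoothSmall l univ q) :
    SmoothSmall l univ (fun i => evenPart (q i)) :=
  (hq.add isOpen_univ (hq.comp isOpen_univ isOpen_univ contDiff_neg.contDiffOn
    (mapsTo_univ _ _))).mul isOpen_univ (contDiffOn_const (c := (2 : ℂ)⁻¹))

theorem SmoothSmall.oddPart {q : ι → ℝ → ℂ} (hq : SmoothSmall l univ q) :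
    SmoothSmall l univ (fun i => oddPart (q i)) :=
  (hq.sub isOpen_univ (hq.comp isOpen_univ isOpen_univ contDiff_neg.contDiffOn
    (mapsTo_univ _ _))).mul isOpen_univ (contDiffOn_const (c := (2 : ℂ)⁻¹))

theorem contDiff_evenPart {q : ℝ → ℂ} (hq : ContDiff ℝ ∞ q) : ContDiff ℝ ∞ (evenPart q) :=
  (hq.add (hq.comp contDiff_neg)).div_const 2

theorem evenPart_add_one {q : ℝ → ℂ} (hq : ∀ x, q (x + 1) = q x) (x : ℝ) :
    evenPart q (x + 1) = evenPart q x := by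
  rw [evenPart_apply, periodic_neg hq, hq, evenPart_apply]

theorem oddPart_add_one {q : ℝ → ℂ} (hq : ∀ x, q (x + 1) = q x) (x : ℝ) :
    oddPart q (x + 1) = oddPart q x := by
  rw [oddPart_apply, periodic_neg hq, hq, oddPart_apply]

/-- The primitive of `q x * sin (2πx)` vanishing at the origin. -/
def sinPrimitive (q : ℝ → ℂ) (x : ℝ) : ℂ := ∫ s in (0 : ℝ)..x, q s * sinTwoPi s

theorem hasDerivAt_sinPrimitive {q : ℝ → ℂ} (hq : Continuous q) (x : ℝ) :
    HasDerivAt (sinPrimitive q) (q x * sinTwoPi x) x :=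
  (hq.mul contDiff_sinTwoPi.continuous).integral_hasStrictDerivAt 0 x |>.hasDerivAt

theorem sinPrimitive_neg {q : ℝ → ℂ} (hq : ∀ x, q (-x) = q x) (x : ℝ) :
    sinPrimitive q (-x) = sinPrimitive q x := by
  have h := intervalIntegral.integral_comp_neg (a := 0) (b := x) fun s => q s * sinTwoPi s
  simp only [hq, sinTwoPi_neg, mul_neg, intervalIntegral.integral_neg, neg_zero] at h
  rw [sinPrimitive, sinPrimitive, intervalIntegral.integral_symm, ← h, neg_neg]

theorem sinPrimitive_add_one {q : ℝ → ℂ} (hc : Continuous q) (hq : ∀ x, q (-x) = q x)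
    (hp : ∀ x, q (x + 1) = q x) (x : ℝ) : sinPrimitive q (x + 1) = sinPrimitive q x := by
  have hcs : Continuous fun s => q s * sinTwoPi s := hc.mul contDiff_sinTwoPi.continuous
  have hper : Function.Periodic (fun s => q s * sinTwoPi s) 1 := fun s => by
    simp only [hp, sinTwoPi_add_one]
  -- The integral over a period may be taken over [-1/2, 1/2], where the odd integrand has integral
  -- zero.
  have h1 := hper.intervalIntegral_add_eq x (-(1 / 2))
  have h2 : sinPrimitive q (-(1 / 2)) = sinPrimitive q (1 / 2) := sinPrimitive_neg hq _
  have h3 := fun a b : ℝ => intervalIntegral.integral_interval_sub_left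
    (hcs.intervalIntegrable (μ := MeasureTheory.volume) 0 a) (hcs.intervalIntegrable 0 b)
  have h4 := h3 (x + 1) x
  have h5 := h3 (-(1 / 2) + 1) (-(1 / 2))
  rw [h1, ← h5] at h4
  have h6 : (-(1 / 2) + 1 : ℝ) = 1 / 2 := by norm_num
  rw [h6] at h4
  simp only [sinPrimitive] at h2 ⊢
  rw [h2, sub_self] at h4
  exact sub_eq_zero.1 h4

theorem SmoothSmall.sinPrimitive {q : ι → ℝ → ℂ} (hq : SmoothSmall l univ q) :
    SmoothSmall l univ (fun i => sinPrimitive (q i)) := by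
  have h1 := hq.mul isOpen_univ contDiff_sinTwoPi.contDiffOn
  have h2 := ((h1.comp isOpen_univ (V := (univ : Set (ℝ × ℝ))) isOpen_univ (φ := fun p => p.1 * p.2)
    (by fun_prop) (mapsTo_univ _ _)).intervalIntegral isOpen_univ 0 1).mono
    (V := univ) fun x _ => by simp
  refine (h2.mul isOpen_univ (c := fun x : ℝ => (x : ℂ)) Complex.ofRealCLM.contDiff.contDiffOn).congr
    isOpen_univ fun i x _ => ?_
  have h3 := intervalIntegral.smul_integral_comp_mul_left (a := 0) (b := 1)
    (fun s => q i s * sinTwoPi s) x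
  rw [mul_zero, mul_one] at h3
  rw [ReebFlow.sinPrimitive, ← h3, Complex.real_smul, mul_comm]

/-- Operator on functions of period one, with right inverse the injection `periodicUnfold`, whose
kernel is the line of the constants. -/
def foldFn (q : ℝ → ℂ) (x : ℝ) : ℂ := oddPart q x + sinDiv (deriv (evenPart q)) x

/-- The right inverse of `foldFn`. -/
def unfoldFn (q : ℝ → ℂ) (x : ℝ) : ℂ := oddPart q x + sinPrimitive (evenPart q) x

theorem deriv_evenPart_neg (q : ℝ → ℂ) (x : ℝ) :
    deriv (evenPart q) (-x) = -deriv (evenPart q) x := by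
  have h := deriv_comp_neg (evenPart q) x
  have h2 : (fun x => evenPart q (-x)) = evenPart q := funext (evenPart_neg q)
  rw [h2] at h
  rw [h, neg_neg]

theorem deriv_evenPart_add_one {q : ℝ → ℂ} (hq : ∀ x, q (x + 1) = q x) (x : ℝ) :
    deriv (evenPart q) (x + 1) = deriv (evenPart q) x := by
  rw [← deriv_comp_add_const]
  congr 1
  exact funext (evenPart_add_one hq)

/-- The zeros of sin(2πx) are the half-integers, where -x and x agree modulo one; an odd function of
period one vanishes there. -/
theorem deriv_evenPart_eq_zero {q : ℝ → ℂ} (hq : ∀ x, q (x + 1) = q x) {x : ℝ}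
    (hx : sinTwoPi x = 0) : deriv (evenPart q) x = 0 := by
  have hs : Real.sin (2 * Real.pi * x) = 0 := Complex.ofReal_eq_zero.1 hx
  obtain ⟨k, hk⟩ := Real.sin_eq_zero_iff.1 hs
  have hper : Function.Periodic (deriv (evenPart q)) 1 := deriv_evenPart_add_one hq
  have h1 := hper.sub_zsmul_eq k (x := x)
  have h2 : x - k • (1 : ℝ) = -x := by
    have := Real.pi_pos.ne'
    have h3 : (k : ℝ) = 2 * x := by
      have : Real.pi * (k - 2 * x) = 0 := by linear_combination hk
      have := (mul_eq_zero.1 this).resolve_left Real.pi_pos.ne'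
      linarith
    simp only [zsmul_eq_mul, mul_one, h3]
    ring
  rw [h2, deriv_evenPart_neg] at h1
  have h4 : (2 : ℂ) * deriv (evenPart q) x = 0 := by linear_combination -h1
  simpa using h4

theorem sinDiv_neg {g : ℝ → ℂ} (hg : ∀ x, g (-x) = -g x) (x : ℝ) :
    sinDiv g (-x) = sinDiv g x := by
  have hd : ∀ {g : ℝ → ℂ}, (∀ x, g (-x) = -g x) → deriv g (-x) = deriv g x := by
    intro g hg
    have h := deriv_comp_neg g x
    have h2 : (fun x => g (-x)) = fun x => -g x := funext hg
    rw [h2, deriv.fun_neg] at h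
    exact (neg_injective h).symm
  simp only [sinDiv, hd hg, hd sinTwoPi_neg, hg, sinTwoPi_neg, neg_eq_zero, neg_div_neg_eq]

theorem sinDiv_add_one {g : ℝ → ℂ} (hg : ∀ x, g (x + 1) = g x) (x : ℝ) :
    sinDiv g (x + 1) = sinDiv g x := by
  have hd : ∀ {g : ℝ → ℂ}, (∀ x, g (x + 1) = g x) → deriv g (x + 1) = deriv g x := by
    intro g hg
    rw [← deriv_comp_add_const]
    congr 1
    exact funext hg
  simp only [sinDiv, hd hg, hd sinTwoPi_add_one, hg, sinTwoPi_add_one]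

theorem SmoothSmall.deriv {g : ι → ℝ → ℂ} (hg : SmoothSmall l univ g) :
    SmoothSmall l univ (fun i => deriv (g i)) :=
  ((hg.fderiv isOpen_univ).clm_apply isOpen_univ (ContinuousLinearMap.apply ℝ ℂ (1 : ℝ)))

theorem SmoothSmall.foldFn {q : ι → ℝ → ℂ} (hq : SmoothSmall l univ q)
    (hp : ∀ i x, q i (x + 1) = q i x) : SmoothSmall l univ (fun i => foldFn (q i)) :=
  hq.oddPart.add isOpen_univ
    (hq.evenPart.deriv.sinDiv fun i _ hx => deriv_evenPart_eq_zero (hp i) hx)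

theorem SmoothSmall.unfoldFn {q : ι → ℝ → ℂ} (hq : SmoothSmall l univ q) :
    SmoothSmall l univ (fun i => unfoldFn (q i)) :=
  hq.oddPart.add isOpen_univ hq.evenPart.sinPrimitive

theorem contDiff_of_smoothSmall {g : ℝ → ℂ}
    (h : SmoothSmall (⊥ : Filter Unit) univ fun _ => g) : ContDiff ℝ ∞ g :=
  contDiffOn_univ.1 (h.contDiffOn ())

/-- `foldFn` as a linear map. -/
def periodicFold : periodicFn →ₗ[ℂ] periodicFn where
  toFun q := ⟨foldFn q.1,
    contDiff_of_smoothSmall (SmoothSmall.foldFn (smoothSmall_bot fun _ => q.2.1.contDiffOn)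
      fun _ => q.2.2),
    fun x => by
      rw [foldFn, oddPart_add_one q.2.2, sinDiv_add_one (deriv_evenPart_add_one q.2.2), foldFn]⟩
  map_add' p q := by
    refine Subtype.ext (funext fun x => ?_)
    have hp := fun y => ((contDiff_evenPart p.2.1).differentiable (by simp)) y
    have hq := fun y => ((contDiff_evenPart q.2.1).differentiable (by simp)) y
    have hp' : Differentiable ℝ (deriv (evenPart p.1)) :=
      (contDiff_infty_iff_deriv.1 (contDiff_evenPart p.2.1)).2.differentiable (by simp)
    have hq' : Differentiable ℝ (deriv (evenPart q.1)) :=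
      (contDiff_infty_iff_deriv.1 (contDiff_evenPart q.2.1)).2.differentiable (by simp)
    have hd : deriv (evenPart p.1 + evenPart q.1) = deriv (evenPart p.1) + deriv (evenPart q.1) :=
      funext fun y => deriv_add (hp y) (hq y)
    change foldFn (p.1 + q.1) x = foldFn p.1 x + foldFn q.1 x
    simp only [foldFn, map_add, hd, sinDiv, Pi.add_apply, deriv_add (hp' x) (hq' x)]
    split_ifs <;> ring
  map_smul' c q := by
    refine Subtype.ext (funext fun x => ?_)
    have hd : ∀ g : ℝ → ℂ, deriv (c • g) = c • deriv g := fun g =>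
      funext fun y => deriv_const_smul_field c g
    change foldFn (c • q.1) x = c * foldFn q.1 x
    simp only [foldFn, map_smul, hd, sinDiv, Pi.smul_apply, smul_eq_mul]
    split_ifs <;> ring

/-- `unfoldFn` as a linear map. -/
def periodicUnfold : periodicFn →ₗ[ℂ] periodicFn where
  toFun q := ⟨unfoldFn q.1,
    contDiff_of_smoothSmall (SmoothSmall.unfoldFn (smoothSmall_bot fun _ => q.2.1.contDiffOn)),
    fun x => by
      rw [unfoldFn, oddPart_add_one q.2.2, sinPrimitive_add_one
        (contDiff_evenPart q.2.1).continuous (evenPart_neg q.1) (evenPart_add_one q.2.2), unfoldFn]⟩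
  map_add' p q := by
    refine Subtype.ext (funext fun x => ?_)
    have hi : ∀ q : periodicFn, IntervalIntegrable (fun s => evenPart q.1 s * sinTwoPi s)
        MeasureTheory.volume 0 x := fun q =>
      ((contDiff_evenPart q.2.1).continuous.mul contDiff_sinTwoPi.continuous).intervalIntegrable _ _
    change unfoldFn (p.1 + q.1) x = unfoldFn p.1 x + unfoldFn q.1 x
    simp only [unfoldFn, map_add, sinPrimitive, Pi.add_apply, add_mul]
    rw [intervalIntegral.integral_add (hi p) (hi q)]
    ring
  map_smul' c q := by
    refine Subtype.ext (funext fun x => ?_)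
    change unfoldFn (c • q.1) x = c * unfoldFn q.1 x
    simp only [unfoldFn, map_smul, sinPrimitive, Pi.smul_apply, smul_eq_mul, mul_assoc]
    rw [intervalIntegral.integral_const_mul]
    ring

/-- Both operators respect parity. On even functions one integrates against the sine, and the other
differentiates and divides by the sine. -/
theorem periodicFold_periodicUnfold (q : periodicFn) : periodicFold (periodicUnfold q) = q := by
  refine Subtype.ext (funext fun x => ?_)
  have hc := contDiff_evenPart q.2.1
  have hE : evenPart (unfoldFn q.1) = sinPrimitive (evenPart q.1) := by
    ext y
    rw [evenPart_apply, unfoldFn, unfoldFn, oddPart_neg, sinPrimitive_neg (evenPart_neg q.1)]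
    ring
  have hO : oddPart (unfoldFn q.1) x = oddPart q.1 x := by
    rw [oddPart_apply, unfoldFn, unfoldFn, oddPart_neg, sinPrimitive_neg (evenPart_neg q.1)]
    ring
  have hd : deriv (sinPrimitive (evenPart q.1)) = fun y => evenPart q.1 y * sinTwoPi y :=
    funext fun y => (hasDerivAt_sinPrimitive hc.continuous y).deriv
  change foldFn (unfoldFn q.1) x = q.1 x
  rw [foldFn, hE, hO, hd, sinDiv_mul_sin (hc.differentiable (by simp) x), oddPart_apply,
    evenPart_apply]
  ring

/-- In this order the even part is recovered by integrating its own derivative from the origin,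
which loses exactly its value there. -/
theorem periodicUnfold_periodicFold (q : periodicFn) (x : ℝ) :
    (periodicUnfold (periodicFold q)).1 x = q.1 x - q.1 0 := by
  have hc := contDiff_evenPart q.2.1
  have hn := sinDiv_neg (deriv_evenPart_neg q.1)
  have hE : evenPart (foldFn q.1) = sinDiv (deriv (evenPart q.1)) := by
    ext y
    rw [evenPart_apply, foldFn, foldFn, oddPart_neg, hn]
    ring
  have hO : oddPart (foldFn q.1) x = oddPart q.1 x := by
    rw [oddPart_apply, foldFn, foldFn, oddPart_neg, hn]
    ring
  have hint : sinPrimitive (sinDiv (deriv (evenPart q.1))) x = evenPart q.1 x - evenPart q.1 0 := by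
    rw [sinPrimitive, intervalIntegral.integral_congr fun s _ =>
      sinDiv_mul fun hs => deriv_evenPart_eq_zero q.2.2 hs]
    exact intervalIntegral.integral_deriv_eq_sub (fun y _ => hc.differentiable (by simp) y)
      ((hc.continuous_deriv (by simp)).intervalIntegrable _ _)
  change unfoldFn (foldFn q.1) x = _
  rw [unfoldFn, hE, hO, hint, oddPart_apply, evenPart_apply, evenPart_apply, neg_zero]
  ring

theorem periodicUnfold_zero (q : periodicFn) : (periodicUnfold q).1 0 = 0 := by
  change unfoldFn q.1 0 = 0
  simp [unfoldFn, oddPart_apply, sinPrimitive]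

end Fold

/-! ### The same surjection on functions on S^m × S^1 -/

section FoldHopf

variable {ι : Type*} {m : ℕ} {lam : ℝ}

/-- A base vector of `ℝ^(m+1)`. -/
abbrev baseVec (m : ℕ) : Cover m := EuclideanSpace.single 0 1

/-- The base point of `S^m × S^1`. -/
def basePoint (m : ℕ) (lam : ℝ) : Hopf m := hopfMap lam (baseVec m)

/-- The ray through the base vector, with logarithmic parameter. -/
def baseRay (m : ℕ) (lam : ℝ) (x : ℝ) : Cover m := Real.exp (x * Real.log lam) • baseVec m

theorem norm_baseRay (x : ℝ) : ‖baseRay m lam x‖ = Real.exp (x * Real.log lam) := by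
  rw [baseRay, norm_smul, Real.norm_of_nonneg (Real.exp_pos _).le]
  simp

theorem baseRay_ne_zero (x : ℝ) : baseRay m lam x ≠ 0 := by
  rw [← norm_ne_zero_iff, norm_baseRay]
  exact (Real.exp_pos _).ne'

theorem baseRay_zero : baseRay m lam 0 = baseVec m := by
  simp [baseRay]

theorem baseRay_add_one (h0 : 0 < lam) (x : ℝ) : baseRay m lam (x + 1) = lam • baseRay m lam x := by
  rw [baseRay, baseRay, smul_smul, add_mul, one_mul, Real.exp_add, Real.exp_log h0, mul_comm]

theorem contDiff_baseRay : ContDiff ℝ ∞ (baseRay m lam) :=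
  (Real.contDiff_exp.comp (contDiff_id.mul contDiff_const)).smul contDiff_const

/-- Restriction of a function to the circle through the base point. -/
def restrictCircle (h0 : 0 < lam) (h1 : lam < 1) :
    SmoothFn (hopfModel m) (Hopf m) →ₗ[ℂ] periodicFn where
  toFun f := ⟨fun x => f (hopfMap lam (baseRay m lam x)),
    contDiffOn_univ.1 ((contDiffOn_lift f lam).comp contDiff_baseRay.contDiffOn
      fun x _ => baseRay_ne_zero x),
    fun x => by
      beta_reduce
      rw [baseRay_add_one h0, hopfMap_smul h0 h1 (baseRay_ne_zero x)]⟩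
  map_add' _ _ := rfl
  map_smul' _ _ := rfl

/-- The logarithmic radius, whose class modulo one is the circle coordinate. -/
def logRadius (lam : ℝ) (z : Cover m) : ℝ := Real.log ‖z‖ / Real.log lam

theorem contDiffOn_logRadius : ContDiffOn ℝ ∞ (logRadius lam : Cover m → ℝ) {0}ᶜ :=
  (ContDiffOn.log (contDiffOn_id.norm ℝ fun _ hp => hp)
    fun p (hp : p ≠ 0) => (norm_pos_iff.2 hp).ne').div_const _

theorem logRadius_smul (h0 : 0 < lam) (h1 : lam < 1) {z : Cover m} (hz : z ≠ 0) :
    logRadius lam (lam • z) = logRadius lam z + 1 := by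
  have hlog : Real.log lam ≠ 0 := (Real.log_neg h0 h1).ne
  rw [logRadius, norm_smul, Real.norm_of_nonneg h0.le,
    Real.log_mul h0.ne' (norm_ne_zero_iff.2 hz), add_div, div_self hlog, add_comm, logRadius]

theorem logRadius_baseRay (h0 : 0 < lam) (h1 : lam < 1) (x : ℝ) :
    logRadius lam (baseRay m lam x) = x := by
  rw [logRadius, norm_baseRay, Real.log_exp, mul_div_cancel_right₀ _ (Real.log_neg h0 h1).ne]

/-- Functions of the circle coordinate as functions on `S^m × S^1`. -/
def extendCircle (m : ℕ) (h0 : 0 < lam) (h1 : lam < 1) :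
    periodicFn →ₗ[ℂ] SmoothFn (hopfModel m) (Hopf m) :=
  descend h0 h1 ∘ₗ
    { toFun := fun q => ⟨fun z => q.1 (logRadius lam z), q.2.1.comp_contDiffOn contDiffOn_logRadius,
        fun p hp => by
          beta_reduce
          rw [logRadius_smul h0 h1 hp, q.2.2]⟩
      map_add' := fun _ _ => rfl
      map_smul' := fun _ _ => rfl }

theorem extendCircle_hopfMap (h0 : 0 < lam) (h1 : lam < 1) (q : periodicFn) {z : Cover m}
    (hz : z ≠ 0) : extendCircle m h0 h1 q (hopfMap lam z) = q.1 (logRadius lam z) :=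
  descend_hopfMap h0 h1 _ hz

theorem restrictCircle_extendCircle (h0 : 0 < lam) (h1 : lam < 1) (q : periodicFn) :
    restrictCircle h0 h1 (extendCircle m h0 h1 q) = q := by
  refine Subtype.ext (funext fun x => ?_)
  refine (extendCircle_hopfMap h0 h1 q (baseRay_ne_zero x)).trans ?_
  rw [logRadius_baseRay h0 h1]

/-- An operator on the periodic functions acting on the functions on `S^m × S^1`, by the identity
on the functions that vanish on the circle through the base point. -/
def onCircle (m : ℕ) (h0 : 0 < lam) (h1 : lam < 1) (P : periodicFn →ₗ[ℂ] periodicFn) :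
    SmoothFn (hopfModel m) (Hopf m) →ₗ[ℂ] SmoothFn (hopfModel m) (Hopf m) :=
  LinearMap.id + extendCircle m h0 h1 ∘ₗ (P - LinearMap.id) ∘ₗ restrictCircle h0 h1

theorem onCircle_apply (h0 : 0 < lam) (h1 : lam < 1) (P : periodicFn →ₗ[ℂ] periodicFn)
    (f : SmoothFn (hopfModel m) (Hopf m)) : onCircle m h0 h1 P f =
      f + extendCircle m h0 h1 (P (restrictCircle h0 h1 f) - restrictCircle h0 h1 f) := rfl

theorem restrictCircle_onCircle (h0 : 0 < lam) (h1 : lam < 1) (P : periodicFn →ₗ[ℂ] periodicFn)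
    (f : SmoothFn (hopfModel m) (Hopf m)) :
    restrictCircle h0 h1 (onCircle m h0 h1 P f) = P (restrictCircle h0 h1 f) := by
  rw [onCircle_apply, map_add, restrictCircle_extendCircle, add_sub_cancel]

/-- Since `extendCircle` is a section of `restrictCircle`, the functions split as the kernel of the
restriction plus a copy of the periodic functions. `onCircle` acts by `P` on the second summand and
trivially on the first, hence is multiplicative in `P`. -/
theorem onCircle_comp (h0 : 0 < lam) (h1 : lam < 1) (P Q : periodicFn →ₗ[ℂ] periodicFn)
    (f : SmoothFn (hopfModel m) (Hopf m)) :
    onCircle m h0 h1 P (onCircle m h0 h1 Q f) = onCircle m h0 h1 (P ∘ₗ Q) f := by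
  rw [onCircle_apply (P := P), restrictCircle_onCircle, onCircle_apply, onCircle_apply, add_assoc,
    ← map_add]
  congr 2
  rw [LinearMap.comp_apply]
  abel

theorem continuous_onCircle (h0 : 0 < lam) (h1 : lam < 1) {P : periodicFn →ₗ[ℂ] periodicFn}
    (hP : ∀ {ι : Type} {l : Filter ι} {q : ι → periodicFn},
      SmoothSmall l univ (fun i => (q i).1) → SmoothSmall l univ (fun i => (P (q i)).1)) :
    Continuous (onCircle m h0 h1 P) := by
  refine continuous_of_smoothSmall_lift h0 h1 _ fun f => ?_
  have hU : IsOpen ({0}ᶜ : Set (Cover m)) := isOpen_compl_singleton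
  have hl := smoothSmall_lift h0 h1 f
  have hr : SmoothSmall (𝓝 f) univ fun g => (restrictCircle h0 h1 (g - f)).1 :=
    hl.comp hU isOpen_univ contDiff_baseRay.contDiffOn fun x _ => baseRay_ne_zero x
  have hd := ((hP hr).sub isOpen_univ hr).comp isOpen_univ hU (contDiffOn_logRadius (lam := lam)) (mapsTo_univ _ _)
  refine (hl.add hU hd).congr hU fun g z hz => ?_
  rw [onCircle_apply, ContMDiffMap.coe_add, Pi.add_apply, extendCircle_hopfMap h0 h1 _ hz]
  rfl

/-- The surjection of `C^∞(S^m × S^1)` onto itself with kernel the constants. -/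
abbrev foldHopf (m : ℕ) (h0 : 0 < lam) (h1 : lam < 1) := onCircle m h0 h1 periodicFold

/-- The right inverse of `foldHopf` with values in the functions vanishing at the base point. -/
abbrev unfoldHopf (m : ℕ) (h0 : 0 < lam) (h1 : lam < 1) := onCircle m h0 h1 periodicUnfold

theorem continuous_foldHopf (h0 : 0 < lam) (h1 : lam < 1) : Continuous (foldHopf m h0 h1) :=
  continuous_onCircle h0 h1 fun {_ _ q} hq => hq.foldFn fun i => (q i).2.2

theorem continuous_unfoldHopf (h0 : 0 < lam) (h1 : lam < 1) : Continuous (unfoldHopf m h0 h1) :=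
  continuous_onCircle h0 h1 fun hq => hq.unfoldFn

theorem foldHopf_unfoldHopf (h0 : 0 < lam) (h1 : lam < 1)
    (f : SmoothFn (hopfModel m) (Hopf m)) : foldHopf m h0 h1 (unfoldHopf m h0 h1 f) = f := by
  rw [onCircle_comp, onCircle_apply, LinearMap.comp_apply, periodicFold_periodicUnfold, sub_self,
    map_zero, add_zero]

theorem smul_one_apply (c : ℂ) (x : Hopf m) :
    (c • (1 : SmoothFn (hopfModel m) (Hopf m))) x = c := by
  rw [smoothFn_smul_apply]
  simp

theorem restrictCircle_zero_apply (h0 : 0 < lam) (h1 : lam < 1)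
    (f : SmoothFn (hopfModel m) (Hopf m)) : (restrictCircle h0 h1 f).1 0 = f (basePoint m lam) := by
  change f (hopfMap lam (baseRay m lam 0)) = _
  rw [baseRay_zero, basePoint]

theorem unfoldHopf_foldHopf (h0 : 0 < lam) (h1 : lam < 1)
    (f : SmoothFn (hopfModel m) (Hopf m)) :
    unfoldHopf m h0 h1 (foldHopf m h0 h1 f) + f (basePoint m lam) • 1 = f := by
  refine ext_hopf h0 h1 fun z hz => ?_
  rw [onCircle_comp, onCircle_apply, LinearMap.comp_apply, ContMDiffMap.coe_add, Pi.add_apply,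
    smul_one_apply, ContMDiffMap.coe_add, Pi.add_apply, extendCircle_hopfMap h0 h1 _ hz]
  change _ + ((periodicUnfold (periodicFold (restrictCircle h0 h1 f))).1 (logRadius lam z)
    - (restrictCircle h0 h1 f).1 (logRadius lam z)) + _ = _
  rw [periodicUnfold_periodicFold, restrictCircle_zero_apply]
  ring

theorem unfoldHopf_basePoint (h0 : 0 < lam) (h1 : lam < 1)
    (f : SmoothFn (hopfModel m) (Hopf m)) : unfoldHopf m h0 h1 f (basePoint m lam) = 0 := by
  rw [← restrictCircle_zero_apply h0 h1, restrictCircle_onCircle, periodicUnfold_zero]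

end FoldHopf

/-! ### The invariant frame of the foliation -/

section TangentBundle

variable {E : Type*} [NormedAddCommGroup E] [NormedSpace ℝ E]
  {H : Type*} [TopologicalSpace H] {I : ModelWithCorners ℝ E H}
  {M : Type*} [TopologicalSpace M] [ChartedSpace H M]

theorem tangentBundle_mk_eq {q : TangentBundle I M} {x : M} (h : q.1 = x) :
    (⟨x, (q.2 : E)⟩ : TangentBundle I M) = q := by
  subst h; rfl

end TangentBundle

section ReebField

variable {m : ℕ} {lam : ℝ}

/-- This is the derivative of the identity that `hopfMap` composed with the homothety is `hopfMap`.
-/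
theorem tangentMap_hopfMap_zpow {d : ℕ} (h0 : 0 < lam) (h1 : lam < 1) {p : Cover d} (hp : p ≠ 0) (k : ℤ)
    (v : Cover d) :
    tangentMap 𝓘(ℝ, Cover d) (hopfModel d) (hopfMap lam) ⟨lam ^ k • p, lam ^ k • v⟩ =
      tangentMap 𝓘(ℝ, Cover d) (hopfModel d) (hopfMap lam) ⟨p, v⟩ := by
  have hk : lam ^ k ≠ 0 := zpow_ne_zero k h0.ne'
  let σ : Cover d → Cover d := fun q => lam ^ k • q
  have hσ : HasFDerivAt σ (lam ^ k • ContinuousLinearMap.id ℝ (Cover d)) p :=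
    (hasFDerivAt_id p).const_smul (lam ^ k)
  have hd : ∀ q : Cover d, q ≠ 0 → MDifferentiableAt 𝓘(ℝ, Cover d) (hopfModel d) (hopfMap lam) q :=
    fun q hq => (((contMDiffOn_hopfMap lam).contMDiffAt
      (isOpen_compl_singleton.mem_nhds hq)).mdifferentiableAt (by simp))
  have hev : (hopfMap lam ∘ σ : Cover d → Hopf d) =ᶠ[𝓝 p] hopfMap lam := by
    filter_upwards [isOpen_compl_singleton.mem_nhds hp] with q hq
    exact ((hopfMap_eq_iff h0 h1 hq (smul_ne_zero hk hq)).2 ⟨k, rfl⟩).symm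
  have h2 := tangentMap_comp_at (I := 𝓘(ℝ, Cover d)) (I' := 𝓘(ℝ, Cover d)) (I'' := hopfModel d)
    (f := σ) (g := hopfMap lam) ⟨p, v⟩ (hd _ (smul_ne_zero hk hp))
    hσ.differentiableAt.mdifferentiableAt
  have h3 : tangentMap 𝓘(ℝ, Cover d) 𝓘(ℝ, Cover d) σ ⟨p, v⟩ = ⟨lam ^ k • p, lam ^ k • v⟩ := by
    simp only [tangentMap, mfderiv_eq_fderiv, hσ.fderiv]
    rfl
  rw [h3] at h2
  rw [← h2]
  simp only [tangentMap, hev.mfderiv_eq]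
  have h4 : (hopfMap lam ∘ σ) p = hopfMap lam p := hev.eq_of_nhds
  exact (tangentBundle_mk_eq (q := ⟨(hopfMap lam ∘ σ) p, _⟩) h4).symm

/-- The image of `‖p‖ ∂/∂t` in the tangent bundle of `S^n × S^1`. -/
def reebVec (m : ℕ) (lam : ℝ) (p : Cover (m + 1)) : TangentBundle (hopfModel (m + 1)) (Hopf (m + 1)) :=
  tangentMap 𝓘(ℝ, Cover (m + 1)) (hopfModel (m + 1)) (hopfMap lam) ⟨p, ‖p‖ • lastVec m⟩

theorem reebVec_eq (h0 : 0 < lam) (h1 : lam < 1) {p q : Cover (m + 1)} (hp : p ≠ 0) (hq : q ≠ 0)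
    (h : hopfMap lam p = hopfMap lam q) : reebVec m lam p = reebVec m lam q := by
  obtain ⟨k, rfl⟩ := (hopfMap_eq_iff h0 h1 hp hq).1 h
  have := tangentMap_hopfMap_zpow h0 h1 hp k (‖p‖ • lastVec m)
  rw [smul_smul] at this
  rw [reebVec, reebVec, norm_smul, Real.norm_of_nonneg (zpow_pos h0 k).le, ← this]

/-- The vector field of `S^n × S^1` induced by the homothety invariant field `‖p‖ ∂/∂t`. -/
def reebField (m : ℕ) (h0 : 0 < lam) (h1 : lam < 1) : SmoothVF (hopfModel (m + 1)) (Hopf (m + 1)) where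
  toFun x := show EuclideanSpace ℝ (Fin (m + 1)) × EuclideanSpace ℝ (Fin 1) from (reebVec m lam (hopfMap_surjective h0 h1 x).choose).2
  contMDiff_toFun := by
    intro x
    obtain ⟨W, s, hW, hxW, hs, hs0, hsx⟩ := exists_local_section h0 h1 x
    have hsec : ContMDiffOn 𝓘(ℝ, Cover (m + 1)) 𝓘(ℝ, Cover (m + 1)).tangent ∞
        (fun q : Cover (m + 1) => (⟨q, ‖q‖ • lastVec m⟩ : TangentBundle 𝓘(ℝ, Cover (m + 1)) (Cover (m + 1))))
        {0}ᶜ :=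
      contMDiffOn_vectorSpace_iff_contDiffOn.2
        ((contDiffOn_id.norm ℝ fun p hp => hp).smul contDiffOn_const)
    have htan : ContMDiffOn 𝓘(ℝ, Cover (m + 1)).tangent (hopfModel (m + 1)).tangent ∞
        (tangentMap 𝓘(ℝ, Cover (m + 1)) (hopfModel (m + 1))
          (hopfMap lam : Cover (m + 1) → Hopf (m + 1)))
        (Bundle.TotalSpace.proj ⁻¹' {0}ᶜ) := by
      refine ((contMDiffOn_hopfMap lam).contMDiffOn_tangentMapWithin (m := ∞) (by simp)
        isOpen_compl_singleton.uniqueMDiffOn).congr fun q hq => ?_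
      exact (tangentMapWithin_eq_tangentMap (isOpen_compl_singleton.uniqueMDiffOn _ hq)
        (((contMDiffOn_hopfMap lam).contMDiffAt
          (isOpen_compl_singleton.mem_nhds hq)).mdifferentiableAt (by simp))).symm
    have h2 := ((htan.comp hsec fun q hq => hq).comp hs fun y _ => hs0 y).contMDiffAt
      (hW.mem_nhds hxW)
    refine h2.congr_of_eventuallyEq (Eventually.of_forall fun y => ?_)
    have hy := (hopfMap_surjective h0 h1 y).choose_spec
    refine (tangentBundle_mk_eq (q := reebVec m lam _) hy.2).trans ?_
    exact reebVec_eq h0 h1 hy.1 (hs0 y) (hy.2.trans (hsx y).symm)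

theorem mk_reebField (h0 : 0 < lam) (h1 : lam < 1) {p : Cover (m + 1)} (hp : p ≠ 0) :
    (⟨hopfMap lam p, reebField m h0 h1 (hopfMap lam p)⟩ :
      TangentBundle (hopfModel (m + 1)) (Hopf (m + 1))) = reebVec m lam p := by
  have hy := (hopfMap_surjective h0 h1 (hopfMap lam p)).choose_spec
  exact (tangentBundle_mk_eq (q := reebVec m lam _) hy.2).trans (reebVec_eq h0 h1 hy.1 hp hy.2)

theorem reebVec_snd (p : Cover (m + 1)) : reebVec m lam p = ⟨hopfMap lam p, ‖p‖ •
    (mfderiv 𝓘(ℝ, Cover (m + 1)) (hopfModel (m + 1)) (hopfMap lam) p (lastVec m))⟩ := by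
  have := (mfderiv 𝓘(ℝ, Cover (m + 1)) (hopfModel (m + 1)) (hopfMap lam) p).map_smul ‖p‖ (lastVec m)
  rw [← this]; rfl

theorem reebField_hopfMap (h0 : 0 < lam) (h1 : lam < 1) {p : Cover (m + 1)} (hp : p ≠ 0) :
    reebField m h0 h1 (hopfMap lam p) = ‖p‖ •
      (mfderiv 𝓘(ℝ, Cover (m + 1)) (hopfModel (m + 1)) (hopfMap lam) p (lastVec m)) := by
  have := mk_reebField h0 h1 hp
  rw [reebVec_snd] at this
  exact eq_of_heq (Bundle.TotalSpace.mk.inj this).2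

theorem reebField_mem (h0 : 0 < lam) (h1 : lam < 1) (x : Hopf (m + 1)) :
    reebField m h0 h1 x ∈ reebLine (m + 1) lam x := by
  obtain ⟨p, hp, rfl⟩ := hopfMap_surjective h0 h1 x
  rw [reebField_hopfMap h0 h1 hp]
  exact Submodule.smul_mem _ _ (Submodule.subset_span ⟨p, hp, rfl⟩)

/-- The span defining `reebLine` runs over all preimages of `x`. By invariance of ‖p‖ ∂/∂t every
generator is a multiple of the same vector, so the span is at most a line. -/
theorem exists_smul_reebField (h0 : 0 < lam) (h1 : lam < 1) {x : Hopf (m + 1)}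
    {v : TangentSpace (hopfModel (m + 1)) x} (hv : v ∈ reebLine (m + 1) lam x) :
    ∃ c : ℝ, v = c • reebField m h0 h1 x := by
  have : reebLine (m + 1) lam x ≤ Submodule.span ℝ {reebField m h0 h1 x} := by
    refine Submodule.span_le.2 ?_
    rintro w ⟨p, hp, hw⟩
    have hx : hopfMap lam p = x := congrArg Bundle.TotalSpace.proj hw
    subst hx
    have hw' : (mfderiv 𝓘(ℝ, Cover (m + 1)) (hopfModel (m + 1)) (hopfMap lam) p (lastVec m)) = w :=
      eq_of_heq (Bundle.TotalSpace.mk.inj hw).2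
    refine Submodule.mem_span_singleton.2 ⟨‖p‖⁻¹, ?_⟩
    rw [reebField_hopfMap h0 h1 hp, smul_smul, inv_mul_cancel₀ (norm_ne_zero_iff.2 hp), one_smul, hw']
  obtain ⟨c, hc⟩ := Submodule.mem_span_singleton.1 (this hv)
  exact ⟨c, hc.symm⟩

theorem mvfderiv_hopfMap (f : SmoothFn (hopfModel (m + 1)) (Hopf (m + 1))) {p : Cover (m + 1)}
    (hp : p ≠ 0) (v : Cover (m + 1)) : mvfderiv (hopfModel (m + 1)) f (hopfMap lam p)
      (mfderiv 𝓘(ℝ, Cover (m + 1)) (hopfModel (m + 1)) (hopfMap lam) p v) =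
    fderiv ℝ (fun q => f (hopfMap lam q)) p v := by
  have hd : MDifferentiableAt 𝓘(ℝ, Cover (m + 1)) (hopfModel (m + 1)) (hopfMap lam) p :=
    (((contMDiffOn_hopfMap lam).contMDiffAt
      (isOpen_compl_singleton.mem_nhds hp)).mdifferentiableAt (by simp))
  have hf : MDifferentiableAt (hopfModel (m + 1)) 𝓘(ℝ, ℂ) f (hopfMap lam p) :=
    f.contMDiff.mdifferentiable (by simp) _
  refine (mfderiv_comp_apply p hf hd v).symm.trans ?_
  rw [mfderiv_eq_fderiv]
  rfl

theorem vfDeriv_reebField (h0 : 0 < lam) (h1 : lam < 1)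
    (f : SmoothFn (hopfModel (m + 1)) (Hopf (m + 1))) {p : Cover (m + 1)} (hp : p ≠ 0) :
    vfDeriv (reebField m h0 h1) f (hopfMap lam p) =
      (‖p‖ : ℂ) * fderiv ℝ (fun q => f (hopfMap lam q)) p (lastVec m) := by
  rw [← mvfderiv_hopfMap f hp]
  change mvfderiv (hopfModel (m + 1)) f (hopfMap lam p) (reebField m h0 h1 (hopfMap lam p)) = _
  rw [reebField_hopfMap h0 h1 hp, map_smul, Complex.real_smul]

theorem mem_range_vfDeriv_iff (h0 : 0 < lam) (h1 : lam < 1)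
    {g : SmoothFn (hopfModel (m + 1)) (Hopf (m + 1))} :
    g ∈ LinearMap.range (vfDeriv (reebField m h0 h1)) ↔ IsLeafExact lam g := by
  constructor
  · rintro ⟨f, rfl⟩
    exact ⟨f, fun p hp => vfDeriv_reebField h0 h1 f hp⟩
  · rintro ⟨f, hf⟩
    exact ⟨f, ext_hopf h0 h1 fun p hp => (vfDeriv_reebField h0 h1 f hp).trans (hf p hp).symm⟩

end ReebField

/-! ### Leafwise forms as functions, through evaluation on a tangent field -/

section LeafForms

variable {E : Type} [NormedAddCommGroup E] [NormedSpace ℝ E]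
  {H : Type*} [TopologicalSpace H] {I : ModelWithCorners ℝ E H}
  {M : Type*} [TopologicalSpace M] [ChartedSpace H M] [IsManifold I ∞ M]
  {τ : ∀ x : M, Submodule ℝ (TangentSpace I x)}

theorem contMDiff_mul_complex {f g : M → ℂ} (hf : ContMDiff I 𝓘(ℝ, ℂ) ∞ f)
    (hg : ContMDiff I 𝓘(ℝ, ℂ) ∞ g) : ContMDiff I 𝓘(ℝ, ℂ) ∞ fun x => f x * g x :=
  (contDiff_mul (𝕜 := ℝ) (𝔸 := ℂ)).contMDiff.comp (hf.prodMk_space hg)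

/-- Multiplication of leafwise forms by a smooth function. -/
def leafMul (θ : LeafForm τ) : SmoothFn I M →ₗ[ℂ] LeafForm τ where
  toFun f := ⟨fun x => f x • θ.1 x, fun Y => contMDiff_mul_complex f.contMDiff (θ.2 Y)⟩
  map_add' f g := Subtype.ext (funext fun x => add_smul (f x) (g x) (θ.1 x))
  map_smul' c f := Subtype.ext (funext fun x => mul_smul c (f x) (θ.1 x))

theorem evalVF_leafMul (Y : TangentVF τ) (θ : LeafForm τ) (f : SmoothFn I M) (x : M) :
    evalVF Y (leafMul θ f) x = f x * evalVF Y θ x := rfl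

/-- A leafwise form `θ` with `θ(X) = 1` trivializes the bundle of leafwise forms. -/
def evalVFEquiv (X : TangentVF τ) (hX : ∀ x, ∀ v ∈ τ x, ∃ c : ℝ, v = c • X.1 x)
    (θ : LeafForm τ) (hθ : evalVF X θ = 1) : LeafForm τ ≃ₗ[ℂ] SmoothFn I M where
  __ := evalVF X
  invFun := leafMul θ
  left_inv α := by
    refine Subtype.ext (funext fun x => LinearMap.ext fun v => ?_)
    obtain ⟨c, hc⟩ := hX x v.1 v.2
    have hv : v = c • ⟨X.1 x, X.2 x⟩ := Subtype.ext hc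
    change evalVF X α x • θ.1 x v = α.1 x v
    have h1 : θ.1 x ⟨X.1 x, X.2 x⟩ = 1 := congrArg (fun f => f x) hθ
    rw [hv, map_smul, map_smul, h1, smul_comm, smul_eq_mul, mul_one]
    rfl
  right_inv f := by
    change evalVF X (leafMul θ f) = f
    ext x
    rw [evalVF_leafMul, hθ]
    exact mul_one _

theorem continuous_evalVF [I.Boundaryless] (X : TangentVF τ) : Continuous (evalVF X) :=
  continuous_iInf_dom (i := X) continuous_induced_dom

end LeafForms

/-! ### A smooth leafwise form dual to a tangent field -/

section ReebForm

variable {m : ℕ} {lam : ℝ}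

theorem continuous_leafMul {d : ℕ} (h0 : 0 < lam) (h1 : lam < 1)
    {τ : ∀ x : Hopf d, Submodule ℝ (TangentSpace (hopfModel d) x)} (θ : LeafForm τ) :
    Continuous (leafMul θ) := by
  refine continuous_iInf_rng.2 fun Y => continuous_induced_rng.2 ?_
  refine continuous_of_smoothSmall_lift h0 h1 (evalVF Y ∘ₗ leafMul θ) fun v => ?_
  exact (smoothSmall_lift h0 h1 v).mul isOpen_compl_singleton (contDiffOn_lift (evalVF Y θ) lam)

/-- The normalized last coordinate on the sphere factor. -/
def heightFn (d : ℕ) : SmoothFn (hopfModel d) (Hopf d) :=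
  ⟨fun x => (((x.1 : Cover d) (Fin.last d) : ℝ) : ℂ), by
    have h : ContDiff ℝ ∞ fun p : Cover d => ((p (Fin.last d) : ℝ) : ℂ) :=
      Complex.ofRealCLM.contDiff.comp
        (EuclideanSpace.proj (Fin.last d) : Cover d →L[ℝ] ℝ).contDiff
    exact h.contMDiff.comp ((contMDiff_coe_euclideanSphere d).comp contMDiff_fst)⟩

/-- The coordinate on the circle factor. -/
def circleFn (d : ℕ) : SmoothFn (hopfModel d) (Hopf d) :=
  ⟨fun x => (x.2 : ℂ), contMDiff_coe_circle.comp contMDiff_snd⟩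

theorem hasDerivAt_log_norm {p : Cover (m + 1)} (hp : p ≠ 0) :
    HasDerivAt (fun s : ℝ => Real.log ‖p + s • lastVec m‖) (p (Fin.last (m + 1)) / ‖p‖ ^ 2) 0 := by
  have h1 : HasDerivAt (fun s : ℝ => p + s • lastVec m) (lastVec m) 0 := by
    simpa using ((hasDerivAt_id (0 : ℝ)).smul_const (lastVec m)).const_add p
  have h2 := (h1.norm_sq.log (by simpa using hp)).const_mul (1 / 2 : ℝ)
  refine HasDerivAt.congr_deriv (h2.congr_of_eventuallyEq (Eventually.of_forall fun s => ?_)) ?_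
  · simp only [Real.log_pow]; push_cast; ring
  · simp [lastVec, EuclideanSpace.inner_single_right]; ring

theorem hasDerivAt_lift (f : SmoothFn (hopfModel (m + 1)) (Hopf (m + 1))) {p : Cover (m + 1)}
    (hp : p ≠ 0) : HasDerivAt (fun s : ℝ => f (hopfMap lam (p + s • lastVec m)))
      (fderiv ℝ (fun q => f (hopfMap lam q)) p (lastVec m)) 0 :=
  (((contDiffOn_lift f lam).contDiffAt (isOpen_compl_singleton.mem_nhds hp)).differentiableAt
    (by simp)).hasFDerivAt.hasLineDerivAt (lastVec m)

/-- Off t = 0 the norm varies along the leaf, which the circle coordinate detects. At t = 0 the norm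
is stationary and t/‖p‖ has derivative 1/‖p‖. Two global functions thus suffice to see that the
frame never vanishes and to build dual forms. -/
theorem fderiv_heightFn_or_circleFn_ne_zero (h0 : 0 < lam) (h1 : lam < 1) {p : Cover (m + 1)}
    (hp : p ≠ 0) :
    fderiv ℝ (fun q => heightFn (m + 1) (hopfMap lam q)) p (lastVec m) ≠ 0 ∨
      fderiv ℝ (fun q => circleFn (m + 1) (hopfMap lam q)) p (lastVec m) ≠ 0 := by
  have hr := hasDerivAt_log_norm hp
  have hn : ‖p‖ ≠ 0 := norm_ne_zero_iff.2 hp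
  have hlog : Real.log lam ≠ 0 := (Real.log_neg h0 h1).ne
  by_cases ht : p (Fin.last (m + 1)) = 0
  · left
    -- With the last coordinate of `p` equal to zero, the height at p + s ∂/∂t is s / ‖p + s ∂/∂t‖;
    -- the inverse norm is written as an exponential so as to use `hr`.
    have h2 : HasDerivAt (fun s : ℝ => ((s * Real.exp (-Real.log ‖p + s • lastVec m‖) : ℝ) : ℂ))
        ((‖p‖⁻¹ : ℝ) : ℂ) 0 := by
      refine (((hasDerivAt_id (0 : ℝ)).mul hr.neg.exp).congr_deriv ?_).ofReal_comp
      simp [Real.exp_neg, Real.exp_log (norm_pos_iff.2 hp)]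
    have hc : ContinuousAt (fun s : ℝ => p + s • lastVec m) 0 := by fun_prop
    have hev : ∀ᶠ s : ℝ in 𝓝 0, p + s • lastVec m ≠ 0 := hc.eventually_ne (by simpa using hp)
    rw [(hasDerivAt_lift (heightFn (m + 1)) hp).unique (h2.congr_of_eventuallyEq ?_)]
    · exact_mod_cast inv_ne_zero hn
    · filter_upwards [hev] with s hs
      change ((((direction (p + s • lastVec m) : _) : Cover (m + 1)) (Fin.last (m + 1)) : ℝ) : ℂ) = _
      rw [direction_coe hs, Real.exp_neg, Real.exp_log (norm_pos_iff.2 hs)]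
      simp [ht, lastVec, mul_comm]
  · right
    have h2 := ((((hr.div_const (Real.log lam)).const_mul (2 * Real.pi)).ofReal_comp).mul_const
      Complex.I).cexp
    have h3 : HasDerivAt (fun s : ℝ => circleFn (m + 1) (hopfMap lam (p + s • lastVec m))) _ 0 :=
      h2.congr_of_eventuallyEq (Eventually.of_forall fun s => Circle.coe_exp _)
    rw [(hasDerivAt_lift (circleFn (m + 1)) hp).unique h3]
    refine mul_ne_zero (Complex.exp_ne_zero _) (mul_ne_zero ?_ Complex.I_ne_zero)
    have := Real.pi_ne_zero
    exact_mod_cast mul_ne_zero (mul_ne_zero two_ne_zero this)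
      (div_ne_zero (div_ne_zero ht (pow_ne_zero 2 hn)) hlog)

theorem vfDeriv_heightFn_or_circleFn_ne_zero (h0 : 0 < lam) (h1 : lam < 1) (x : Hopf (m + 1)) :
    vfDeriv (reebField m h0 h1) (heightFn (m + 1)) x ≠ 0 ∨
      vfDeriv (reebField m h0 h1) (circleFn (m + 1)) x ≠ 0 := by
  obtain ⟨p, hp, rfl⟩ := hopfMap_surjective h0 h1 x
  have hn : (‖p‖ : ℂ) ≠ 0 := by exact_mod_cast norm_ne_zero_iff.2 hp
  rw [vfDeriv_reebField h0 h1 _ hp, vfDeriv_reebField h0 h1 _ hp, mul_ne_zero_iff, mul_ne_zero_iff]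
  exact (fderiv_heightFn_or_circleFn_ne_zero h0 h1 hp).imp (⟨hn, ·⟩) (⟨hn, ·⟩)

/-- A nowhere vanishing vector field tangent to the affine Reeb flow. -/
structure IsReebTangent (lam : ℝ) (X : SmoothVF (hopfModel (m + 1)) (Hopf (m + 1))) : Prop where
  ne_zero : ∀ x, X x ≠ 0
  mem : ∀ x, X x ∈ reebLine (m + 1) lam x

namespace IsReebTangent

variable {X : SmoothVF (hopfModel (m + 1)) (Hopf (m + 1))}

theorem exists_smul (hX : IsReebTangent lam X) (h0 : 0 < lam) (h1 : lam < 1) (x : Hopf (m + 1)) :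
    ∃ c : ℝ, c ≠ 0 ∧ X x = c • reebField m h0 h1 x := by
  obtain ⟨c, hc⟩ := exists_smul_reebField h0 h1 (hX.mem x)
  refine ⟨c, ?_, hc⟩
  rintro rfl
  exact hX.ne_zero x (hc.trans (zero_smul _ _))

theorem exists_smul_of_mem (hX : IsReebTangent lam X) (h0 : 0 < lam) (h1 : lam < 1)
    (x : Hopf (m + 1)) (v : TangentSpace (hopfModel (m + 1)) x) (hv : v ∈ reebLine (m + 1) lam x) :
    ∃ c : ℝ, v = c • X x := by
  obtain ⟨c, hc, hcX⟩ := hX.exists_smul h0 h1 x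
  obtain ⟨b, rfl⟩ := exists_smul_reebField h0 h1 hv
  refine ⟨b * c⁻¹, ?_⟩
  rw [hcX, smul_smul, mul_assoc, inv_mul_cancel₀ hc, mul_one]

theorem normSq_ne_zero (hX : IsReebTangent lam X) (h0 : 0 < lam) (h1 : lam < 1) (x : Hopf (m + 1)) :
    vfDeriv X (heightFn (m + 1)) x * (starRingEnd ℂ) (vfDeriv X (heightFn (m + 1)) x) +
      vfDeriv X (circleFn (m + 1)) x * (starRingEnd ℂ) (vfDeriv X (circleFn (m + 1)) x) ≠ 0 := by
  obtain ⟨c, hc, hcX⟩ := hX.exists_smul h0 h1 x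
  have h : ∀ f : SmoothFn (hopfModel (m + 1)) (Hopf (m + 1)),
      vfDeriv X f x = c • vfDeriv (reebField m h0 h1) f x := fun f => by
    change mvfderiv _ f x (X x) = c • mvfderiv _ f x (reebField m h0 h1 x)
    rw [hcX, map_smul]
  rw [Complex.mul_conj, Complex.mul_conj, ← Complex.ofReal_add]
  refine Complex.ofReal_ne_zero.2 fun hz => ?_
  obtain ⟨ha, hb⟩ := (add_eq_zero_iff_of_nonneg (Complex.normSq_nonneg _)
    (Complex.normSq_nonneg _)).1 hz
  rw [Complex.normSq_eq_zero, h, smul_eq_zero_iff_right hc] at ha hb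
  exact (vfDeriv_heightFn_or_circleFn_ne_zero h0 h1 x).elim (· ha) (· hb)

theorem exists_dual (hX : IsReebTangent lam X) (h0 : 0 < lam) (h1 : lam < 1) :
    ∃ θ : LeafForm (reebLine (m + 1) lam), evalVF ⟨X, hX.mem⟩ θ = 1 := by
  have hconj : ∀ f : SmoothFn (hopfModel (m + 1)) (Hopf (m + 1)),
      ContMDiff (hopfModel (m + 1)) 𝓘(ℝ, ℂ) ∞ fun x => (starRingEnd ℂ) (f x) := fun f =>
    Complex.conjCLE.contDiff.contMDiff.comp f.contMDiff
  let u := vfDeriv X (heightFn (m + 1))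
  let v := vfDeriv X (circleFn (m + 1))
  have hΔ : ContMDiff (hopfModel (m + 1)) 𝓘(ℝ, ℂ) ∞ fun x =>
      (u x * (starRingEnd ℂ) (u x) + v x * (starRingEnd ℂ) (v x))⁻¹ :=
    fun x => ContMDiffAt.comp x (contDiffAt_inv ℝ (hX.normSq_ne_zero h0 h1 x)).contMDiffAt
      ((contMDiff_mul_complex u.contMDiff (hconj u)).add
        (contMDiff_mul_complex v.contMDiff (hconj v)) x)
  let a : SmoothFn (hopfModel (m + 1)) (Hopf (m + 1)) := ⟨_, contMDiff_mul_complex (hconj u) hΔ⟩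
  let b : SmoothFn (hopfModel (m + 1)) (Hopf (m + 1)) := ⟨_, contMDiff_mul_complex (hconj v) hΔ⟩
  -- With u and v the X-derivatives of height and circle coordinate, the form is (ū d(height) + v̄
  -- d(circle)) / (|u|² + |v|²). It is smooth because the exact forms of global functions are.
  refine ⟨leafMul (leafD _ (heightFn (m + 1))) a + leafMul (leafD _ (circleFn (m + 1))) b, ?_⟩
  ext x
  change (starRingEnd ℂ) (u x) * (_)⁻¹ * u x + (starRingEnd ℂ) (v x) * (_)⁻¹ * v x = 1
  have := hX.normSq_ne_zero h0 h1 x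
  change (u x * (starRingEnd ℂ) (u x) + v x * (starRingEnd ℂ) (v x)) ≠ 0 at this
  refine Eq.trans ?_ (mul_inv_cancel₀ this)
  ring

/-- Evaluation on a nowhere vanishing tangent field identifies leafwise forms with functions. -/
def evalEquiv (hX : IsReebTangent lam X) (h0 : 0 < lam) (h1 : lam < 1) :
    LeafForm (reebLine (m + 1) lam) ≃L[ℂ] SmoothFn (hopfModel (m + 1)) (Hopf (m + 1)) where
  __ := evalVFEquiv ⟨X, hX.mem⟩ (hX.exists_smul_of_mem h0 h1) (hX.exists_dual h0 h1).choose
    (hX.exists_dual h0 h1).choose_spec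
  continuous_toFun := continuous_evalVF _
  continuous_invFun := continuous_leafMul h0 h1 _

end IsReebTangent

theorem isReebTangent_reebField (h0 : 0 < lam) (h1 : lam < 1) :
    IsReebTangent lam (reebField m h0 h1) where
  ne_zero x hx := by
    have h : ∀ f : SmoothFn (hopfModel (m + 1)) (Hopf (m + 1)),
        vfDeriv (reebField m h0 h1) f x = 0 := fun f => by
      change mvfderiv _ f x (reebField m h0 h1 x) = 0
      rw [hx, map_zero]
    exact (vfDeriv_heightFn_or_circleFn_ne_zero h0 h1 x).elim (· (h _)) (· (h _))
  mem := reebField_mem h0 h1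

end ReebForm

/-! ### Continuous linear operations on C^∞, and quotients by split maps -/

section TopologicalModule

theorem smoothSmall_const {ι : Type*} {l : Filter ι} {E F : Type} [NormedAddCommGroup E]
    [NormedSpace ℝ E] [NormedAddCommGroup F] [NormedSpace ℝ F] {U : Set E} {a : ι → F}
    (hU : IsOpen U) (ha : Tendsto a l (𝓝 0)) : SmoothSmall l U (fun i _ => a i) := by
  intro k
  cases k with
  | zero =>
    exact (ckSmall_zero_iff hU).2 ⟨fun i => continuousOn_const, fun x _ => ha.comp tendsto_fst⟩
  | succ k =>
    refine (ckSmall_succ_iff hU).2 ⟨fun i => differentiableOn_const _,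
      fun x _ => ha.comp tendsto_fst, ?_⟩
    have h : (fun i => fderiv ℝ fun _ : E => a i) = fun _ _ => 0 :=
      funext fun i => funext fun x => fderiv_const_apply _
    rw [h]
    exact smoothSmall_zero k

variable {d : ℕ}

/-- The topology is defined by charts and does not involve the ratio of the homothety; continuity
may be tested on any covering, here the one of ratio 1/2. -/
instance : IsTopologicalAddGroup (SmoothFn (hopfModel d) (Hopf d)) where
  continuous_add := continuous_of_smoothSmall_lift one_half_pos one_half_lt_one
    (LinearMap.fst ℂ _ _ + LinearMap.snd ℂ _ _) fun v =>
      SmoothSmall.add isOpen_compl_singleton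
        ((tendsto_hopf_iff one_half_pos one_half_lt_one).1 continuousAt_fst)
        ((tendsto_hopf_iff one_half_pos one_half_lt_one).1 continuousAt_snd)
  continuous_neg := continuous_of_smoothSmall_lift one_half_pos one_half_lt_one
    (-LinearMap.id : SmoothFn (hopfModel d) (Hopf d) →ₗ[ℂ] _) fun v =>
      (smoothSmall_lift one_half_pos one_half_lt_one v).neg isOpen_compl_singleton

/-- Evaluation of smooth functions at a point. -/
def evalCLM (x : Hopf d) : SmoothFn (hopfModel d) (Hopf d) →L[ℂ] ℂ where
  toFun f := f x
  map_add' _ _ := rfl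
  map_smul' _ _ := rfl
  cont := by
    obtain ⟨p, hp, rfl⟩ := hopfMap_surjective one_half_pos one_half_lt_one x
    refine continuous_iff_continuousAt.2 fun f => tendsto_sub_nhds_zero_iff.1 ?_
    exact (smoothSmall_lift one_half_pos one_half_lt_one f).tendsto_at hp

/-- The line spanned by a smooth function. -/
def lineCLM (g : SmoothFn (hopfModel d) (Hopf d)) : ℂ →L[ℂ] SmoothFn (hopfModel d) (Hopf d) where
  toLinearMap := LinearMap.toSpanSingleton ℂ _ g
  cont := continuous_of_smoothSmall_lift one_half_pos one_half_lt_one _ fun c =>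
    (smoothSmall_const isOpen_compl_singleton (tendsto_sub_nhds_zero_iff.2 tendsto_id)).mul
      isOpen_compl_singleton (contDiffOn_lift g _)

end TopologicalModule

section Quotient

variable {V W : Type*} [AddCommGroup V] [Module ℂ V] [TopologicalSpace V]
    [AddCommGroup W] [Module ℂ W] [TopologicalSpace W]

/-- A continuous linear map with a continuous right inverse identifies the quotient by its kernel
with its target. -/
def quotientEquivOfRightInverse (D : Submodule ℂ V) (π : V →L[ℂ] W) (S : W →L[ℂ] V)
    (hπ : ∀ v, π v = 0 ↔ v ∈ D) (hS : ∀ w, π (S w) = w) : (V ⧸ D) ≃L[ℂ] W :=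
  ContinuousLinearEquiv.equivOfInverse (D.liftQL π fun v hv => (hπ v).2 hv) (D.mkQL ∘L S)
    (fun c => by
      induction c using Submodule.Quotient.induction_on with
      | H v =>
        refine (Submodule.Quotient.eq D).2 ((hπ _).1 ?_)
        exact (map_sub π _ v).trans (sub_eq_zero.2 (hS (π v))))
    hS

end Quotient

/-! ### The isomorphism of the leafwise cohomology with C^∞(S^m × S^1) -/

section Cohomology

variable {m : ℕ} {lam : ℝ}

local notation "𝒮" d => SmoothFn (hopfModel d) (Hopf d)

/-- The map on smooth functions whose kernel is the space of leafwise exact densities. -/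
def classMap (m : ℕ) (h0 : 0 < lam) (h1 : lam < 1) : (𝒮 (m + 1)) →L[ℂ] 𝒮 m :=
  let G : (𝒮 (m + 1)) →L[ℂ] 𝒮 m := ⟨gapMap h0 h1, continuous_gapMap h0 h1⟩
  let c₁ : (𝒮 (m + 1)) →L[ℂ] ℂ := ⟨periodMap h0 h1 one_ne_zero, continuous_periodMap h0 h1 _⟩
  let c₂ : (𝒮 (m + 1)) →L[ℂ] ℂ :=
    ⟨periodMap h0 h1 (neg_ne_zero.2 one_ne_zero), continuous_periodMap h0 h1 _⟩
  let U : (𝒮 m) →L[ℂ] 𝒮 m := ⟨unfoldHopf m h0 h1, continuous_unfoldHopf h0 h1⟩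
  -- Removing the base value of the gap leaves room for one constant, taken by the first period. `U`
  -- then maps bijectively onto the functions vanishing at the base point, which leaves room for the
  -- second period.
  U ∘L (G - lineCLM 1 ∘L evalCLM (basePoint m lam) ∘L G + lineCLM 1 ∘L c₁) + lineCLM 1 ∘L c₂

theorem classMap_apply (h0 : 0 < lam) (h1 : lam < 1) (g : 𝒮 (m + 1)) :
    classMap m h0 h1 g = unfoldHopf m h0 h1 (gapMap h0 h1 g -
      gapMap h0 h1 g (basePoint m lam) • 1 + periodMap h0 h1 one_ne_zero g • 1) +
      periodMap h0 h1 (neg_ne_zero.2 one_ne_zero) g • 1 := rfl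

theorem classMap_eq_zero_iff (h0 : 0 < lam) (h1 : lam < 1) (g : 𝒮 (m + 1)) :
    classMap m h0 h1 g = 0 ↔ IsLeafExact lam g := by
  rw [isLeafExact_iff h0 h1, classMap_apply]
  set W := gapMap h0 h1 g
  set a := periodMap h0 h1 one_ne_zero g
  set b := periodMap h0 h1 (neg_ne_zero.2 one_ne_zero) g
  constructor
  · intro h
    -- The three data are read back in turn: the base value gives `b`, folding removes `U`, and the
    -- base value of what remains gives `a`.
    have hb : b = 0 := by
      have := congrArg (fun f : 𝒮 m => f (basePoint m lam)) h
      simp only [ContMDiffMap.coe_add, Pi.add_apply, unfoldHopf_basePoint, smul_one_apply,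
        zero_add] at this
      exact this
    have hW : W - W (basePoint m lam) • 1 + a • 1 = 0 := by
      have := congrArg (foldHopf m h0 h1) h
      rwa [hb, zero_smul, add_zero, foldHopf_unfoldHopf, map_zero] at this
    have hx : ∀ x, W x - W (basePoint m lam) + a = 0 := fun x => by
      have := congrArg (fun f : 𝒮 m => f x) hW
      simpa [ContMDiffMap.coe_add, ContMDiffMap.coe_sub, smul_one_apply] using this
    have ha : a = 0 := by simpa using hx (basePoint m lam)
    exact ⟨ha, hb, W (basePoint m lam), fun x => by simpa [ha, sub_eq_zero] using hx x⟩
  · rintro ⟨ha, hb, κ, hκ⟩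
    have hW : W - W (basePoint m lam) • 1 = 0 := by
      ext x
      rw [ContMDiffMap.coe_sub, Pi.sub_apply, smul_one_apply, hκ, hκ, sub_self]
      rfl
    rw [ha, hb, hW, zero_smul, add_zero, add_zero, map_zero]

theorem exists_classMap_rightInverse (h0 : 0 < lam) (h1 : lam < 1) :
    ∃ S : (𝒮 m) →L[ℂ] 𝒮 (m + 1), ∀ f, classMap m h0 h1 (S f) = f := by
  have hm : (-1 : ℝ) ≠ 0 := neg_ne_zero.2 one_ne_zero
  obtain ⟨g₁, hg₁, hg₁1, hg₁2⟩ := exists_periodMap_eq (m := m) h0 h1 (.inl rfl) one_ne_zero hm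
  obtain ⟨g₂, hg₂, hg₂2, hg₂1⟩ := exists_periodMap_eq (m := m) h0 h1 (.inr rfl) hm
    (neg_ne_zero.2 hm)
  replace hg₂1 : periodMap h0 h1 one_ne_zero g₂ = 0 := by simpa only [neg_neg] using hg₂1
  let P : (𝒮 m) →L[ℂ] 𝒮 (m + 1) := ⟨gapSection h0 h1, continuous_gapSection h0 h1⟩
  let R : (𝒮 m) →L[ℂ] 𝒮 m := ⟨foldHopf m h0 h1, continuous_foldHopf h0 h1⟩
  let e := evalCLM (basePoint m lam)
  -- The data to be realized are the gap w = `foldHopf` f, the first period w(base) and the second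
  -- period f(base). Since w - w(base) + w(base) = w, `classMap` returns the unfolding of w plus
  -- f(base), which is f.
  refine ⟨P ∘L R + lineCLM g₁ ∘L e ∘L R + lineCLM g₂ ∘L e, fun f => ?_⟩
  have hS : (P ∘L R + lineCLM g₁ ∘L e ∘L R + lineCLM g₂ ∘L e) f = gapSection h0 h1 (foldHopf m h0 h1 f) +
    foldHopf m h0 h1 f (basePoint m lam) • g₁ + f (basePoint m lam) • g₂ := rfl
  rw [hS]
  generalize hw : foldHopf m h0 h1 f = w
  generalize hg : gapSection h0 h1 w + w (basePoint m lam) • g₁ + f (basePoint m lam) • g₂ = g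
  have hW : gapMap h0 h1 g = w := by
    rw [← hg, LinearMap.map_add, LinearMap.map_add, LinearMap.map_smul, LinearMap.map_smul,
      gapMap_gapSection, hg₁, hg₂, smul_zero, smul_zero, add_zero, add_zero]
  have ha : periodMap h0 h1 one_ne_zero g = w (basePoint m lam) := by
    rw [← hg, LinearMap.map_add, LinearMap.map_add, LinearMap.map_smul, LinearMap.map_smul,
      periodMap_gapSection, hg₁1, hg₂1, smul_zero, zero_add, add_zero, smul_eq_mul, mul_one]
  have hb : periodMap h0 h1 hm g = f (basePoint m lam) := by
    rw [← hg, LinearMap.map_add, LinearMap.map_add, LinearMap.map_smul, LinearMap.map_smul,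
      periodMap_gapSection, hg₁2, hg₂2, smul_zero, zero_add, zero_add, smul_eq_mul, mul_one]
  rw [classMap_apply, hW, ha, hb, sub_add_cancel, ← hw]
  exact unfoldHopf_foldHopf h0 h1 f

theorem evalEquiv_mem_ker_iff (h0 : 0 < lam) (h1 : lam < 1)
    (α : LeafForm (reebLine (m + 1) lam)) :
    classMap m h0 h1 ((isReebTangent_reebField h0 h1).evalEquiv h0 h1 α) = 0 ↔
      α ∈ LinearMap.range (leafD (reebLine (m + 1) lam)) := by
  rw [classMap_eq_zero_iff, ← mem_range_vfDeriv_iff h0 h1]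
  constructor
  · rintro ⟨f, hf⟩
    exact ⟨f, ((isReebTangent_reebField h0 h1).evalEquiv h0 h1).injective hf⟩
  · rintro ⟨f, rfl⟩
    exact ⟨f, rfl⟩

theorem nonempty_leafH1_equiv (h0 : 0 < lam) (h1 : lam < 1) :
    Nonempty (LeafH1 (reebLine (m + 1) lam) ≃L[ℂ] 𝒮 m) := by
  obtain ⟨S, hS⟩ := exists_classMap_rightInverse (m := m) h0 h1
  exact ⟨quotientEquivOfRightInverse _ ((classMap m h0 h1).comp
    ((isReebTangent_reebField h0 h1).evalEquiv h0 h1).toContinuousLinearMap)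
    (((isReebTangent_reebField h0 h1).evalEquiv h0 h1).symm.toContinuousLinearMap.comp S)
    (evalEquiv_mem_ker_iff h0 h1)
    fun f => (congrArg (classMap m h0 h1) (ContinuousLinearEquiv.apply_symm_apply _ _)).trans (hS f)⟩

end Cohomology

/-! ### Invariant distributions as the dual of the cohomology -/

section Duality

variable {m : ℕ} {lam : ℝ}

/-- Transposition of the isomorphism α ↦ α(X): it carries exact forms to X-derivatives, so a form on
the quotient is the same as a distribution killed by X. Evaluation of the image of T at a class [α]
is evaluation of T at α(X), whence continuity both ways. -/
theorem IsReebTangent.exists_dualEquiv {X : SmoothVF (hopfModel (m + 1)) (Hopf (m + 1))}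
    (hX : IsReebTangent lam X) (h0 : 0 < lam) (h1 : lam < 1) :
    ∃ Φ : invariantDistributions X ≃L[ℂ] WeakDual ℂ (LeafH1 (reebLine (m + 1) lam)),
      ∀ (T : invariantDistributions X) (α : LeafForm (reebLine (m + 1) lam)),
        Φ T (Submodule.Quotient.mk α) = T.1 (evalVF ⟨X, hX.mem⟩ α) := by
  let ε := hX.evalEquiv h0 h1
  let D := LinearMap.range (leafD (reebLine (m + 1) lam))
  let F (T : invariantDistributions X) : WeakDual ℂ (LeafH1 (reebLine (m + 1) lam)) :=
    D.liftQL ((T.1 : _ →L[ℂ] ℂ) ∘L (ε : _ →L[ℂ] SmoothFn (hopfModel (m + 1)) (Hopf (m + 1)))) (by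
      rintro _ ⟨φ, rfl⟩
      exact neg_eq_zero.1 (T.2 φ))
  let G (S : WeakDual ℂ (LeafH1 (reebLine (m + 1) lam))) : invariantDistributions X :=
    ⟨(S : _ →L[ℂ] ℂ) ∘L D.mkQL ∘L
      (ε.symm : SmoothFn (hopfModel (m + 1)) (Hopf (m + 1)) →L[ℂ] _), fun φ => by
      have h : ε.symm (vfDeriv X φ) = leafD _ φ := ε.symm_apply_eq.2 rfl
      change -S (Submodule.Quotient.mk (ε.symm (vfDeriv X φ))) = 0
      rw [h, (Submodule.Quotient.mk_eq_zero D).2 (LinearMap.mem_range_self _ φ), map_zero,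
        neg_zero]⟩
  have hF : ∀ T α, F T (Submodule.Quotient.mk α) = T.1 (evalVF ⟨X, hX.mem⟩ α) := fun _ _ => rfl
  have ext_quot : ∀ {S S' : WeakDual ℂ (LeafH1 (reebLine (m + 1) lam))},
      (∀ α, S (Submodule.Quotient.mk α) = S' (Submodule.Quotient.mk α)) → S = S' := by
    intro S S' h
    refine DFunLike.ext _ _ fun c => ?_
    induction c using Submodule.Quotient.induction_on with
    | H α => exact h α
  refine ⟨{ toFun := F
            map_add' := fun T T' => ext_quot fun α => rfl
            map_smul' := fun c T => ext_quot fun α => rfl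
            invFun := G
            left_inv := fun T => ?_
            right_inv := fun S => ext_quot fun α => ?_
            continuous_toFun := ?_
            continuous_invFun := ?_ }, hF⟩
  · refine Subtype.ext (DFunLike.ext _ _ fun f => ?_)
    exact congrArg T.1 (ε.apply_symm_apply f)
  · exact congrArg (fun β => S (Submodule.Quotient.mk β)) (ε.symm_apply_apply α)
  · refine WeakDual.continuous_of_continuous_eval fun c => ?_
    induction c using Submodule.Quotient.induction_on with
    | H α => exact (WeakDual.eval_continuous (evalVF ⟨X, hX.mem⟩ α)).comp continuous_subtype_val
  · refine Continuous.subtype_mk (WeakDual.continuous_of_continuous_eval fun f => ?_) _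
    exact WeakDual.eval_continuous _

/-- The weak dual of a topological isomorphism. -/
def weakDualCongr {V W : Type*} [AddCommGroup V] [Module ℂ V] [TopologicalSpace V]
    [AddCommGroup W] [Module ℂ W] [TopologicalSpace W] (e : V ≃L[ℂ] W) :
    WeakDual ℂ V ≃L[ℂ] WeakDual ℂ W where
  toFun S := (S : V →L[ℂ] ℂ) ∘L (e.symm : W →L[ℂ] V)
  map_add' _ _ := rfl
  map_smul' _ _ := rfl
  invFun S := (S : W →L[ℂ] ℂ) ∘L (e : V →L[ℂ] W)
  left_inv S := DFunLike.ext _ _ fun v => congrArg S (e.symm_apply_apply v)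
  right_inv S := DFunLike.ext _ _ fun w => congrArg S (e.apply_symm_apply w)
  continuous_toFun := WeakDual.continuous_of_continuous_eval fun _ => WeakDual.eval_continuous _
  continuous_invFun := WeakDual.continuous_of_continuous_eval fun _ => WeakDual.eval_continuous _

theorem weakDualCongr_apply_apply {V W : Type*} [AddCommGroup V] [Module ℂ V] [TopologicalSpace V]
    [AddCommGroup W] [Module ℂ W] [TopologicalSpace W] (e : V ≃L[ℂ] W) (S : WeakDual ℂ V) (v : V) :
    weakDualCongr e S (e v) = S v :=
  congrArg S (e.symm_apply_apply v)

end Duality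

end

end ReebFlow

theorem mainTheorem2 (n : ℕ) (hn : 2 ≤ n) (lam : ℝ) (hlam0 : 0 < lam) (hlam1 : lam < 1) :
    ∃ Ψ : LeafH1 (reebLine n lam) ≃L[ℂ] SmoothFn (hopfModel (n - 1)) (Hopf (n - 1)),
    ∀ (X : SmoothVF (hopfModel n) (Hopf n)) (hX0 : ∀ x, X x ≠ 0)
      (hX : ∀ x, X x ∈ reebLine n lam x),
    ∃ (Φ : invariantDistributions X ≃L[ℂ] WeakDual ℂ (LeafH1 (reebLine n lam)))
      (Θ : invariantDistributions X ≃L[ℂ] Distribution (hopfModel (n - 1)) (Hopf (n - 1))),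
      (∀ (T : invariantDistributions X) (α : LeafForm (reebLine n lam)),
        Φ T (Submodule.Quotient.mk α) = T.1 (evalVF ⟨X, hX⟩ α)) ∧
      (∀ (T : invariantDistributions X) (c : LeafH1 (reebLine n lam)),
        Θ T (Ψ c) = Φ T c) := by
  generalize hm : n - 1 = m
  obtain rfl : n = m + 1 := by omega
  -- This isomorphism is built from the frame `reebField` and fixed before X; only Φ depends on X.
  have Ψ := (nonempty_leafH1_equiv (m := m) hlam0 hlam1).some
  refine ⟨Ψ, fun X hX0 hX => ?_⟩
  have hΦ := IsReebTangent.exists_dualEquiv ⟨hX0, hX⟩ hlam0 hlam1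
  exact ⟨hΦ.choose, hΦ.choose.trans (weakDualCongr Ψ), hΦ.choose_spec,
    fun T c => weakDualCongr_apply_apply Ψ (hΦ.choose T) c⟩
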